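/- **Theorem (soundness of the operational semantics of $\lambda^{\mathcal P_c}$).** Fix an integer $d\ge 2$. If $\cdot\vdash e:Q$ in $\lambda^{\mathcal P_c}$ and $e\to e'$, then $[\![e]\!]$ and $[\![e']\!]$ are well-defined morphisms of $\mathcal P_c(\bullet,[\![Q]\!])$ (in particular $\cdot\vdash e':Q$, and neither interpretation depends on the chosen typing derivation), and $[\![e]\!]=[\![e']\!]$. The notions are as follows. *Arithmetic.* Let $d'=d$ if $d$ is odd and $d'=2d$ if $d$ is even. For $r\in\mathbb Z_d$ let $\underline r\in\mathbb Z_{d'}$ be its representative in $\{0,\dots,d-1\}$; $\overline{\,\cdot\,}:\mathbb Z_{d'}\to\mathbb Z_d$ is reduction. Put $\mathrm{sgn}(r')=\frac1d(r'-\underline{\overline{r'}})\in\{0,1\}$ for $r'\in\mathbb Z_{d'}$. On vectors with coordinates $(x_i,z_i)_{i\le n}$ put $\omega(u,v)=\sum_i (z_i(u)x_i(v)-z_i(v)x_i(u))\in\mathbb Z_d$; the same formula modulo $d'$ is $\omega'$, and $\mathrm{sgn}(w)=\frac1d\,\omega'(w,\underline{\overline w})$. A phase $\frac d2k$ is read as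 $0$ if $d$ is odd. *The category $\mathcal P_c$.* Objects are $\bullet$ and $\mathbf P(V)$, for $V$ a free $\mathbb Z_d$-module of rank $2n$ with an ordered basis split into conjugate pairs $(b^x_i,b^z_i)_{i\le n}$ and the form $\omega$ of that basis. A morphism $\mathbf P(V)\to \mathbf P(W)$ is a pair $(\mu,\psi)$ with $\mu:V\to\mathbb Z_d$ linear and $\psi:V\to W$ linear with $\omega(\psi u,\psi v)=\omega(u,v)$; a morphism $\bullet\to \mathbf P(W)$ is a pair of linear maps $\mu:\mathbb Z_d\to\mathbb Z_d$, $\psi:\mathbb Z_d\to W$; $\mathcal P_c(\bullet,\bullet)$ consists of the linear maps $\mathbb Z_d\to\mathbb Z_d$. Composition is $(\mu_2,\psi_2)\circ(\mu_1,\psi_1)=(\mu_3,\psi_2\psi_1)$ where $\mu_3$ is the linear map with $\mu_3(b)=\mu_1(b)+\mu_2(\psi_1 b)+\frac d2\kappa^{\psi_2}(\psi_1 b)$ on basis vectors $b$. Here, for $v=\sum_i x_ib^x_i+z_ib^z_i$ and $w_i=\underline{x_i}\,\underline{\psi(b^x_i)}+\underline{z_i}\,\underline{\psi(b^z_i)}$,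 $$\kappa^\psi(v)=\frac1d\Big(\sum_{i}\underline{x_i}\,\underline{z_i}\big(1+\omega'(\underline{\psi(b^x_i)},\underline{\psi(b^z_i)})\big)+\sum_{i<j}\omega'(w_i,w_j)+\sum_i\omega'(w_i,\underline{\psi(v)})\Big)\in\{0,1\},$$ computed modulo $d'$. Further, $(t,v)\circ r=(rt+\frac d2\mathrm{sgn}(\underline r\,\underline v),rv)$ for $r\in\mathcal P_c(\bullet,\bullet)$; $\langle\mu'\rangle(\mu,\psi)=(\mu'+\mu,\psi)$; on $\mathcal P_c(\bullet,\mathbf P(W))$, $(t_1,v_1)\star(t_2,v_2)=\big(t_1+t_2+\frac d2(\mathrm{sgn}\,\omega'(\underline{v_1},\underline{v_2})+\mathrm{sgn}(\underline{v_1}+\underline{v_2})),\,v_1+v_2\big)$; and $(\mu_1,\psi_1)\boxplus(\mu_2,\psi_2)=(\mu_1\boxplus\mu_2,\psi_1\boxplus\psi_2)$ with $(f_1\boxplus f_2)(u_1\oplus u_2)=f_1u_1+f_2u_2$, which is a morphism only when $\psi_1\boxplus\psi_2$ preserves $\omega$. *The linear calculus $\lambda^{\mathcal C}$.* Types $\alpha::=\mathbb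 1\mid\alpha\oplus\alpha\mid\alpha\multimap\alpha$; expressions (up to renaming of bound variables) $a::=x\mid \mathsf{let}\,x=a\,\mathsf{in}\,a'\mid \mathbf 0_\alpha\mid r\mid a\cdot a'\mid a+a'\mid[a,a']\mid\mathsf{case}\,a\,\{\iota_1x_1\to a_1\mid\iota_2x_2\to a_2\}\mid\lambda x{:}\alpha.a\mid a\,a'$ with $r\in\mathbb Z_d$; $\iota_1a=[a,\mathbf 0]$, $\iota_2a=[\mathbf 0,a]$; values $v::=r\mid[v,v]\mid\lambda x{:}\alpha.a$. Typing is linear: the context is split between the two parts of $\mathsf{let}$, $\cdot$, application and between scrutinee and branches of $\mathsf{case}$; it is shared in $+$, $[\,,]$ and between branches; $r:\mathbb 1$ needs the empty context and $\mathbf 0_\alpha:\alpha$ any context. Reduction is call-by-value, left to right, with the usual $\beta$-rules for $\mathsf{let}$ and application, $\mathsf{case}\,[v_1,v_2]\,\{\dots\}\to a_1\{v_1/x_1\}+a_2\{v_2/x_2\}$, and the rules evaluating $\mathbf 0_\alpha$, $r\cdot v$ and $v+v'$ componentwise (pointwise on functions). A context $\Delta$ and type $\alpha$ denote $\mathbb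 Z_d$-modules ($[\![\mathbb 1]\!]=\mathbb Z_d$, direct sum, module of linear maps; contexts denote tensor products), and $\Delta\vdash a:\alpha$ denotes the evident linear map $[\![a]\!]:[\![\Delta]\!]\to[\![\alpha]\!]$. Write $a\downarrow v$ if $a\to^*v$ with $v$ a value. Equivalence $\Delta\vdash a_1\equiv a_2:\alpha$ means: both are typed, and for all related closed value substitutions $\delta_1,\delta_2$ for $\Delta$, $\delta_1(a_1)$ and $\delta_2(a_2)$ are related at $\alpha$, where closed expressions of type $\alpha$ are related if any values they reduce to are related, values of type $\mathbb 1$ are related if equal, pairs componentwise, and functions if they map related values to related expressions. *The calculus $\lambda^{\mathcal P_c}$.* Types $Q::=\mathsf{Pauli}\mid Q_1\bullet Q_2$, with $\overline{\mathsf{Pauli}}=\mathbb 1\oplus\mathbb 1$, $\overline{Q_1\bullet Q_2}=\overline{Q_1}\oplus\overline{Q_2}$. Expressions $e::=x\mid\mathsf{let}\,x=e\,\mathsf{in}\,e'\mid a\mid\langle a\rangle e\mid e\star e'\mid\mathsf{pow}(e,r)\mid\mathsf{case}\,e\,\{X\to e_x\mid Z\to e_z\}\mid\iota_ie\mid\mathsf{case}\,e\,\{\iota_1x_1\to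 e_1\mid\iota_2x_2\to e_2\}$. The underlying $\lambda^{\mathcal C}$-expression $e^\psi$ drops phases: $(\langle a\rangle e)^\psi=e^\psi$, $(e_1\star e_2)^\psi=e_1^\psi+e_2^\psi$, $\mathsf{pow}(e,r)^\psi=r\cdot e^\psi$, $(\mathsf{case}\,e\{X\to e_x\mid Z\to e_z\})^\psi=\mathsf{case}\,e^\psi\{\iota_1x_1\to x_1\cdot e_x^\psi\mid\iota_2x_2\to x_2\cdot e_z^\psi\}$, and it commutes with the other constructors. Write $\omega_Q(e_1,e_2)$ for $\omega_{\overline Q}\,e_1^\psi\,e_2^\psi$, with $\omega_{\overline Q}:\overline Q\multimap\overline Q\multimap\mathbb 1$ the $\lambda^{\mathcal C}$-term for $\omega$. A context $\Theta$ has at most one variable. Typing rules: $x{:}Q\vdash x:Q$; $\mathsf{let}$ from $\Theta\vdash e:Q$ and $x{:}Q\vdash e':Q'$; $\cdot\vdash a:Q$ if $\cdot\vdash a:\overline Q$ in $\lambda^{\mathcal C}$; $\Theta\vdash\langle a\rangle e:Q$ if $\overline\Theta\vdash a:\mathbb 1$ and $\Theta\vdash e:Q$; $\star$ and $\mathsf{pow}$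 for closed expressions of type $Q$; the $X/Z$-case has type $Q$ if $\Theta\vdash e:\mathsf{Pauli}$, $\cdot\vdash e_x,e_z:Q$ and $\cdot\vdash\omega_Q(e_z,e_x)\equiv1$; $\Theta\vdash\iota_ie:Q_1\bullet Q_2$ if $\Theta\vdash e:Q_i$; the $\iota$-case has type $Q'$ if $\Theta\vdash e:Q_1\bullet Q_2$, $x_i{:}Q_i\vdash e_i:Q'$ and $x_1{:}\overline{Q_1},x_2{:}\overline{Q_2}\vdash\omega_{Q'}(e_1,e_2)\equiv\mathbf 0$. Reduction $e\to e'$ is generated under call-by-value evaluation contexts (including reduction of $\lambda^{\mathcal C}$-expressions occurring as $a$ or as the phase of $\langle a\rangle e$) by the following rules, with $v,v_i$ values: - $\mathsf{let}\,x=\langle r\rangle v\,\mathsf{in}\,e'\to\langle r\rangle e'\{v/x\}$; $\langle r'\rangle\langle r\rangle v\to\langle r'+r\rangle v$; $v\to\langle0\rangle v$; $\iota_i\langle r\rangle v\to\langle r\rangle\iota_i(v)$; - $\langle r_1\rangle v_1\star\langle r_2\rangle v_2\to\langle r_1+r_2+k\rangle(v_1+v_2)$, $k=\frac d2(\mathrm{sgn}\,\omega'(\underline{v_1},\underline{v_2})+\mathrm{sgn}(\underline{v_1}+\underline{v_2}))$;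 - $\mathsf{pow}(\langle r\rangle v,r')\to\langle r'r+k\rangle(r'\cdot v)$, $k=\frac d2\mathrm{sgn}(\underline{r'}\,\underline v)$; - $\mathsf{case}\,\langle r\rangle[r_x,r_z]\{X\to e_x\mid Z\to e_z\}\to\langle r+k\rangle(\mathsf{pow}(e_z,r_z)\star\mathsf{pow}(e_x,r_x))$, $k=\frac d2\mathrm{sgn}(\underline{r_x}\,\underline{r_z})$; - $\mathsf{case}\,\langle r\rangle[v_1,v_2]\{\iota_1x_1\to e_1\mid\iota_2x_2\to e_2\}\to\langle r\rangle(e_1\{v_1/x_1\}\star e_2\{v_2/x_2\})$. *Interpretation.* $[\![Q]\!]=\mathbf P([\![\overline Q]\!])$, $[\![\cdot]\!]=\bullet$, $[\![x{:}Q]\!]=[\![Q]\!]$, and $\Theta\vdash e:Q$ denotes a morphism $[\![\Theta]\!]\to[\![Q]\!]$: $[\![x]\!]=(0,\mathrm{id})$; $[\![\mathsf{let}\,x=e\,\mathsf{in}\,e']\!]=[\![e']\!]\circ[\![e]\!]$; $[\![a]\!]=(0,[\![a]\!])$; $[\![\langle a\rangle e]\!]=\langle[\![a]\!]\rangle[\![e]\!]$;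 $[\![e_1\star e_2]\!]=[\![e_1]\!]\star[\![e_2]\!]$; $[\![\mathsf{pow}(e,r)]\!]=[\![e]\!]\circ r$; $[\![\iota_ie]\!]=(0,\iota_i)\circ[\![e]\!]$; the two case expressions denote $([\![e_x]\!]\boxplus[\![e_z]\!])\circ[\![e]\!]$ and $([\![e_1]\!]\boxplus[\![e_2]\!])\circ[\![e]\!]$. -/

import Mathlib

open scoped TensorProduct

namespace ProjCliff

noncomputable section

/-! Arithmetic modulo `d` and modulo `d'`. -/

/-- The modulus `d'`, which is `d` for odd `d` and `2 * d` for even `d`. -/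
def dExt (d : ℕ) : ℕ := if Even d then 2 * d else d

/-- The inclusion of representatives `{0, ..., d - 1}` into the integers mod `d'`
(an underline on paper; it is not additive). -/
def liftZ {d : ℕ} (r : ZMod d) : ZMod (dExt d) := (r.val : ZMod (dExt d))

/-- Reduction mod `d` (an overline on paper). -/
def redZ {d : ℕ} (r : ZMod (dExt d)) : ZMod d := (r.val : ZMod d)

/-- The operation `(1/d) t`, used only where `t` is `0` or `d` modulo `d'`. Its value is `0` or `1`,
and it is always `0` if `d` is odd. -/
def overD (d : ℕ) (t : ZMod (dExt d)) : ℕ := t.val / d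

/-- The sign `(1/d) (r - lift (red r))` of a scalar mod `d'`. -/
def sgn {d : ℕ} (r : ZMod (dExt d)) : ℕ := overD d (r - liftZ (redZ r))

/-- The phase `(d/2) k` in the integers mod `d`, for an integer `k`
(which vanishes whenever `d` is odd). -/
def halfD (d : ℕ) (k : ℕ) : ZMod d := ((d / 2 * k : ℕ) : ZMod d)

/-! The category of finitely generated free modules with ordered bases. Its morphisms are
the linear maps. -/

/-- A finitely generated free module over the integers mod `d` with an ordered basis. -/
structure CObj (d : ℕ) where
  carrier : Type
  [addCommGroup : AddCommGroup carrier]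
  [module : Module (ZMod d) carrier]
  rank : ℕ
  basis : Module.Basis (Fin rank) (ZMod d) carrier

attribute [instance] CObj.addCommGroup CObj.module

instance (d : ℕ) : CoeSort (CObj d) Type := ⟨CObj.carrier⟩

/-- The ring itself. -/
abbrev CObj.unit (d : ℕ) : CObj d where
  carrier := ZMod d
  rank := 1
  basis := Module.Basis.singleton (Fin 1) (ZMod d)

/-- The biproduct. -/
abbrev CObj.sum {d : ℕ} (A B : CObj d) : CObj d where
  carrier := A × B
  rank := A.rank + B.rank
  basis := (A.basis.prod B.basis).reindex finSumFinEquiv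

/-- The tensor product with the Kronecker basis. -/
abbrev CObj.tensor {d : ℕ} (A B : CObj d) : CObj d where
  carrier := A ⊗[ZMod d] B
  rank := A.rank * B.rank
  basis := (A.basis.tensorProduct B.basis).reindex finProdFinEquiv

/-- The module of linear maps. -/
abbrev CObj.hom {d : ℕ} (A B : CObj d) : CObj d where
  carrier := A →ₗ[ZMod d] B
  rank := B.rank * A.rank
  basis := (A.basis.linearMap B.basis).reindex finProdFinEquiv

/-! Symplectic modules. -/

/-- A free module whose ordered basis is split into conjugate pairs `(b^x_i, b^z_i)`, for `i < n`.
It carries the canonical symplectic form `SObj.omega` of that basis. -/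
structure SObj (d : ℕ) extends CObj d where
  n : ℕ
  pair : Fin n ⊕ Fin n ≃ Fin rank

instance (d : ℕ) : CoeSort (SObj d) Type := ⟨fun V => V.toCObj.carrier⟩

namespace SObj

variable {d : ℕ} (V : SObj d)

/-- The basis vector `b^x_i`. -/
def bx (i : Fin V.n) : V := V.basis (V.pair (Sum.inl i))

/-- The basis vector `b^z_i`. -/
def bz (i : Fin V.n) : V := V.basis (V.pair (Sum.inr i))

/-- The coordinate of `v` at `b^x_i`. -/
def x (v : V) (i : Fin V.n) : ZMod d := V.basis.repr v (V.pair (Sum.inl i))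

/-- The coordinate of `v` at `b^z_i`. -/
def z (v : V) (i : Fin V.n) : ZMod d := V.basis.repr v (V.pair (Sum.inr i))

/-- The symplectic form. -/
def omega (u v : V) : ZMod d := ∑ i, (V.z u i * V.x v i - V.z v i * V.x u i)

/-- Coordinate vectors modulo `d'`. -/
abbrev ExtVec : Type := Fin V.rank → ZMod (dExt d)

/-- The coordinates of `v`, lifted to the integers mod `d'`. -/
def lift (v : V) : V.ExtVec := fun j => liftZ (V.basis.repr v j)

/-- The extended symplectic form, computed modulo `d'`. -/
def omegaExt (a b : V.ExtVec) : ZMod (dExt d) :=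
  ∑ i, (a (V.pair (Sum.inr i)) * b (V.pair (Sum.inl i))
    - b (V.pair (Sum.inr i)) * a (V.pair (Sum.inl i)))

/-- The sign `(1/d) ω'(w, lift (red w))` of a vector mod `d'`. -/
def sgnVec (w : V.ExtVec) : ℕ := overD d (V.omegaExt w (fun j => liftZ (redZ (w j))))

/-- The symplectic sum of two symplectic modules. -/
abbrev sum (V W : SObj d) : SObj d where
  toCObj := V.toCObj.sum W.toCObj
  n := V.n + W.n
  pair := ((Equiv.sumCongr finSumFinEquiv.symm finSumFinEquiv.symm).trans
    (Equiv.sumSumSumComm _ _ _ _)).trans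
    ((Equiv.sumCongr V.pair W.pair).trans finSumFinEquiv)

/-- The phase space of a single qudit. -/
abbrev qudit (d : ℕ) : SObj d where
  toCObj := (CObj.unit d).sum (CObj.unit d)
  n := 1
  pair := finSumFinEquiv

/-- A linear map is a symplectic morphism if it respects the symplectic forms. -/
def IsSymplectic (V W : SObj d) (ψ : V →ₗ[ZMod d] W) : Prop :=
  ∀ u v : V, W.omega (ψ u) (ψ v) = V.omega u v

/-- The phase correction `κ^ψ(v)`, which is `0` or `1` for a symplectic morphism `ψ`. Write
`v = ∑ x_i b^x_i + z_i b^z_i` and let `w_i` be the vector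
`lift x_i * lift (ψ b^x_i) + lift z_i * lift (ψ b^z_i)` modulo `d'`. If `γ` is the center-fixing
multiplicative map with `γ(Δ_b) = Δ_(lift (ψ b))` on basis vectors `b`, then the rule
`Δ_a Δ_b = τ^(ω'(a,b)) Δ_(a+b)` turns `γ(Δ_(lift v))` into the ordered product over `i` of
`τ^(x_i z_i (1 + ω'(ψ b^x_i, ψ b^z_i))) Δ_(w_i)`; this product is
`(-1)^(κ^ψ(v)) Δ_(lift (ψ v))`. The double sum over `i < j` comes from multiplying the
factors `Δ_(w_i)` of different qudits. -/
def kappa (V W : SObj d) (ψ : V →ₗ[ZMod d] W) (v : V) : ℕ :=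
  let wx : Fin V.n → W.ExtVec := fun i => W.lift (ψ (V.bx i))
  let wz : Fin V.n → W.ExtVec := fun i => W.lift (ψ (V.bz i))
  let xl : Fin V.n → ZMod (dExt d) := fun i => liftZ (V.x v i)
  let zl : Fin V.n → ZMod (dExt d) := fun i => liftZ (V.z v i)
  let w : Fin V.n → W.ExtVec := fun i => xl i • wx i + zl i • wz i
  overD d
    (∑ i, (xl i * zl i * (1 + W.omegaExt (wx i) (wz i))
        + xl i * W.omegaExt (wx i) (W.lift (ψ v))
        + zl i * W.omegaExt (wz i) (W.lift (ψ v)))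
      + ∑ i, ∑ j ∈ Finset.Ioi i, W.omegaExt (w i) (w j))

end SObj

/-! The category of projective Cliffords. -/

/-- The objects: a unit object, and one object for each symplectic module. -/
inductive PObj (d : ℕ) : Type 1
  | unit : PObj d
  | pauli (V : SObj d) : PObj d

/-- The module underlying an object; it is the ring for the unit object. -/
def PObj.toCObj {d : ℕ} : PObj d → CObj d
  | .unit => CObj.unit d
  | .pauli V => V.toCObj

/-- The condition on the linear part of a morphism from `A` to `pauli W`: none if `A` is the unit,
and being a symplectic morphism otherwise. -/
def PObj.IsMor {d : ℕ} : (A : PObj d) → (W : SObj d) → (A.toCObj →ₗ[ZMod d] W) → Prop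
  | .unit, _, _ => True
  | .pauli V, W, ψ => SObj.IsSymplectic V W ψ

/-- Morphisms from `A` to `pauli W`: condensed encodings `(μ, ψ)`. -/
@[ext]
structure PHom {d : ℕ} (A : PObj d) (W : SObj d) where
  μ : A.toCObj →ₗ[ZMod d] CObj.unit d
  ψ : A.toCObj →ₗ[ZMod d] W
  isMor : A.IsMor W ψ

/-- Endomorphisms of the unit object. -/
abbrev UnitEnd (d : ℕ) : Type := CObj.unit d →ₗ[ZMod d] CObj.unit d

namespace PHom

variable {d : ℕ}

/-- The number `1` in the ring, as a module element. -/
def one (d : ℕ) : CObj.unit d := (1 : ZMod d)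

/-- The identity morphism `(0, id)`. -/
def id (V : SObj d) : PHom (.pauli V) V where
  μ := 0
  ψ := LinearMap.id
  isMor := fun _ _ => rfl

theorem isMor_comp {A : PObj d} {V W : SObj d} (φ : V →ₗ[ZMod d] W) (ψ : A.toCObj →ₗ[ZMod d] V)
    (hφ : SObj.IsSymplectic V W φ) (hψ : A.IsMor V ψ) : A.IsMor W (φ ∘ₗ ψ) := by
  cases A with
  | unit => trivial
  | pauli U => exact fun u v => (hφ _ _).trans (hψ u v)

/-- Composition `(μ₂, ψ₂) ∘ (μ₁, ψ₁)`. Its first component is the linear map with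
`b ↦ μ₁(b) + μ₂(ψ₁(b)) + (d/2) κ^(ψ₂)(ψ₁(b))` on basis vectors `b`. -/
def comp {A : PObj d} {V W : SObj d} (g : PHom (.pauli V) W) (f : PHom A V) : PHom A W where
  μ := A.toCObj.basis.constr (ZMod d) fun i =>
    let b := A.toCObj.basis i
    (f.μ b + g.μ (f.ψ b) + (halfD d (SObj.kappa V W g.ψ (f.ψ b)) : ZMod d) • one d :
      CObj.unit d)
  ψ := g.ψ ∘ₗ f.ψ
  isMor := isMor_comp g.ψ f.ψ g.isMor f.isMor

/-- Composition `(t, v) ∘ r` of a global element with an endomorphism of the unit: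
the power of a Pauli operator. -/
def compUnit {V : SObj d} (g : PHom .unit V) (r : UnitEnd d) : PHom .unit V where
  μ := LinearMap.toSpanSingleton (ZMod d) (CObj.unit d)
    (g.μ (r (one d)) +
      halfD d (V.sgnVec fun j => liftZ (r (one d)) * V.lift (g.ψ (one d)) j) • one d)
  ψ := g.ψ ∘ₗ r
  isMor := trivial

/-- Adding a phase: `⟨μ'⟩ (μ, ψ) = (μ' + μ, ψ)`. -/
def addPhase {A : PObj d} {V : SObj d} (μ' : A.toCObj →ₗ[ZMod d] CObj.unit d) (f : PHom A V) :
    PHom A V where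
  μ := μ' + f.μ
  ψ := f.ψ
  isMor := f.isMor

/-- The condensed product of two global elements. -/
def star {V : SObj d} (f g : PHom .unit V) : PHom .unit V where
  μ := LinearMap.toSpanSingleton (ZMod d) (CObj.unit d)
    (f.μ (one d) + g.μ (one d) +
      halfD d (sgn (V.omegaExt (V.lift (f.ψ (one d))) (V.lift (g.ψ (one d))))
        + V.sgnVec (V.lift (f.ψ (one d)) + V.lift (g.ψ (one d)))) • one d)
  ψ := f.ψ + g.ψ
  isMor := trivial

theorem pair_sum_inl (V W : SObj d) (s : Fin V.n ⊕ Fin V.n) :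
    (V.sum W).pair (Sum.map (Fin.castAdd W.n) (Fin.castAdd W.n) s)
      = finSumFinEquiv (Sum.inl (V.pair s)) := by
  cases s <;> simp

theorem pair_sum_inr (V W : SObj d) (s : Fin W.n ⊕ Fin W.n) :
    (V.sum W).pair (Sum.map (Fin.natAdd V.n) (Fin.natAdd V.n) s)
      = finSumFinEquiv (Sum.inr (W.pair s)) := by
  cases s <;> simp

theorem omega_sum (V W : SObj d) (p q : V × W) :
    (V.sum W).omega p q = V.omega p.1 q.1 + W.omega p.2 q.2 := by
  have hl : ∀ (p : V × W) (s : Fin V.n ⊕ Fin V.n),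
      (V.sum W).basis.repr p ((V.sum W).pair (Sum.map (Fin.castAdd W.n) (Fin.castAdd W.n) s))
        = V.basis.repr p.1 (V.pair s) := by
    intro p s
    rw [pair_sum_inl]
    simp
  have hr : ∀ (p : V × W) (s : Fin W.n ⊕ Fin W.n),
      (V.sum W).basis.repr p ((V.sum W).pair (Sum.map (Fin.natAdd V.n) (Fin.natAdd V.n) s))
        = W.basis.repr p.2 (W.pair s) := by
    intro p s
    rw [pair_sum_inr]
    simp
  refine (Fin.sum_univ_add _).trans ?_
  refine congrArg₂ (· + ·) (Finset.sum_congr rfl fun i _ => ?_)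
    (Finset.sum_congr rfl fun i _ => ?_)
  · exact congrArg₂ (· - ·)
      (congrArg₂ (· * ·) (hl p (Sum.inr i)) (hl q (Sum.inl i)))
      (congrArg₂ (· * ·) (hl q (Sum.inr i)) (hl p (Sum.inl i)))
  · exact congrArg₂ (· - ·)
      (congrArg₂ (· * ·) (hr p (Sum.inr i)) (hr q (Sum.inl i)))
      (congrArg₂ (· * ·) (hr q (Sum.inr i)) (hr p (Sum.inl i)))

theorem isSymplectic_inl (V W : SObj d) :
    SObj.IsSymplectic V (V.sum W) (LinearMap.inl (ZMod d) V W) := by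
  intro u v
  have h0 : W.omega 0 0 = 0 := by simp [SObj.omega, SObj.x, SObj.z]
  refine (omega_sum V W (u, 0) (v, 0)).trans ?_
  rw [h0, add_zero]

theorem isSymplectic_inr (V W : SObj d) :
    SObj.IsSymplectic W (V.sum W) (LinearMap.inr (ZMod d) V W) := by
  intro u v
  have h0 : V.omega 0 0 = 0 := by simp [SObj.omega, SObj.x, SObj.z]
  refine (omega_sum V W (0, u) (0, v)).trans ?_
  rw [h0, zero_add]

/-- The injection `(0, ι₁)`. -/
def inl (V W : SObj d) : PHom (.pauli V) (V.sum W) where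
  μ := 0
  ψ := LinearMap.inl (ZMod d) V W
  isMor := isSymplectic_inl V W

/-- The injection `(0, ι₂)`. -/
def inr (V W : SObj d) : PHom (.pauli W) (V.sum W) where
  μ := 0
  ψ := LinearMap.inr (ZMod d) V W
  isMor := isSymplectic_inr V W

open Classical in
/-- The pairing `f ⊞ g` of two global elements, as a morphism from the single-qudit object.
It is defined only if its linear part is a symplectic morphism. -/
def boxUnit {V : SObj d} (f g : PHom .unit V) : Option (PHom (.pauli (SObj.qudit d)) V) :=
  if h : SObj.IsSymplectic (SObj.qudit d) V (LinearMap.coprod f.ψ g.ψ) then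
    some ⟨LinearMap.coprod f.μ g.μ, LinearMap.coprod f.ψ g.ψ, h⟩
  else none

open Classical in
/-- The pairing `f ⊞ g` of morphisms out of two symplectic objects, as a morphism out of their sum.
It is defined only if its linear part is a symplectic morphism. -/
def boxPauli {V₁ V₂ V : SObj d} (f : PHom (.pauli V₁) V) (g : PHom (.pauli V₂) V) :
    Option (PHom (.pauli (V₁.sum V₂)) V) :=
  if h : SObj.IsSymplectic (V₁.sum V₂) V (LinearMap.coprod f.ψ g.ψ) then
    some ⟨LinearMap.coprod f.μ g.μ, LinearMap.coprod f.ψ g.ψ, h⟩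
  else none

end PHom

end

/-! The linear calculus for modules: types, expressions and typing. Variables are de Bruijn
indices, so that expressions are taken up to renaming of bound variables; `lam` and `zero` carry
their type. -/

inductive CTy : Type
  | unit : CTy
  | sum (α β : CTy) : CTy
  | fn (α β : CTy) : CTy

inductive CExpr (d : ℕ) : Type
  | var (i : ℕ) : CExpr d
  | letIn (a a' : CExpr d) : CExpr d
  | zero (α : CTy) : CExpr d
  | const (r : ZMod d) : CExpr d
  | smul (a a' : CExpr d) : CExpr d
  | add (a₁ a₂ : CExpr d) : CExpr d
  | pair (a₁ a₂ : CExpr d) : CExpr d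
  | case (a a₁ a₂ : CExpr d) : CExpr d
  | lam (α : CTy) (a : CExpr d) : CExpr d
  | app (a a' : CExpr d) : CExpr d

namespace CExpr

variable {d : ℕ}

/-- Renaming that makes room for a new variable with index `k`. -/
def shift (k : ℕ) : CExpr d → CExpr d
  | var i => if i < k then var i else var (i + 1)
  | letIn a a' => letIn (shift k a) (shift (k + 1) a')
  | zero α => zero α
  | const r => const r
  | smul a a' => smul (shift k a) (shift k a')
  | add a₁ a₂ => add (shift k a₁) (shift k a₂)
  | pair a₁ a₂ => pair (shift k a₁) (shift k a₂)
  | case a a₁ a₂ => case (shift k a) (shift (k + 1) a₁) (shift (k + 1) a₂)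
  | lam α a => lam α (shift (k + 1) a)
  | app a a' => app (shift k a) (shift k a')

/-- Substitution of the closed expression `v` for the variable with index `k`, which is removed. -/
def subst (k : ℕ) (v : CExpr d) : CExpr d → CExpr d
  | var i => if i < k then var i else if i = k then v else var (i - 1)
  | letIn a a' => letIn (subst k v a) (subst (k + 1) v a')
  | zero α => zero α
  | const r => const r
  | smul a a' => smul (subst k v a) (subst k v a')
  | add a₁ a₂ => add (subst k v a₁) (subst k v a₂)
  | pair a₁ a₂ => pair (subst k v a₁) (subst k v a₂)
  | case a a₁ a₂ => case (subst k v a) (subst (k + 1) v a₁) (subst (k + 1) v a₂)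
  | lam α a => lam α (subst (k + 1) v a)
  | app a a' => app (subst k v a) (subst k v a')

/-- Substitution of a list of closed expressions for the variables `0, 1, ...`. -/
def close : List (CExpr d) → CExpr d → CExpr d
  | [], a => a
  | v :: δ, a => close δ (subst 0 v a)

/-- The values. -/
inductive IsVal : CExpr d → Prop
  | const (r : ZMod d) : IsVal (const r)
  | pair {v₁ v₂ : CExpr d} : IsVal v₁ → IsVal v₂ → IsVal (pair v₁ v₂)
  | lam (α : CTy) (a : CExpr d) : IsVal (lam α a)

end CExpr

/-- A linear context. Its entry with number `i` is the type of the variable with index `i`, or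
`none` if that variable is not in the context. -/
abbrev CCtx : Type := List (Option CTy)

/-- The context without variables. -/
inductive CCtx.IsEmpty : CCtx → Type
  | nil : CCtx.IsEmpty []
  | cons {Δ : CCtx} : CCtx.IsEmpty Δ → CCtx.IsEmpty (none :: Δ)

/-- The context whose only variable has index `i` and type `α`. -/
inductive CCtx.Only : CCtx → ℕ → CTy → Type
  | here {Δ : CCtx} {α : CTy} : CCtx.IsEmpty Δ → CCtx.Only (some α :: Δ) 0 α
  | there {Δ : CCtx} {i : ℕ} {α : CTy} : CCtx.Only Δ i α → CCtx.Only (none :: Δ) (i + 1) α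

/-- `Merge Δ₁ Δ₂ Δ` says that `Δ` is the disjoint union of `Δ₁` and `Δ₂`. -/
inductive CCtx.Merge : CCtx → CCtx → CCtx → Type
  | nil : CCtx.Merge [] [] []
  | skip {Δ₁ Δ₂ Δ : CCtx} : CCtx.Merge Δ₁ Δ₂ Δ →
      CCtx.Merge (none :: Δ₁) (none :: Δ₂) (none :: Δ)
  | left {Δ₁ Δ₂ Δ : CCtx} (α : CTy) : CCtx.Merge Δ₁ Δ₂ Δ →
      CCtx.Merge (some α :: Δ₁) (none :: Δ₂) (some α :: Δ)
  | right {Δ₁ Δ₂ Δ : CCtx} (α : CTy) : CCtx.Merge Δ₁ Δ₂ Δ →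
      CCtx.Merge (none :: Δ₁) (some α :: Δ₂) (some α :: Δ)

/-- Derivations of the typing judgment of the linear calculus. -/
inductive CTyping {d : ℕ} : CCtx → CExpr d → CTy → Type
  | var {Δ : CCtx} {i : ℕ} {α : CTy} : Δ.Only i α → CTyping Δ (.var i) α
  | letIn {Δ Δ' Δ₀ : CCtx} {a a' : CExpr d} {α α' : CTy} : CCtx.Merge Δ Δ' Δ₀ →
      CTyping Δ a α → CTyping (some α :: Δ') a' α' → CTyping Δ₀ (.letIn a a') α'
  | const {Δ : CCtx} (r : ZMod d) : Δ.IsEmpty → CTyping Δ (.const r) .unit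
  | smul {Δ Δ' Δ₀ : CCtx} {a a' : CExpr d} {α : CTy} : CCtx.Merge Δ Δ' Δ₀ →
      CTyping Δ a .unit → CTyping Δ' a' α → CTyping Δ₀ (.smul a a') α
  | zero (Δ : CCtx) (α : CTy) : CTyping Δ (.zero α) α
  | add {Δ : CCtx} {a₁ a₂ : CExpr d} {α : CTy} :
      CTyping Δ a₁ α → CTyping Δ a₂ α → CTyping Δ (.add a₁ a₂) α
  | pair {Δ : CCtx} {a₁ a₂ : CExpr d} {α₁ α₂ : CTy} :
      CTyping Δ a₁ α₁ → CTyping Δ a₂ α₂ → CTyping Δ (.pair a₁ a₂) (.sum α₁ α₂)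
  | case {Δ Δ' Δ₀ : CCtx} {a a₁ a₂ : CExpr d} {α₁ α₂ α' : CTy} : CCtx.Merge Δ Δ' Δ₀ →
      CTyping Δ a (.sum α₁ α₂) → CTyping (some α₁ :: Δ') a₁ α' →
      CTyping (some α₂ :: Δ') a₂ α' → CTyping Δ₀ (.case a a₁ a₂) α'
  | lam {Δ : CCtx} {a : CExpr d} {α α' : CTy} :
      CTyping (some α :: Δ) a α' → CTyping Δ (.lam α a) (.fn α α')
  | app {Δ Δ' Δ₀ : CCtx} {a a' : CExpr d} {α α' : CTy} : CCtx.Merge Δ Δ' Δ₀ →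
      CTyping Δ a (.fn α α') → CTyping Δ' a' α → CTyping Δ₀ (.app a a') α'

/-! Operational semantics of the linear calculus. -/

open CExpr in
inductive CBeta {d : ℕ} : CExpr d → CExpr d → Prop
  | letIn {v a' : CExpr d} : IsVal v → CBeta (letIn v a') (subst 0 v a')
  | case {v₁ v₂ a₁ a₂ : CExpr d} : IsVal v₁ → IsVal v₂ →
      CBeta (case (pair v₁ v₂) a₁ a₂) (add (subst 0 v₁ a₁) (subst 0 v₂ a₂))
  | app {α : CTy} {a v : CExpr d} : IsVal v → CBeta (app (lam α a) v) (subst 0 v a)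
  | zero_unit : CBeta (zero .unit) (const 0)
  | zero_sum {α₁ α₂ : CTy} : CBeta (zero (.sum α₁ α₂)) (pair (zero α₁) (zero α₂))
  | zero_fn {α α' : CTy} : CBeta (zero (.fn α α')) (lam α (zero α'))
  | smul_const {r₁ r₂ : ZMod d} : CBeta (smul (const r₁) (const r₂)) (const (r₁ * r₂))
  | smul_pair {r : ZMod d} {v₁ v₂ : CExpr d} : IsVal v₁ → IsVal v₂ →
      CBeta (smul (const r) (pair v₁ v₂)) (pair (smul (const r) v₁) (smul (const r) v₂))
  | smul_lam {r : ZMod d} {α : CTy} {a : CExpr d} :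
      CBeta (smul (const r) (lam α a)) (lam α (smul (const r) a))
  | add_const {r₁ r₂ : ZMod d} : CBeta (add (const r₁) (const r₂)) (const (r₁ + r₂))
  | add_pair {v₁ v₂ v₁' v₂' : CExpr d} : IsVal v₁ → IsVal v₂ → IsVal v₁' → IsVal v₂' →
      CBeta (add (pair v₁ v₂) (pair v₁' v₂')) (pair (add v₁ v₁') (add v₂ v₂'))
  | add_lam {α : CTy} {a₁ a₂ : CExpr d} :
      CBeta (add (lam α a₁) (lam α a₂)) (lam α (add a₁ a₂))

/-- The call-by-value small-step relation of the linear calculus. -/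
inductive CStep {d : ℕ} : CExpr d → CExpr d → Prop
  | beta {a a' : CExpr d} : CBeta a a' → CStep a a'
  | letIn {a a' a'' : CExpr d} : CStep a a' → CStep (.letIn a a'') (.letIn a' a'')
  | smul_left {a a' a'' : CExpr d} : CStep a a' → CStep (.smul a a'') (.smul a' a'')
  | smul_right {r : ZMod d} {a a' : CExpr d} : CStep a a' →
      CStep (.smul (.const r) a) (.smul (.const r) a')
  | add_left {a₁ a₁' a₂ : CExpr d} : CStep a₁ a₁' → CStep (.add a₁ a₂) (.add a₁' a₂)
  | add_right {v₁ a₂ a₂' : CExpr d} : v₁.IsVal → CStep a₂ a₂' →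
      CStep (.add v₁ a₂) (.add v₁ a₂')
  | pair_left {a₁ a₁' a₂ : CExpr d} : CStep a₁ a₁' → CStep (.pair a₁ a₂) (.pair a₁' a₂)
  | pair_right {v₁ a₂ a₂' : CExpr d} : v₁.IsVal → CStep a₂ a₂' →
      CStep (.pair v₁ a₂) (.pair v₁ a₂')
  | case {a a' a₁ a₂ : CExpr d} : CStep a a' → CStep (.case a a₁ a₂) (.case a' a₁ a₂)
  | app_left {a₁ a₁' a₂ : CExpr d} : CStep a₁ a₁' → CStep (.app a₁ a₂) (.app a₁' a₂)
  | app_right {v a₂ a₂' : CExpr d} : v.IsVal → CStep a₂ a₂' →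
      CStep (.app v a₂) (.app v a₂')

/-- `a ↓ v`: the expression `a` reduces to the value `v`. -/
def CExpr.Evals {d : ℕ} (a v : CExpr d) : Prop := Relation.ReflTransGen CStep a v ∧ v.IsVal

/-! The equivalence of expressions of the linear calculus, as a logical relation. -/

/-- The relation on closed expressions of type `α` that is induced by a relation `R` on values. -/
def ExpRelOf {d : ℕ} (α : CTy) (R : CExpr d → CExpr d → Prop) (a₁ a₂ : CExpr d) : Prop :=
  Nonempty (CTyping [] a₁ α) ∧ Nonempty (CTyping [] a₂ α) ∧
    ∀ v₁ v₂ : CExpr d, a₁.Evals v₁ ∧ a₂.Evals v₂ → R v₁ v₂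

/-- The relation on closed values of type `α`. -/
def ValRel {d : ℕ} : CTy → CExpr d → CExpr d → Prop
  | .unit, v, w => ∃ r : ZMod d, v = .const r ∧ w = .const r
  | .sum α₁ α₂, v, w => ∃ v₁ v₂ w₁ w₂ : CExpr d, v = .pair v₁ v₂ ∧ w = .pair w₁ w₂ ∧
      ValRel α₁ v₁ w₁ ∧ ValRel α₂ v₂ w₂
  | .fn α α', v, w => ∃ a₁ a₂ : CExpr d, v = .lam α a₁ ∧ w = .lam α a₂ ∧
      Nonempty (CTyping [] v (.fn α α')) ∧ Nonempty (CTyping [] w (.fn α α')) ∧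
      ∀ v' w' : CExpr d, ValRel α v' w' →
        ExpRelOf α' (ValRel α') (CExpr.subst 0 v' a₁) (CExpr.subst 0 w' a₂)

/-- The relation on closed expressions of type `α`. -/
def ExpRel {d : ℕ} (α : CTy) : CExpr d → CExpr d → Prop := ExpRelOf α (ValRel α)

/-- The relation on value contexts. An entry for an absent variable is an arbitrary placeholder. -/
def CtxRel {d : ℕ} : CCtx → List (CExpr d) → List (CExpr d) → Prop
  | [], [], [] => True
  | none :: Δ, _ :: δ₁, _ :: δ₂ => CtxRel Δ δ₁ δ₂
  | some α :: Δ, v :: δ₁, w :: δ₂ => ValRel α v w ∧ CtxRel Δ δ₁ δ₂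
  | _, _, _ => False

/-- The equivalence `Δ ⊢ a₁ ≡ a₂ : α`. -/
def CEquiv {d : ℕ} (Δ : CCtx) (a₁ a₂ : CExpr d) (α : CTy) : Prop :=
  Nonempty (CTyping Δ a₁ α) ∧ Nonempty (CTyping Δ a₂ α) ∧
    ∀ δ₁ δ₂ : List (CExpr d), CtxRel Δ δ₁ δ₂ → ExpRel α (a₁.close δ₁) (a₂.close δ₂)

/-! Denotational semantics of the linear calculus. -/

noncomputable section

/-- The module denoted by a type. -/
def CTy.den (d : ℕ) : CTy → CObj d
  | .unit => CObj.unit d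
  | .sum α β => (α.den d).sum (β.den d)
  | .fn α β => (α.den d).hom (β.den d)

/-- The module denoted by a context: the tensor product of the types of its variables. -/
def CCtx.den (d : ℕ) : CCtx → CObj d
  | [] => CObj.unit d
  | none :: Δ => CCtx.den d Δ
  | some α :: Δ => (CCtx.den d Δ).tensor (α.den d)

/-- The canonical isomorphism of an empty context with the ring. -/
def CCtx.IsEmpty.interp (d : ℕ) : {Δ : CCtx} → Δ.IsEmpty → (Δ.den d →ₗ[ZMod d] CObj.unit d)
  | _, .nil => LinearMap.id
  | _, .cons h => h.interp d

/-- The canonical isomorphism `1 ⊗ a ↦ a` of a context with a single variable with its type. -/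
def CCtx.Only.interp (d : ℕ) : {Δ : CCtx} → {i : ℕ} → {α : CTy} → Δ.Only i α →
    (Δ.den d →ₗ[ZMod d] α.den d)
  | _, _, α, .here h =>
      (TensorProduct.lid (ZMod d) (α.den d)).toLinearMap ∘ₗ
        TensorProduct.map (h.interp d) LinearMap.id
  | _, _, _, .there h => h.interp d

/-- The canonical isomorphism of `⟦Δ⟧` with `⟦Δ₁⟧ ⊗ ⟦Δ₂⟧`. -/
def CCtx.Merge.interp (d : ℕ) : {Δ₁ Δ₂ Δ : CCtx} → CCtx.Merge Δ₁ Δ₂ Δ →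
    (Δ.den d →ₗ[ZMod d] (Δ₁.den d ⊗[ZMod d] Δ₂.den d))
  | _, _, _, .nil => (TensorProduct.lid (ZMod d) (CObj.unit d)).symm.toLinearMap
  | _, _, _, .skip m => m.interp d
  | _, _, _, .left α m =>
      (TensorProduct.rightComm (ZMod d) _ _ (α.den d)).toLinearMap ∘ₗ
        TensorProduct.map (m.interp d) LinearMap.id
  | _, _, _, .right α m =>
      (TensorProduct.assoc (ZMod d) _ _ (α.den d)).toLinearMap ∘ₗ
        TensorProduct.map (m.interp d) LinearMap.id

/-- The linear map `s ⊗ s' ↦ g (s' ⊗ f s)`. -/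
def bindMap {d : ℕ} {A B C D : CObj d} (f : A →ₗ[ZMod d] C) (g : B.tensor C →ₗ[ZMod d] D) :
    (A ⊗[ZMod d] B) →ₗ[ZMod d] D :=
  g ∘ₗ (TensorProduct.comm (ZMod d) C B).toLinearMap ∘ₗ TensorProduct.map f LinearMap.id

/-- The linear map from `⟦Δ⟧` to `⟦α⟧` denoted by a typed expression. -/
def CTyping.interp {d : ℕ} : {Δ : CCtx} → {a : CExpr d} → {α : CTy} → CTyping Δ a α →
    (Δ.den d →ₗ[ZMod d] α.den d)
  | _, _, _, .var h => h.interp d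
  | _, _, _, .letIn m D D' => bindMap D.interp D'.interp ∘ₗ m.interp d
  | _, _, _, .const r h => r • h.interp d
  | _, _, α, .smul m D D' =>
      (TensorProduct.lid (ZMod d) (α.den d)).toLinearMap ∘ₗ
        TensorProduct.map D.interp D'.interp ∘ₗ m.interp d
  | _, _, _, .zero _ _ => 0
  | _, _, _, .add D₁ D₂ => D₁.interp + D₂.interp
  | _, _, _, .pair D₁ D₂ => LinearMap.prod D₁.interp D₂.interp
  | _, _, _, .case (α₁ := α₁) (α₂ := α₂) m D D₁ D₂ =>
      (bindMap (LinearMap.fst (ZMod d) (α₁.den d) (α₂.den d) ∘ₗ D.interp) D₁.interp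
        + bindMap (LinearMap.snd (ZMod d) (α₁.den d) (α₂.den d) ∘ₗ D.interp) D₂.interp) ∘ₗ
        m.interp d
  | _, _, _, .lam D => TensorProduct.curry D.interp
  | _, _, _, .app (α := α) (α' := α') m D D' =>
      TensorProduct.lift (LinearMap.id : (α.den d →ₗ[ZMod d] α'.den d) →ₗ[ZMod d] _) ∘ₗ
        TensorProduct.map D.interp D'.interp ∘ₗ m.interp d

end

/-! The calculus for projective Cliffords: types and expressions. -/

inductive PTy : Type
  | pauli : PTy
  | tensor (Q₁ Q₂ : PTy) : PTy

/-- The symplectic type underlying a type. -/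
def PTy.toC : PTy → CTy
  | .pauli => .sum .unit .unit
  | .tensor Q₁ Q₂ => .sum Q₁.toC Q₂.toC

/-- The symplectic form of the type `Q`, as a closed expression of the linear calculus of
type `Q.toC ⊸ Q.toC ⊸ unit`. -/
def PTy.omega (d : ℕ) : PTy → CExpr d
  | .pauli =>
      .lam (.sum .unit .unit) (.lam (.sum .unit .unit)
        (.case (.var 1)
          (.case (.var 1)
            (.zero .unit)
            (.smul (.const (-1)) (.smul (.var 1) (.var 0))))
          (.case (.var 1)
            (.smul (.var 1) (.var 0))
            (.zero .unit))))
  | .tensor Q₁ Q₂ =>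
      .lam (.sum Q₁.toC Q₂.toC) (.lam (.sum Q₁.toC Q₂.toC)
        (.case (.var 1)
          (.case (.var 1)
            (.app (.app (Q₁.omega d) (.var 1)) (.var 0))
            (.zero .unit))
          (.case (.var 1)
            (.zero .unit)
            (.app (.app (Q₂.omega d) (.var 1)) (.var 0)))))

/-- Expressions. Injections carry the type of the other summand. In `caseXZ e ex ez` no variable is
bound; in `caseIn e e₁ e₂` a variable is bound in each of `e₁` and `e₂`. -/
inductive PExpr (d : ℕ) : Type
  | var (i : ℕ) : PExpr d
  | letIn (e e' : PExpr d) : PExpr d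
  | ofC (a : CExpr d) : PExpr d
  | phase (a : CExpr d) (e : PExpr d) : PExpr d
  | star (e₁ e₂ : PExpr d) : PExpr d
  | pow (e : PExpr d) (r : ZMod d) : PExpr d
  | caseXZ (e ex ez : PExpr d) : PExpr d
  | inl (Q₂ : PTy) (e : PExpr d) : PExpr d
  | inr (Q₁ : PTy) (e : PExpr d) : PExpr d
  | caseIn (e e₁ e₂ : PExpr d) : PExpr d

namespace PExpr

variable {d : ℕ}

/-- Substitution of the closed expression `v` of the linear calculus for the variable with
index `k`, which is removed. -/
def subst (k : ℕ) (v : CExpr d) : PExpr d → PExpr d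
  | var i => if i < k then var i else if i = k then ofC v else var (i - 1)
  | letIn e e' => letIn (subst k v e) (subst (k + 1) v e')
  | ofC a => ofC (CExpr.subst k v a)
  | phase a e => phase (CExpr.subst k v a) (subst k v e)
  | star e₁ e₂ => star (subst k v e₁) (subst k v e₂)
  | pow e r => pow (subst k v e) r
  | caseXZ e ex ez => caseXZ (subst k v e) (subst k v ex) (subst k v ez)
  | inl Q₂ e => inl Q₂ (subst k v e)
  | inr Q₁ e => inr Q₁ (subst k v e)
  | caseIn e e₁ e₂ => caseIn (subst k v e) (subst (k + 1) v e₁) (subst (k + 1) v e₂)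

/-- The non-phase part of an expression, as an expression of the linear calculus. -/
def psi : PExpr d → CExpr d
  | var i => .var i
  | letIn e e' => .letIn e.psi e'.psi
  | ofC a => a
  | phase _ e => e.psi
  | star e₁ e₂ => .add e₁.psi e₂.psi
  | pow e r => .smul (.const r) e.psi
  | caseXZ e ex ez => .case e.psi
      (.smul (.var 0) (ex.psi.shift 0)) (.smul (.var 0) (ez.psi.shift 0))
  | inl Q₂ e => .pair e.psi (.zero Q₂.toC)
  | inr Q₁ e => .pair (.zero Q₁.toC) e.psi
  | caseIn e e₁ e₂ => .case e.psi e₁.psi e₂.psi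

end PExpr

/-- A context has at most one variable, which then has index `0`. -/
abbrev PCtx : Type := Option PTy

def PCtx.toC : PCtx → CCtx
  | none => []
  | some Q => [some Q.toC]

/-- The expression `ω_Q a₁ a₂` of the linear calculus. -/
def sympForm {d : ℕ} (Q : PTy) (a₁ a₂ : CExpr d) : CExpr d := .app (.app (Q.omega d) a₁) a₂

/-- Derivations of the typing judgment for projective Cliffords. In the last rule the two branches
are compared in a context of two variables: index `0` is the variable of `e₁` and index `1` is the
variable of `e₂`. -/
inductive PTyping {d : ℕ} : PCtx → PExpr d → PTy → Type
  | var (Q : PTy) : PTyping (some Q) (.var 0) Q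
  | letIn {Θ : PCtx} {e e' : PExpr d} {Q Q' : PTy} :
      PTyping Θ e Q → PTyping (some Q) e' Q' → PTyping Θ (.letIn e e') Q'
  | ofC {a : CExpr d} {Q : PTy} : CTyping [] a Q.toC → PTyping none (.ofC a) Q
  | phase {Θ : PCtx} {a : CExpr d} {e : PExpr d} {Q : PTy} :
      CTyping Θ.toC a .unit → PTyping Θ e Q → PTyping Θ (.phase a e) Q
  | star {e₁ e₂ : PExpr d} {Q : PTy} :
      PTyping none e₁ Q → PTyping none e₂ Q → PTyping none (.star e₁ e₂) Q
  | pow {e : PExpr d} {Q : PTy} (r : ZMod d) : PTyping none e Q → PTyping none (.pow e r) Q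
  | caseXZ {Θ : PCtx} {e ex ez : PExpr d} {Q : PTy} :
      PTyping Θ e .pauli → PTyping none ex Q → PTyping none ez Q →
      CEquiv [] (sympForm Q ez.psi ex.psi) (.const 1) .unit →
      PTyping Θ (.caseXZ e ex ez) Q
  | inl {Θ : PCtx} {e : PExpr d} {Q₁ : PTy} (Q₂ : PTy) :
      PTyping Θ e Q₁ → PTyping Θ (.inl Q₂ e) (.tensor Q₁ Q₂)
  | inr {Θ : PCtx} {e : PExpr d} (Q₁ : PTy) {Q₂ : PTy} :
      PTyping Θ e Q₂ → PTyping Θ (.inr Q₁ e) (.tensor Q₁ Q₂)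
  | caseIn {Θ : PCtx} {e e₁ e₂ : PExpr d} {Q₁ Q₂ Q' : PTy} :
      PTyping Θ e (.tensor Q₁ Q₂) → PTyping (some Q₁) e₁ Q' → PTyping (some Q₂) e₂ Q' →
      CEquiv [some Q₁.toC, some Q₂.toC] (sympForm Q' e₁.psi (e₂.psi.shift 0)) (.zero .unit) .unit →
      PTyping Θ (.caseIn e e₁ e₂) Q'

/-! Operational semantics for projective Cliffords. -/

/-- The coordinates `x_1, z_1, x_2, z_2, ...` of a closed value of symplectic type. -/
def CExpr.flatten {d : ℕ} : CExpr d → List (ZMod d)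
  | .const r => [r]
  | .pair v₁ v₂ => v₁.flatten ++ v₂.flatten
  | _ => []

/-- The extended symplectic form on lists of coordinates `x_1, z_1, x_2, z_2, ...`. -/
def listOmegaExt {d : ℕ} : List (ZMod (dExt d)) → List (ZMod (dExt d)) → ZMod (dExt d)
  | x :: z :: u, x' :: z' :: v => z * x' - z' * x + listOmegaExt u v
  | _, _ => 0

/-- The sign `(1/d) ω'(w, lift (red w))` of a list of coordinates. -/
def listSgn {d : ℕ} (w : List (ZMod (dExt d))) : ℕ :=
  overD d (listOmegaExt w (w.map fun c => liftZ (redZ c)))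

/-- The extra phase of `star`. -/
def starPhase {d : ℕ} (v₁ v₂ : CExpr d) : ZMod d :=
  halfD d (sgn (listOmegaExt (v₁.flatten.map liftZ) (v₂.flatten.map liftZ))
    + listSgn (List.zipWith (· + ·) (v₁.flatten.map liftZ) (v₂.flatten.map liftZ)))

/-- The extra phase of `pow`. -/
def powPhase {d : ℕ} (r : ZMod d) (v : CExpr d) : ZMod d :=
  halfD d (listSgn (v.flatten.map fun c => liftZ r * liftZ c))

/-- The expression `⟨r⟩ v`. -/
def PExpr.nf {d : ℕ} (r : ZMod d) (v : CExpr d) : PExpr d := .phase (.const r) (.ofC v)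

open PExpr in
/-- The reduction rules for closed expressions. -/
inductive PBeta {d : ℕ} : PExpr d → PExpr d → Prop
  | letIn {r : ZMod d} {v : CExpr d} {e' : PExpr d} : v.IsVal →
      PBeta (letIn (nf r v) e') (phase (.const r) (subst 0 v e'))
  | phase {r' r : ZMod d} {v : CExpr d} : v.IsVal →
      PBeta (phase (.const r') (nf r v)) (nf (r' + r) v)
  | star {r₁ r₂ : ZMod d} {v₁ v₂ : CExpr d} : v₁.IsVal → v₂.IsVal →
      PBeta (star (nf r₁ v₁) (nf r₂ v₂)) (nf (r₁ + r₂ + starPhase v₁ v₂) (.add v₁ v₂))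
  | pow {r r' : ZMod d} {v : CExpr d} : v.IsVal →
      PBeta (pow (nf r v) r') (nf (r' * r + powPhase r' v) (.smul (.const r') v))
  | caseXZ {r rx rz : ZMod d} {ex ez : PExpr d} :
      PBeta (caseXZ (nf r (.pair (.const rx) (.const rz))) ex ez)
        (phase (.const (r + halfD d (sgn (liftZ rx * liftZ rz)))) (star (pow ez rz) (pow ex rx)))
  | inl {Q₂ : PTy} {r : ZMod d} {v : CExpr d} : v.IsVal →
      PBeta (inl Q₂ (nf r v)) (nf r (.pair v (.zero Q₂.toC)))
  | inr {Q₁ : PTy} {r : ZMod d} {v : CExpr d} : v.IsVal →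
      PBeta (inr Q₁ (nf r v)) (nf r (.pair (.zero Q₁.toC) v))
  | caseIn {r : ZMod d} {v₁ v₂ : CExpr d} {e₁ e₂ : PExpr d} : v₁.IsVal → v₂.IsVal →
      PBeta (caseIn (nf r (.pair v₁ v₂)) e₁ e₂)
        (phase (.const r) (star (subst 0 v₁ e₁) (subst 0 v₂ e₂)))
  | eta {v : CExpr d} : v.IsVal → PBeta (ofC v) (nf 0 v)

/-- The small-step relation: reduction under call-by-value evaluation contexts. -/
inductive PStep {d : ℕ} : PExpr d → PExpr d → Prop
  | beta {e e' : PExpr d} : PBeta e e' → PStep e e'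
  | letIn {e e' e'' : PExpr d} : PStep e e' → PStep (.letIn e e'') (.letIn e' e'')
  | ofC {a a' : CExpr d} : CStep a a' → PStep (.ofC a) (.ofC a')
  | phase_left {a a' : CExpr d} {e : PExpr d} : CStep a a' →
      PStep (.phase a e) (.phase a' e)
  | phase_right {r : ZMod d} {e e' : PExpr d} : PStep e e' →
      PStep (.phase (.const r) e) (.phase (.const r) e')
  | star_left {e₁ e₁' e₂ : PExpr d} : PStep e₁ e₁' → PStep (.star e₁ e₂) (.star e₁' e₂)
  | star_right {r : ZMod d} {v : CExpr d} {e₂ e₂' : PExpr d} : v.IsVal → PStep e₂ e₂' →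
      PStep (.star (.nf r v) e₂) (.star (.nf r v) e₂')
  | pow {e e' : PExpr d} {r : ZMod d} : PStep e e' → PStep (.pow e r) (.pow e' r)
  | caseXZ {e e' ex ez : PExpr d} : PStep e e' →
      PStep (.caseXZ e ex ez) (.caseXZ e' ex ez)
  | inl {Q₂ : PTy} {e e' : PExpr d} : PStep e e' → PStep (.inl Q₂ e) (.inl Q₂ e')
  | inr {Q₁ : PTy} {e e' : PExpr d} : PStep e e' → PStep (.inr Q₁ e) (.inr Q₁ e')
  | caseIn {e e' e₁ e₂ : PExpr d} : PStep e e' →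
      PStep (.caseIn e e₁ e₂) (.caseIn e' e₁ e₂)

/-! Denotational semantics for projective Cliffords. -/

noncomputable section

/-- The number of qudits of a type. -/
def PTy.qudits : PTy → ℕ
  | .pauli => 1
  | .tensor Q₁ Q₂ => Q₁.qudits + Q₂.qudits

/-- The conjugate pairs of basis vectors of `⟦Q.toC⟧`. -/
def PTy.conj (d : ℕ) : (Q : PTy) → (Fin Q.qudits ⊕ Fin Q.qudits ≃ Fin (Q.toC.den d).rank)
  | .pauli => (SObj.qudit d).pair
  | .tensor Q₁ Q₂ => (SObj.sum ⟨Q₁.toC.den d, Q₁.qudits, Q₁.conj d⟩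
      ⟨Q₂.toC.den d, Q₂.qudits, Q₂.conj d⟩).pair

/-- The symplectic module `⟦Q.toC⟧`. -/
def PTy.den (d : ℕ) (Q : PTy) : SObj d := ⟨Q.toC.den d, Q.qudits, Q.conj d⟩

theorem PTy.den_pauli (d : ℕ) : PTy.den d .pauli = SObj.qudit d := rfl

theorem PTy.den_tensor (d : ℕ) (Q₁ Q₂ : PTy) :
    PTy.den d (.tensor Q₁ Q₂) = (Q₁.den d).sum (Q₂.den d) := rfl

/-- The object denoted by a context. -/
def PCtx.den (d : ℕ) : PCtx → PObj d
  | none => .unit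
  | some Q => .pauli (Q.den d)

/-- The canonical isomorphism from the module of a context to the tensor product denoted by the
corresponding context of the linear calculus (`v ↦ 1 ⊗ v` for one variable). -/
def PCtx.toTensor (d : ℕ) : (Θ : PCtx) → ((Θ.den d).toCObj →ₗ[ZMod d] Θ.toC.den d)
  | none => LinearMap.id
  | some Q => (TensorProduct.lid (ZMod d) (Q.toC.den d)).symm.toLinearMap

/-- The morphism denoted by a typed expression; it has the value `none` if some pairing `⊞` that
occurs in it is not a morphism. -/
def PTyping.interp {d : ℕ} : {Θ : PCtx} → {e : PExpr d} → {Q : PTy} → PTyping Θ e Q →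
    Option (PHom (Θ.den d) (Q.den d))
  | _, _, _, .var Q => some (PHom.id (Q.den d))
  | _, _, _, .letIn D D' => do
      let f ← D.interp
      let g ← D'.interp
      return PHom.comp g f
  | _, _, _, .ofC D => some ⟨0, D.interp, trivial⟩
  | Θ, _, _, .phase D D' => do
      let f ← D'.interp
      return PHom.addPhase (D.interp ∘ₗ Θ.toTensor d) f
  | _, _, _, .star D₁ D₂ => do
      let f ← D₁.interp
      let g ← D₂.interp
      return PHom.star f g
  | _, _, _, .pow r D => do
      let f ← D.interp
      return PHom.compUnit f (r • LinearMap.id)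
  | _, _, _, .caseXZ D Dx Dz _ => do
      let f ← D.interp
      let gx ← Dx.interp
      let gz ← Dz.interp
      let g ← PHom.boxUnit gx gz
      return PHom.comp g f
  | _, _, _, .inl (Q₁ := Q₁) Q₂ D => do
      let f ← D.interp
      return PHom.comp (PHom.inl (Q₁.den d) (Q₂.den d)) f
  | _, _, _, .inr (Q₂ := Q₂) Q₁ D => do
      let f ← D.interp
      return PHom.comp (PHom.inr (Q₁.den d) (Q₂.den d)) f
  | _, _, _, .caseIn D D₁ D₂ _ => do
      let f ← D.interp
      let g₁ ← D₁.interp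
      let g₂ ← D₂.interp
      let g ← PHom.boxPauli g₁ g₂
      return PHom.comp g f

end

end ProjCliff

namespace ProjCliff
noncomputable section

set_option linter.unusedSectionVars false

/-! Arithmetic of representatives and signs. -/

section Arithmetic

/-! Phases. All signs are kept as exponents in `ZMod (dExt d)` that are multiples of `d`; halving
such an exponent is additive (`halfPhase_add`). The condensed product of lifted vectors has a
cocycle c, namely ω' of the lifts plus the sign of their sum. The central fact, `SObj.kappaExt_add`,
says that for a symplectic ψ the correction satisfies κ(u+v) − κ(u) − κ(v) = c(ψu, ψv) − c(u, v).
Since κ also vanishes on basis vectors, these two properties determine it: two functions with the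
same failure of additivity differ by an additive function, and an additive function that is zero on
a basis is zero (`SObj.eq_zero_of_additive`).

Every phase identity needed follows by this argument. For a composite, κ^ψ + κ^φ∘ψ and κ^(φψ) have
the same failure of additivity, so they differ by an additive function. That difference is exactly
what prescribing μ on basis vectors puts into the linear phase of a composite, which yields
`PHom.comp_assoc` on global elements. The injections preserve the cocycle, hence have no correction.
The correction of a copairing is the sum of the two corrections and one cocycle value, which is the
phase of ⋆. These computations become `PHom.boxUnit_comp` and `PHom.boxPauli_comp`, the equations
behind the two case rules.

Linear parts. Typing derivations are not unique, since a zero is typable in any context and so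
contexts may be split in several ways. Therefore `CExpr.Den` gives meaning to raw expressions in an
environment of typed elements. This relation is functional, stable under substitution and reduction,
and satisfied by the denotation of every derivation. Independence of the derivation and invariance
under reduction of the linear calculus follow at once.

Well-definedness. The side conditions of the case rules only compare values that are reached by
reduction. A normalization proof (`CTyping.redExp`) guarantees that values are reached, and
`CExpr.Den` turns equality of the values into equality of scalars. As each vector of a symplectic
type is denoted by a closed value, the conditions become the equations on ω that make ⊞ a morphism
(`PTyping.exists_interp`).

Soundness. Substituting a closed expression denotes composition with its global element
(`PTyping.exists_subst`), by associativity. Each reduction rule is then an equation between phases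
and vectors of global elements, and evaluation contexts preserve such equations. -/

theorem dvd_dExt (d : ℕ) : d ∣ dExt d := by
  unfold dExt; split <;> simp

/-- Reduction mod `d` as a ring homomorphism. -/
def redHom (d : ℕ) : ZMod (dExt d) →+* ZMod d := ZMod.castHom (dvd_dExt d) (ZMod d)

/-- The phase `(1/2) t` for `t` a multiple of `d` modulo `d'`. -/
def halfPhase {d : ℕ} (t : ZMod (dExt d)) : ZMod d := halfD d (overD d t)

theorem halfD_add (d k l : ℕ) : halfD d (k + l) = halfD d k + halfD d l := by
  simp [halfD, mul_add]

variable {d : ℕ} [hd : Fact (1 < d)]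

instance neZero_of_fact : NeZero d := ⟨by have := hd.out; omega⟩

instance neZero_dExt : NeZero (dExt d) :=
  ⟨by have := NeZero.ne d; unfold dExt; split <;> omega⟩

theorem redZ_eq (r : ZMod (dExt d)) : redZ r = redHom d r := by
  simp [redZ, redHom]

@[simp] theorem redHom_liftZ (r : ZMod d) : redHom d (liftZ r) = r := by
  simp [liftZ]

@[simp] theorem liftZ_zero : liftZ (0 : ZMod d) = 0 := by simp [liftZ]

@[simp] theorem liftZ_one : liftZ (1 : ZMod d) = 1 := by simp [liftZ, ZMod.val_one]

theorem redHom_eq_zero_iff {x : ZMod (dExt d)} : redHom d x = 0 ↔ ∃ k, x = d * k := by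
  constructor
  · intro h
    rw [← redZ_eq, redZ, ZMod.natCast_eq_zero_iff] at h
    obtain ⟨k, hk⟩ := h
    refine ⟨k, ?_⟩
    rw [← Nat.cast_mul, ← hk, ZMod.natCast_zmod_val]
  · rintro ⟨k, rfl⟩
    simp

theorem exists_eq_add_mul {x y : ZMod (dExt d)} (h : redHom d x = redHom d y) :
    ∃ k, x = y + d * k := by
  obtain ⟨k, hk⟩ := redHom_eq_zero_iff.1 (show redHom d (x - y) = 0 by rw [map_sub, h, sub_self])
  exact ⟨k, by rw [← hk]; ring⟩

theorem two_mul_natCast_self : (2 : ZMod (dExt d)) * d = 0 := by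
  have h : ((2 * d : ℕ) : ZMod (dExt d)) = 0 := by
    rw [ZMod.natCast_eq_zero_iff]; unfold dExt; split <;> simp
  exact_mod_cast h

theorem natCast_self_mul_self : (d : ZMod (dExt d)) * d = 0 := by
  have h : ((d * d : ℕ) : ZMod (dExt d)) = 0 := by
    rw [ZMod.natCast_eq_zero_iff]; unfold dExt; split
    · next h => exact mul_dvd_mul_right h.two_dvd d
    · simp
  exact_mod_cast h

/-- The modulus d' divides 2d. Consequently the sign of an exponent that is a multiple of `d` is
irrelevant, which allows factors belonging to different qudits to be reordered freely. -/
theorem two_mul_eq_zero {x : ZMod (dExt d)} (h : redHom d x = 0) : 2 * x = 0 := by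
  obtain ⟨k, rfl⟩ := redHom_eq_zero_iff.1 h
  rw [← mul_assoc, two_mul_natCast_self, zero_mul]

theorem natCast_mul_eq_zero {x : ZMod (dExt d)} (h : redHom d x = 0) : d * x = 0 := by
  obtain ⟨k, rfl⟩ := redHom_eq_zero_iff.1 h
  rw [← mul_assoc, natCast_self_mul_self, zero_mul]

/-- Since d² is zero modulo d', a factor `d` erases everything about the other factor except its
residue. In error terms this lets ω' be handled as if it were ω. -/
theorem natCast_mul_congr {x y : ZMod (dExt d)} (h : redHom d x = redHom d y) :
    (d : ZMod (dExt d)) * x = d * y := by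
  rw [← sub_eq_zero, ← mul_sub]
  exact natCast_mul_eq_zero (by rw [map_sub, h, sub_self])

/-- Dividing dk mod 2d by d leaves k mod 2, and (d/2)·(k mod 2) agrees with (d/2)·k modulo d. -/
theorem halfPhase_natCast_mul (h : Even d) (k : ℕ) :
    halfPhase ((d : ZMod (dExt d)) * (k : ZMod (dExt d))) = halfD d k := by
  have hpos : 0 < d := NeZero.pos d
  rw [halfPhase, overD, ← Nat.cast_mul, ZMod.val_natCast, dExt, if_pos h, mul_comm 2 d,
    Nat.mul_mod_mul_left, Nat.mul_div_cancel_left _ hpos]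
  obtain ⟨m, hm⟩ := h.two_dvd
  rw [halfD, halfD, ZMod.natCast_eq_natCast_iff]
  have : d / 2 = m := by omega
  rw [this]
  have := (Nat.mod_modEq k 2).mul_left' m
  rwa [mul_comm m 2, ← hm] at this

theorem natCast_self_eq_zero_of_odd (h : ¬ Even d) : (d : ZMod (dExt d)) = 0 := by
  rw [ZMod.natCast_eq_zero_iff, dExt, if_neg h]

@[simp] theorem halfPhase_zero : halfPhase (0 : ZMod (dExt d)) = 0 := by
  simp [halfPhase, overD, halfD]

/-- Division with remainder is not additive in general; on multiples of `d` it is, once the result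
is multiplied by d/2 modulo d. For odd `d` the only such multiple is zero. -/
theorem halfPhase_add {x y : ZMod (dExt d)} (hx : redHom d x = 0) (hy : redHom d y = 0) :
    halfPhase (x + y) = halfPhase x + halfPhase y := by
  obtain ⟨k, rfl⟩ := redHom_eq_zero_iff.1 hx
  obtain ⟨l, rfl⟩ := redHom_eq_zero_iff.1 hy
  by_cases h : Even d
  · rw [← ZMod.natCast_zmod_val k, ← ZMod.natCast_zmod_val l, ← mul_add, ← Nat.cast_add,
      halfPhase_natCast_mul h, halfPhase_natCast_mul h, halfPhase_natCast_mul h, halfD_add]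
  · simp [natCast_self_eq_zero_of_odd h]

theorem halfPhase_neg {x : ZMod (dExt d)} (hx : redHom d x = 0) :
    halfPhase (-x) = halfPhase x := by
  have h : -x = x := by rw [neg_eq_iff_add_eq_zero, ← two_mul, two_mul_eq_zero hx]
  rw [h]

end Arithmetic

end

end ProjCliff

namespace ProjCliff
noncomputable section
set_option linter.unusedSectionVars false

/-! The extended symplectic form and the correction of a symplectic morphism. -/

namespace SObj

variable {d : ℕ} [hd : Fact (1 < d)] (U V W : SObj d)

theorem omegaExt_add_left (a b c : V.ExtVec) :
    V.omegaExt (a + b) c = V.omegaExt a c + V.omegaExt b c := by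
  simp only [omegaExt, ← Finset.sum_add_distrib, Pi.add_apply]
  exact Finset.sum_congr rfl fun i _ => by ring

theorem omegaExt_smul_left (r : ZMod (dExt d)) (a c : V.ExtVec) :
    V.omegaExt (r • a) c = r * V.omegaExt a c := by
  simp only [omegaExt, Finset.mul_sum, Pi.smul_apply, smul_eq_mul]
  exact Finset.sum_congr rfl fun i _ => by ring

theorem omegaExt_antisymm (a b : V.ExtVec) : V.omegaExt a b = - V.omegaExt b a := by
  simp only [omegaExt, ← Finset.sum_neg_distrib]
  exact Finset.sum_congr rfl fun i _ => by ring

theorem omegaExt_add_right (a b c : V.ExtVec) :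
    V.omegaExt a (b + c) = V.omegaExt a b + V.omegaExt a c := by
  rw [omegaExt_antisymm, omegaExt_add_left, neg_add, ← omegaExt_antisymm, ← omegaExt_antisymm]

theorem omegaExt_smul_right (r : ZMod (dExt d)) (a c : V.ExtVec) :
    V.omegaExt a (r • c) = r * V.omegaExt a c := by
  rw [omegaExt_antisymm, omegaExt_smul_left, V.omegaExt_antisymm a c, mul_neg]

theorem omegaExt_self (a : V.ExtVec) : V.omegaExt a a = 0 := by
  simp [omegaExt]

/-- The extended symplectic form as a bilinear map. -/
def omegaBilin : V.ExtVec →ₗ[ZMod (dExt d)] V.ExtVec →ₗ[ZMod (dExt d)] ZMod (dExt d) :=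
  LinearMap.mk₂ _ V.omegaExt V.omegaExt_add_left V.omegaExt_smul_left V.omegaExt_add_right
    V.omegaExt_smul_right

theorem omegaBilin_apply (a b : V.ExtVec) : V.omegaBilin a b = V.omegaExt a b := rfl

theorem omegaExt_sum_left {ι : Type*} (s : Finset ι) (a : ι → V.ExtVec) (b : V.ExtVec) :
    V.omegaExt (∑ i ∈ s, a i) b = ∑ i ∈ s, V.omegaExt (a i) b := by
  simp [← omegaBilin_apply]

theorem omegaExt_sum_right {ι : Type*} (s : Finset ι) (a : V.ExtVec) (b : ι → V.ExtVec) :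
    V.omegaExt a (∑ i ∈ s, b i) = ∑ i ∈ s, V.omegaExt a (b i) := by
  simp [← omegaBilin_apply]

/-- Reduction of a coordinate vector. -/
def redVec (a : V.ExtVec) : V := V.basis.equivFun.symm fun j => redHom d (a j)

@[simp] theorem repr_redVec (a : V.ExtVec) (j : Fin V.rank) :
    V.basis.repr (V.redVec a) j = redHom d (a j) := by
  rw [← V.basis.equivFun_apply, redVec, LinearEquiv.apply_symm_apply]

@[simp] theorem redVec_lift (v : V) : V.redVec (V.lift v) = v :=
  V.basis.ext_elem fun j => by simp [lift]

@[simp] theorem redVec_add (a b : V.ExtVec) : V.redVec (a + b) = V.redVec a + V.redVec b :=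
  V.basis.ext_elem fun j => by simp

theorem redVec_smul (r : ZMod (dExt d)) (a : V.ExtVec) :
    V.redVec (r • a) = redHom d r • V.redVec a :=
  V.basis.ext_elem fun j => by simp

@[simp] theorem lift_zero : V.lift (0 : V) = 0 := by
  funext j; simp [lift]

theorem redHom_omegaExt (a b : V.ExtVec) :
    redHom d (V.omegaExt a b) = V.omega (V.redVec a) (V.redVec b) := by
  simp [omegaExt, omega, x, z]

theorem natCast_mul_omegaExt_congr {a a' b b' : V.ExtVec} (ha : V.redVec a = V.redVec a')
    (hb : V.redVec b = V.redVec b') :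
    (d : ZMod (dExt d)) * V.omegaExt a b = d * V.omegaExt a' b' :=
  natCast_mul_congr (by rw [redHom_omegaExt, redHom_omegaExt, ha, hb])

theorem exists_eq_add_smul {a b : V.ExtVec} (h : V.redVec a = V.redVec b) :
    ∃ c : V.ExtVec, a = b + (d : ZMod (dExt d)) • c := by
  have hj : ∀ j, ∃ k, a j = b j + d * k := fun j =>
    exists_eq_add_mul (by rw [← repr_redVec, ← repr_redVec, h])
  choose c hc using hj
  exact ⟨c, funext fun j => by simp [hc]⟩

/-- The phase exponent of a coordinate vector relative to its reduction. -/
def signExt (a : V.ExtVec) : ZMod (dExt d) := V.omegaExt a (V.lift (V.redVec a))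

theorem sgnVec_eq (a : V.ExtVec) : halfD d (V.sgnVec a) = halfPhase (V.signExt a) := by
  have : (fun j => liftZ (redZ (a j))) = V.lift (V.redVec a) := by
    funext j; simp [lift, redZ_eq]
  rw [sgnVec, this]; rfl

theorem omega_self (v : V) : V.omega v v = 0 := by simp [omega]

theorem redHom_signExt (a : V.ExtVec) : redHom d (V.signExt a) = 0 := by
  rw [signExt, redHom_omegaExt, redVec_lift, omega_self]

theorem signExt_lift (v : V) : V.signExt (V.lift v) = 0 := by
  rw [signExt, redVec_lift, omegaExt_self]

/-- As ω' is alternating, the lift pairs to zero with itself and only the error dc contributes. -/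
theorem signExt_add_smul (v : V) (c : V.ExtVec) :
    V.signExt (V.lift v + (d : ZMod (dExt d)) • c) = d * V.omegaExt c (V.lift v) := by
  have h : V.redVec (V.lift v + (d : ZMod (dExt d)) • c) = v := by simp [redVec_smul]
  rw [signExt, h, omegaExt_add_left, omegaExt_self, omegaExt_smul_left, zero_add]

/-- The cocycle of the product of lifted vectors. -/
def cocycle (u v : V) : ZMod (dExt d) :=
  V.omegaExt (V.lift u) (V.lift v) + V.signExt (V.lift u + V.lift v)

/-- The sign part is a multiple of `d`. Hence a symplectic map changes the cocycle only by multiples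
of `d`. -/
theorem redHom_cocycle (u v : V) : redHom d (V.cocycle u v) = V.omega u v := by
  simp [cocycle, redHom_signExt, redHom_omegaExt]

variable {U V W} (ψ : V →ₗ[ZMod d] W)

/-- The linear extension of the lifted values of a linear map on basis vectors. -/
def extMap : V.ExtVec →ₗ[ZMod (dExt d)] W.ExtVec :=
  ∑ j, (LinearMap.proj j).smulRight (W.lift (ψ (V.basis j)))

theorem extMap_apply (a : V.ExtVec) : extMap ψ a = ∑ j, a j • W.lift (ψ (V.basis j)) := by
  simp [extMap]

/-- `extMap ψ` is linear modulo d' and lifts ψ, but it preserves ω' only modulo `d` when ψ is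
symplectic. That defect is what `quadExt` records. -/
theorem redVec_extMap (a : V.ExtVec) : W.redVec (extMap ψ a) = ψ (V.redVec a) := by
  have hs : W.redVec (extMap ψ a) = ∑ j, redHom d (a j) • ψ (V.basis j) := by
    have hr : ∀ (s : Finset (Fin V.rank)) (f : Fin V.rank → W.ExtVec),
        W.redVec (∑ j ∈ s, f j) = ∑ j ∈ s, W.redVec (f j) := fun s f =>
      map_sum (AddMonoidHom.mk' W.redVec W.redVec_add) f s
    rw [extMap_apply, hr]
    exact Finset.sum_congr rfl fun j _ => by rw [redVec_smul, redVec_lift]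
  rw [hs, redVec, Module.Basis.equivFun_symm_apply, map_sum]
  simp only [map_smul]

/-- The part of `extMap` at one qudit. -/
def extPair (a : V.ExtVec) (i : Fin V.n) : W.ExtVec :=
  a (V.pair (Sum.inl i)) • W.lift (ψ (V.bx i)) + a (V.pair (Sum.inr i)) • W.lift (ψ (V.bz i))

theorem sum_extPair (a : V.ExtVec) : ∑ i, extPair ψ a i = extMap ψ a := by
  rw [extMap_apply, ← V.pair.sum_comp, Fintype.sum_sum_type, ← Finset.sum_add_distrib]
  rfl

/-- The quadratic phase exponent of the ordered product over the qudits. -/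
def quadExt (a : V.ExtVec) : ZMod (dExt d) :=
  ∑ i, a (V.pair (Sum.inl i)) * a (V.pair (Sum.inr i)) *
      (1 + W.omegaExt (W.lift (ψ (V.bx i))) (W.lift (ψ (V.bz i))))
    + ∑ i, ∑ j ∈ Finset.Ioi i, W.omegaExt (extPair ψ a i) (extPair ψ a j)

/-- The phase exponent whose half is the correction `kappa`. -/
def kappaExt (v : V) : ZMod (dExt d) := quadExt ψ (V.lift v) + W.signExt (extMap ψ (V.lift v))

/-- The terms ω'(w_i, lift of ψ(v)) sum by linearity to the sign of the vector ∑ w_i, which is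
`extMap ψ (V.lift v)` and reduces to ψ(v). What remains is the quadratic part. -/
theorem halfD_kappa (v : V) : halfD d (kappa V W ψ v) = halfPhase (kappaExt ψ v) := by
  rw [halfPhase, kappa, kappaExt, quadExt, signExt, redVec_extMap, redVec_lift, ← sum_extPair,
    omegaExt_sum_left]
  congr 2
  have h : ∀ i, W.omegaExt (extPair ψ (V.lift v) i) (W.lift (ψ v)) =
      V.lift v (V.pair (Sum.inl i)) * W.omegaExt (W.lift (ψ (V.bx i))) (W.lift (ψ v)) +
      V.lift v (V.pair (Sum.inr i)) * W.omegaExt (W.lift (ψ (V.bz i))) (W.lift (ψ v)) := by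
    intro i
    rw [extPair, omegaExt_add_left, omegaExt_smul_left, omegaExt_smul_left]
  simp only [h, Finset.sum_add_distrib]
  exact (congrArg (· + _) (add_assoc _ _ _)).trans (add_right_comm _ _ _)

theorem extPair_add (a b : V.ExtVec) (i : Fin V.n) :
    extPair ψ (a + b) i = extPair ψ a i + extPair ψ b i := by
  simp only [extPair, Pi.add_apply, add_smul]; abel

/-! ### How the correction fails to be additive. -/

variable {ψ}

theorem x_basis_pair (s : Fin V.n ⊕ Fin V.n) (i : Fin V.n) :
    V.x (V.basis (V.pair s)) i = if s = Sum.inl i then 1 else 0 := by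
  simp [x, Finsupp.single_apply]

theorem z_basis_pair (s : Fin V.n ⊕ Fin V.n) (i : Fin V.n) :
    V.z (V.basis (V.pair s)) i = if s = Sum.inr i then 1 else 0 := by
  simp [z, Finsupp.single_apply]

theorem omega_basis_pair (i j : Fin V.n) :
    V.omega (V.bx i) (V.bx j) = 0 ∧ V.omega (V.bz i) (V.bz j) = 0 ∧
      V.omega (V.bx i) (V.bz j) = if i = j then -1 else 0 := by
  refine ⟨?_, ?_, ?_⟩ <;> simp [omega, bx, bz, x_basis_pair, z_basis_pair, eq_comm, apply_ite]

theorem omega_smul_add_smul (a b a' b' : ZMod d) {i j : Fin V.n} (hij : i ≠ j) :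
    V.omega (a • V.bx i + b • V.bz i) (a' • V.bx j + b' • V.bz j) = 0 := by
  have hx : ∀ (a b : ZMod d) (i k : Fin V.n),
      V.x (a • V.bx i + b • V.bz i) k = if i = k then a else 0 := fun a b i k => by
    simp [x, bx, bz, Finsupp.single_apply]
  have hz : ∀ (a b : ZMod d) (i k : Fin V.n),
      V.z (a • V.bx i + b • V.bz i) k = if i = k then b else 0 := fun a b i k => by
    simp [z, bx, bz, Finsupp.single_apply]
  simp [omega, hx, hz, hij, hij.symm]

/-- An additive function on a free module that vanishes on a basis is zero. -/
theorem eq_zero_of_additive {M : Type*} [AddCommGroup M] {f : V → M} (hf : ∀ u v, f (u + v) = f u + f v)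
    (hb : ∀ j, f (V.basis j) = 0) (v : V) : f v = 0 := by
  let F : V →+ M := AddMonoidHom.mk' f hf
  change F v = 0
  rw [← V.basis.sum_repr v, map_sum]
  refine Finset.sum_eq_zero fun j _ => ?_
  rw [← ZMod.natCast_zmod_val (V.basis.repr v j), Nat.cast_smul_eq_nsmul, map_nsmul]
  exact (congrArg _ (hb j)).trans (smul_zero _)

theorem lift_basis (j : Fin V.rank) : V.lift (V.basis j) = Pi.single j 1 := by
  funext k
  by_cases h : k = j
  · subst h; simp [lift]
  · simp [lift, h]

theorem lift_smul_basis (r : ZMod d) (j : Fin V.rank) :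
    V.lift (r • V.basis j) = liftZ r • V.lift (V.basis j) := by
  funext k
  by_cases h : k = j
  · subst h; simp [lift]
  · simp [lift, h]

/-- Every term contains a product of two distinct coordinates of the argument, and the lift of a
basis vector has a single nonzero coordinate. -/
theorem quadExt_lift_basis (j : Fin V.rank) : quadExt ψ (V.lift (V.basis j)) = 0 := by
  rw [lift_basis, quadExt]
  have h2 : ∀ s t : Fin V.n ⊕ Fin V.n, s ≠ t →
      (Pi.single j 1 : V.ExtVec) (V.pair s) * (Pi.single j 1 : V.ExtVec) (V.pair t) = 0 := by
    intro s t hst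
    by_cases h : V.pair s = j
    · have : V.pair t ≠ j := fun h' => hst (V.pair.injective (h.trans h'.symm))
      simp [Pi.single_apply, this]
    · simp [Pi.single_apply, h]
  rw [Finset.sum_eq_zero fun i _ => by rw [h2 _ _ (by simp), zero_mul], zero_add]
  refine Finset.sum_eq_zero fun i _ => Finset.sum_eq_zero fun k hk => ?_
  have hik : k ≠ i := (Finset.mem_Ioi.1 hk).ne'
  simp only [extPair, omegaExt_add_left, omegaExt_add_right, omegaExt_smul_left,
    omegaExt_smul_right, mul_add, ← mul_assoc]
  rw [h2 _ _ (by simp [hik]), h2 _ _ (by simp), h2 _ _ (by simp), h2 _ _ (by simp [hik])]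
  simp

theorem extMap_lift_basis (j : Fin V.rank) :
    extMap ψ (V.lift (V.basis j)) = W.lift (ψ (V.basis j)) := by
  rw [lift_basis, extMap_apply, Finset.sum_eq_single j] <;> simp +contextual

theorem quadExt_smul (r : ZMod (dExt d)) (a : V.ExtVec) :
    quadExt ψ (r • a) = r * r * quadExt ψ a := by
  have h : ∀ i, extPair ψ (r • a) i = r • extPair ψ a i := fun i => by
    simp only [extPair, Pi.smul_apply, smul_eq_mul, smul_add, mul_smul]
  simp only [quadExt, h, omegaExt_smul_left, omegaExt_smul_right, Pi.smul_apply, smul_eq_mul,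
    mul_add, Finset.mul_sum]
  refine congrArg₂ (· + ·) (Finset.sum_congr rfl fun i _ => by ring)
    (Finset.sum_congr rfl fun i _ => Finset.sum_congr rfl fun j _ => by ring)

/-- The quadratic part is homogeneous of degree two, so it stays zero on multiples of basis vectors.
What is left is precisely the phase of a power. -/
theorem kappaExt_smul_basis (r : ZMod d) (j : Fin V.rank) :
    kappaExt ψ (r • V.basis j) = W.signExt (liftZ r • W.lift (ψ (V.basis j))) := by
  rw [kappaExt, lift_smul_basis, quadExt_smul, quadExt_lift_basis, map_smul, extMap_lift_basis,
    mul_zero, zero_add]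

theorem kappaExt_basis (j : Fin V.rank) : kappaExt ψ (V.basis j) = 0 := by
  rw [← one_smul (ZMod d) (V.basis j), kappaExt_smul_basis, liftZ_one, one_smul, signExt_lift]

theorem redHom_omegaExt_pair (hψ : IsSymplectic V W ψ) (i : Fin V.n) :
    redHom d (1 + W.omegaExt (W.lift (ψ (V.bx i))) (W.lift (ψ (V.bz i)))) = 0 := by
  rw [map_add, redHom_omegaExt, redVec_lift, redVec_lift, hψ, (omega_basis_pair i i).2.2]
  simp

theorem redHom_omegaExt_extPair (hψ : IsSymplectic V W ψ) (a b : V.ExtVec) {i j : Fin V.n} (hij : i ≠ j) :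
    redHom d (W.omegaExt (extPair ψ a i) (extPair ψ b j)) = 0 := by
  rw [redHom_omegaExt]
  simp only [extPair, redVec_add, redVec_smul, redVec_lift, ← map_smul, ← map_add]
  rw [hψ, omega_smul_add_smul _ _ _ _ hij]

/-- This is the polarization of the quadratic exponent. Multiplying two ordered products and
restoring the order of the qudits moves factors past one another; for a symplectic ψ the commutation
exponents across qudits are multiples of `d`, so their doubles disappear. -/
theorem quadExt_add (hψ : IsSymplectic V W ψ) (a b : V.ExtVec) :
    quadExt ψ (a + b) =
    quadExt ψ a + quadExt ψ b + W.omegaExt (extMap ψ a) (extMap ψ b) - V.omegaExt a b := by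
  have h1 : W.omegaExt (extMap ψ a) (extMap ψ b) =
      ∑ i, W.omegaExt (extPair ψ a i) (extPair ψ b i) +
      ∑ i, ∑ j ∈ Finset.Ioi i, (W.omegaExt (extPair ψ a i) (extPair ψ b j) +
        W.omegaExt (extPair ψ b i) (extPair ψ a j)) := by
    -- Antisymmetry costs a sign, which is harmless on a multiple of `d`. Afterwards the sum over i
    -- < j is the full off-diagonal sum.
    have h2 : ∀ i, ∀ j ∈ Finset.Ioi i, W.omegaExt (extPair ψ a i) (extPair ψ b j) +
        W.omegaExt (extPair ψ b i) (extPair ψ a j) = W.omegaExt (extPair ψ a j) (extPair ψ b i) +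
        W.omegaExt (extPair ψ a i) (extPair ψ b j) := by
      intro i j hj
      have h := two_mul_eq_zero
        (redHom_omegaExt_extPair hψ a b (Finset.mem_Ioi.1 hj).ne')
      rw [W.omegaExt_antisymm (extPair ψ b i)]
      linear_combination -h
    rw [Finset.sum_congr rfl fun i _ => Finset.sum_congr rfl (h2 i),
      Finset.sum_sum_Ioi_add_eq_sum_sum_off_diag, ← Finset.sum_add_distrib, ← sum_extPair,
      ← sum_extPair, omegaExt_sum_left]
    simp only [omegaExt_sum_right]
    rw [Finset.sum_comm]
    refine Finset.sum_congr rfl fun i _ => ?_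
    rw [← Finset.sum_add_sum_compl {i}, Finset.sum_singleton]
  have h3 : ∀ i, W.omegaExt (extPair ψ a i) (extPair ψ b i) =
      (a (V.pair (Sum.inl i)) * b (V.pair (Sum.inr i)) -
        b (V.pair (Sum.inl i)) * a (V.pair (Sum.inr i))) *
        W.omegaExt (W.lift (ψ (V.bx i))) (W.lift (ψ (V.bz i))) := by
    intro i
    simp only [extPair, omegaExt_add_left, omegaExt_add_right, omegaExt_smul_left,
      omegaExt_smul_right, omegaExt_self, W.omegaExt_antisymm (W.lift (ψ (V.bz i)))
        (W.lift (ψ (V.bx i)))]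
    ring
  have h4 : V.omegaExt a b = ∑ i, (a (V.pair (Sum.inr i)) * b (V.pair (Sum.inl i))
    - b (V.pair (Sum.inr i)) * a (V.pair (Sum.inl i))) := rfl
  have h5 : ∑ i, (a + b) (V.pair (Sum.inl i)) * (a + b) (V.pair (Sum.inr i)) *
      (1 + W.omegaExt (W.lift (ψ (V.bx i))) (W.lift (ψ (V.bz i)))) =
      ∑ i, a (V.pair (Sum.inl i)) * a (V.pair (Sum.inr i)) *
        (1 + W.omegaExt (W.lift (ψ (V.bx i))) (W.lift (ψ (V.bz i)))) +
      ∑ i, b (V.pair (Sum.inl i)) * b (V.pair (Sum.inr i)) *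
        (1 + W.omegaExt (W.lift (ψ (V.bx i))) (W.lift (ψ (V.bz i)))) +
      ∑ i, W.omegaExt (extPair ψ a i) (extPair ψ b i) - V.omegaExt a b := by
    rw [h4, ← Finset.sum_add_distrib, ← Finset.sum_add_distrib, ← Finset.sum_sub_distrib]
    refine Finset.sum_congr rfl fun i _ => ?_
    rw [h3, Pi.add_apply, Pi.add_apply]
    -- The two sides differ by twice x(b)z(a)(1 + ω'(ψb^x, ψb^z)); the last factor is a multiple of
    -- `d` because ω(b^x, b^z) = −1.
    linear_combination b (V.pair (Sum.inl i)) * a (V.pair (Sum.inr i)) *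
      two_mul_eq_zero (redHom_omegaExt_pair hψ i)
  rw [quadExt, h5, h1]
  simp only [quadExt, extPair_add, omegaExt_add_left, omegaExt_add_right, Finset.sum_add_distrib]
  ring

/-- The cross term is d times the difference of two forms that agree modulo `d`, and d² = 0. So the
quadratic exponent depends only on the reduced vector. -/
theorem quadExt_add_natCast_smul (hψ : IsSymplectic V W ψ) (a c : V.ExtVec) :
    quadExt ψ (a + (d : ZMod (dExt d)) • c) = quadExt ψ a := by
  rw [quadExt_add hψ, quadExt_smul, natCast_self_mul_self, map_smul, omegaExt_smul_right,
    omegaExt_smul_right, add_sub_assoc, ← mul_sub, natCast_mul_eq_zero]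
  · ring
  · rw [map_sub, redHom_omegaExt, redHom_omegaExt, redVec_extMap, redVec_extMap, hψ, sub_self]

/-- The correction of a symplectic morphism transports one cocycle to the other. -/
theorem kappaExt_add (hψ : IsSymplectic V W ψ) (u v : V) :
    kappaExt ψ (u + v) =
    kappaExt ψ u + kappaExt ψ v + W.cocycle (ψ u) (ψ v) - V.cocycle u v := by
  -- The vectors α, β, δ measure how `extMap ψ` misses the lifts of ψ(u), ψ(v), ψ(u+v); ε and γ are
  -- the carries of the additions in the source and in the target.
  obtain ⟨α, hα⟩ := exists_eq_add_smul W (a := extMap ψ (V.lift u)) (b := W.lift (ψ u))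
    (by rw [redVec_extMap, redVec_lift, redVec_lift])
  obtain ⟨β, hβ⟩ := exists_eq_add_smul W (a := extMap ψ (V.lift v)) (b := W.lift (ψ v))
    (by rw [redVec_extMap, redVec_lift, redVec_lift])
  obtain ⟨δ, hδ⟩ := exists_eq_add_smul W (a := extMap ψ (V.lift (u + v)))
    (b := W.lift (ψ (u + v))) (by rw [redVec_extMap, redVec_lift, redVec_lift])
  obtain ⟨ε, hε⟩ := exists_eq_add_smul V (a := V.lift u + V.lift v) (b := V.lift (u + v))
    (by simp)
  obtain ⟨γ, hγ⟩ := exists_eq_add_smul W (a := W.lift (ψ u) + W.lift (ψ v))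
    (b := W.lift (ψ (u + v))) (by simp)
  have hq : quadExt ψ (V.lift (u + v)) = quadExt ψ (V.lift u) + quadExt ψ (V.lift v) +
      W.omegaExt (extMap ψ (V.lift u)) (extMap ψ (V.lift v)) -
      V.omegaExt (V.lift u) (V.lift v) := by
    rw [← quadExt_add hψ, hε, quadExt_add_natCast_smul hψ]
  -- Applying `extMap ψ` to the carry equation in the source and comparing with the one in the
  -- target links all five errors.
  have hd' : (d : ZMod (dExt d)) • δ =
      (d : ZMod (dExt d)) • (γ + α + β - extMap ψ ε) := by
    have h := congrArg (extMap ψ) hε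
    rw [map_add, map_add, map_smul, hα, hβ, hδ] at h
    have h' := congrArg (· + (d : ZMod (dExt d)) • (α + β)) hγ
    simp only [smul_add, smul_sub] at h' ⊢
    rw [eq_sub_iff_add_eq, ← add_right_inj (W.lift (ψ (u + v))), ← add_assoc, ← h]
    exact (by abel : _ = _).trans (h'.trans (by abel))
  -- Behind a factor `d` only residues count, so lifting behaves additively.
  have hr : ∀ a, (d : ZMod (dExt d)) * W.omegaExt a (W.lift (ψ (u + v))) =
      d * W.omegaExt a (W.lift (ψ u)) + d * W.omegaExt a (W.lift (ψ v)) := fun a => by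
    rw [← mul_add, ← omegaExt_add_right]
    exact natCast_mul_omegaExt_congr W rfl (by simp)
  have hs : (d : ZMod (dExt d)) * W.omegaExt δ (W.lift (ψ (u + v))) =
      d * W.omegaExt γ (W.lift (ψ (u + v))) + d * W.omegaExt α (W.lift (ψ (u + v))) +
      d * W.omegaExt β (W.lift (ψ (u + v))) -
      d * W.omegaExt (extMap ψ ε) (W.lift (ψ (u + v))) := by
    rw [← omegaExt_smul_left, hd', omegaExt_smul_left, sub_eq_add_neg, ← neg_one_smul (ZMod (dExt d)),
      omegaExt_add_left, omegaExt_add_left, omegaExt_add_left, omegaExt_smul_left]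
    ring
  -- Symplecticity of ψ turns the carry of the source, seen in the target, back into the sign
  -- occurring in the source cocycle.
  have he : (d : ZMod (dExt d)) * W.omegaExt (extMap ψ ε) (W.lift (ψ (u + v))) =
      d * V.omegaExt ε (V.lift (u + v)) :=
    natCast_mul_congr (by
      rw [redHom_omegaExt, redHom_omegaExt, redVec_extMap, redVec_lift, redVec_lift, hψ])
  rw [kappaExt, kappaExt, kappaExt, cocycle, cocycle, hq, hδ, hα, hβ, hε, hγ]
  simp only [signExt_add_smul, hs, he]
  rw [hr α, hr β]
  simp only [omegaExt_add_left, omegaExt_add_right, omegaExt_smul_left, omegaExt_smul_right]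
  rw [W.omegaExt_antisymm (W.lift (ψ u)) β]
  linear_combination (W.omegaExt α (W.lift (ψ v))) * two_mul_natCast_self (d := d)
    + W.omegaExt α β * natCast_self_mul_self (d := d)

/-- Modulo `d` the two cocycles are ω before and after ψ, so the reduced correction is additive, and
it is zero on the basis. This makes `halfPhase_add` applicable to corrections. -/
theorem redHom_kappaExt (hψ : IsSymplectic V W ψ) (v : V) : redHom d (kappaExt ψ v) = 0 := by
  refine eq_zero_of_additive (f := fun v => redHom d (kappaExt ψ v)) (fun u v => ?_)
    (fun j => by rw [kappaExt_basis, map_zero]) v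
  rw [kappaExt_add hψ, map_sub, map_add, map_add, redHom_cocycle, redHom_cocycle, hψ,
    add_sub_cancel_right]


end SObj
end
end ProjCliff

namespace ProjCliff
noncomputable section
set_option linter.unusedSectionVars false

/-! Composition laws for condensed encodings. -/

namespace SObj

variable {d : ℕ} [hd : Fact (1 < d)] {U V W : SObj d}

/-- The cocycle of the middle module occurs twice with opposite signs and cancels. -/
theorem kappaExt_comp_add {φ : V →ₗ[ZMod d] W} {ψ : U →ₗ[ZMod d] V}
    (hφ : IsSymplectic V W φ) (hψ : IsSymplectic U V ψ) (u v : U) :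
    kappaExt ψ (u + v) + kappaExt φ (ψ (u + v)) - kappaExt (φ ∘ₗ ψ) (u + v) =
      (kappaExt ψ u + kappaExt φ (ψ u) - kappaExt (φ ∘ₗ ψ) u) +
      (kappaExt ψ v + kappaExt φ (ψ v) - kappaExt (φ ∘ₗ ψ) v) := by
  have hφψ : IsSymplectic U W (φ ∘ₗ ψ) := fun u v => (hφ _ _).trans (hψ u v)
  rw [kappaExt_add hψ, kappaExt_add hφψ, map_add, kappaExt_add hφ]
  simp only [LinearMap.comp_apply]
  ring

/-- In general the two sides differ by an additive function; the condition `hb` says that this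
function is zero on the basis. -/
theorem kappaExt_comp {φ : V →ₗ[ZMod d] W} {ψ : U →ₗ[ZMod d] V}
    (hφ : IsSymplectic V W φ) (hψ : IsSymplectic U V ψ)
    (hb : ∀ j, kappaExt φ (ψ (U.basis j)) = 0) (u : U) :
    kappaExt (φ ∘ₗ ψ) u = kappaExt ψ u + kappaExt φ (ψ u) := by
  refine (sub_eq_zero.1 (eq_zero_of_additive
    (f := fun u => kappaExt ψ u + kappaExt φ (ψ u) - kappaExt (φ ∘ₗ ψ) u)
    (kappaExt_comp_add hφ hψ) (fun j => ?_) u)).symm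
  rw [kappaExt_basis, kappaExt_basis, hb, add_zero, sub_zero]

theorem kappaExt_eq_zero {ψ : V →ₗ[ZMod d] W} (hψ : IsSymplectic V W ψ)
    (hc : ∀ u v, W.cocycle (ψ u) (ψ v) = V.cocycle u v) (v : V) : kappaExt ψ v = 0 :=
  eq_zero_of_additive (fun u v => by rw [kappaExt_add hψ, hc, add_sub_cancel_right])
    kappaExt_basis v

/-! ### Corrections of identities, injections and copairings, and on one conjugate pair. -/

theorem isSymplectic_id : IsSymplectic V V LinearMap.id := fun _ _ => rfl

theorem kappaExt_id (v : V) : kappaExt (LinearMap.id : V →ₗ[ZMod d] V) v = 0 :=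
  kappaExt_eq_zero isSymplectic_id (fun _ _ => rfl) v

theorem lift_redVec (a : V.ExtVec) : V.lift (V.redVec a) = fun j => liftZ (redHom d (a j)) := by
  funext j; rw [lift, repr_redVec]

theorem omegaExt_sum (a b : (V.sum W).ExtVec) :
    (V.sum W).omegaExt a b =
      V.omegaExt (fun j => a (finSumFinEquiv (Sum.inl j)))
        (fun j => b (finSumFinEquiv (Sum.inl j))) +
      W.omegaExt (fun j => a (finSumFinEquiv (Sum.inr j)))
        (fun j => b (finSumFinEquiv (Sum.inr j))) := by
  have hl := PHom.pair_sum_inl V W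
  have hr := PHom.pair_sum_inr V W
  refine (Fin.sum_univ_add _).trans (congrArg₂ (· + ·) (Finset.sum_congr rfl fun i _ => ?_)
    (Finset.sum_congr rfl fun i _ => ?_))
  · beta_reduce
    rw [← hl (Sum.inl i), ← hl (Sum.inr i)]; rfl
  · beta_reduce
    rw [← hr (Sum.inl i), ← hr (Sum.inr i)]; rfl

theorem lift_sum_inl (p : V × W) (j : Fin V.rank) :
    (V.sum W).lift p (finSumFinEquiv (Sum.inl j)) = V.lift p.1 j := by
  simp [lift]

theorem lift_sum_inr (p : V × W) (j : Fin W.rank) :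
    (V.sum W).lift p (finSumFinEquiv (Sum.inr j)) = W.lift p.2 j := by
  simp [lift]

theorem signExt_sum (a : (V.sum W).ExtVec) :
    (V.sum W).signExt a = V.signExt (fun j => a (finSumFinEquiv (Sum.inl j))) +
      W.signExt (fun j => a (finSumFinEquiv (Sum.inr j))) := by
  simp only [signExt, omegaExt_sum, lift_redVec]

theorem cocycle_sum (p q : V × W) :
    (V.sum W).cocycle p q = V.cocycle p.1 q.1 + W.cocycle p.2 q.2 := by
  have h1 : ∀ (p q : V × W), (fun j => ((V.sum W).lift p + (V.sum W).lift q)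
      (finSumFinEquiv (Sum.inl j))) = V.lift p.1 + V.lift q.1 := fun p q => by
    funext j; simp only [Pi.add_apply, lift_sum_inl]
  have h2 : ∀ (p q : V × W), (fun j => ((V.sum W).lift p + (V.sum W).lift q)
      (finSumFinEquiv (Sum.inr j))) = W.lift p.2 + W.lift q.2 := fun p q => by
    funext j; simp only [Pi.add_apply, lift_sum_inr]
  rw [cocycle, cocycle, cocycle, signExt_sum, h1, h2, omegaExt_sum]
  simp only [lift_sum_inl, lift_sum_inr]
  exact add_add_add_comm _ _ _ _

theorem omegaExt_zero_left (a : V.ExtVec) : V.omegaExt 0 a = 0 := by simp [omegaExt]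

theorem cocycle_zero_left (v : V) : V.cocycle 0 v = 0 := by
  rw [cocycle, lift_zero, omegaExt_zero_left, zero_add, zero_add, signExt_lift]

theorem cocycle_zero_right (v : V) : V.cocycle v 0 = 0 := by
  rw [cocycle, lift_zero, omegaExt_antisymm, omegaExt_zero_left, add_zero, signExt_lift]; simp

theorem kappaExt_inl (v : V) :
    kappaExt (V := V) (W := V.sum W) (LinearMap.inl (ZMod d) V W) v = 0 :=
  kappaExt_eq_zero (PHom.isSymplectic_inl V W) (fun u v => by
    refine (cocycle_sum (V := V) (W := W) (u, 0) (v, 0)).trans ?_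
    rw [cocycle_zero_left, add_zero]) v

theorem kappaExt_inr (v : W) :
    kappaExt (V := W) (W := V.sum W) (LinearMap.inr (ZMod d) V W) v = 0 :=
  kappaExt_eq_zero (PHom.isSymplectic_inr V W) (fun u v => by
    refine (cocycle_sum (V := V) (W := W) (0, u) (0, v)).trans ?_
    rw [cocycle_zero_left, zero_add]) v

theorem sum_basis_inl (j : Fin V.rank) :
    (V.sum W).basis (finSumFinEquiv (Sum.inl j)) = (V.basis j, 0) := by
  simp

theorem sum_basis_inr (j : Fin W.rank) :
    (V.sum W).basis (finSumFinEquiv (Sum.inr j)) = (0, W.basis j) := by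
  simp

/-- Split (u, v) as (u, 0) + (0, v). The two parts have trivial cocycle in the source, and on each
part the correction is that of ψ₁ or ψ₂ because the injections have none. -/
theorem kappaExt_coprod {ψ₁ : U →ₗ[ZMod d] W} {ψ₂ : V →ₗ[ZMod d] W}
    (h : IsSymplectic (U.sum V) W (LinearMap.coprod ψ₁ ψ₂)) (u : U) (v : V) :
    kappaExt (V := U.sum V) (LinearMap.coprod ψ₁ ψ₂) (u, v) =
      kappaExt ψ₁ u + kappaExt ψ₂ v + W.cocycle (ψ₁ u) (ψ₂ v) := by
  have h1 : kappaExt ψ₁ u = kappaExt (V := U.sum V) (LinearMap.coprod ψ₁ ψ₂) (u, 0) := by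
    have := kappaExt_comp (U := U) (V := U.sum V) (W := W) h (PHom.isSymplectic_inl U V)
      (fun j => by
        refine (congrArg _ (sum_basis_inl j).symm).trans (kappaExt_basis (V := U.sum V) _)) u
    rw [kappaExt_inl, zero_add, LinearMap.coprod_inl] at this
    exact this
  have h2 : kappaExt ψ₂ v = kappaExt (V := U.sum V) (LinearMap.coprod ψ₁ ψ₂) (0, v) := by
    have := kappaExt_comp (U := V) (V := U.sum V) (W := W) h (PHom.isSymplectic_inr U V)
      (fun j => by
        refine (congrArg _ (sum_basis_inr j).symm).trans (kappaExt_basis (V := U.sum V) _)) v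
    rw [kappaExt_inr, zero_add, LinearMap.coprod_inr] at this
    exact this
  have h3 := kappaExt_add (V := U.sum V) h (u, 0) (0, v)
  have h4 : (U.sum V).cocycle (u, 0) (0, v) = 0 :=
    (cocycle_sum (V := U) (W := V) (u, 0) (0, v)).trans (by
      rw [cocycle_zero_left, cocycle_zero_right, zero_add])
  rw [h4, sub_zero, ← h1, ← h2] at h3
  have h5 : ((u, 0) + (0, v) : U × V) = (u, v) := by simp
  refine (congrArg (kappaExt (V := U.sum V) (LinearMap.coprod ψ₁ ψ₂)) h5.symm).trans (h3.trans ?_)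
  simp

theorem lift_x (v : V) (i : Fin V.n) : V.lift v (V.pair (Sum.inl i)) = liftZ (V.x v i) := rfl

theorem lift_z (v : V) (i : Fin V.n) : V.lift v (V.pair (Sum.inr i)) = liftZ (V.z v i) := rfl

theorem omegaExt_bz_bx (i : Fin V.n) :
    V.omegaExt (V.lift (V.bz i)) (V.lift (V.bx i)) = 1 := by
  simp [omegaExt, lift_x, lift_z, bx, bz, x_basis_pair, z_basis_pair, apply_ite liftZ]

/-- The two vectors have disjoint supports, so their lifts add without a carry and the sign part is
zero. -/
theorem cocycle_bz_bx (i : Fin V.n) (a b : ZMod d) :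
    V.cocycle (b • V.bz i) (a • V.bx i) = liftZ b * liftZ a := by
  have h : V.lift (b • V.bz i) + V.lift (a • V.bx i) = V.lift (b • V.bz i + a • V.bx i) := by
    have hne : V.pair (Sum.inr i) ≠ V.pair (Sum.inl i) := by simp
    funext k
    by_cases h1 : k = V.pair (Sum.inr i)
    · subst h1; simp [lift, bz, bx]
    · by_cases h2 : k = V.pair (Sum.inl i)
      · subst h2; simp [lift, bz, bx]
      · simp [lift, bz, bx, h1, h2]
  rw [cocycle, h, signExt_lift, add_zero, bz, bx, lift_smul_basis, lift_smul_basis,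
    omegaExt_smul_left, omegaExt_smul_right, ← mul_assoc]
  exact (congrArg _ (omegaExt_bz_bx i)).trans (mul_one _)

theorem kappaExt_bz_bx {ψ : V →ₗ[ZMod d] W} (hψ : IsSymplectic V W ψ) (i : Fin V.n)
    (a b : ZMod d) : kappaExt ψ (b • V.bz i + a • V.bx i) =
      W.signExt (liftZ b • W.lift (ψ (V.bz i))) + W.signExt (liftZ a • W.lift (ψ (V.bx i))) +
      W.cocycle (b • ψ (V.bz i)) (a • ψ (V.bx i)) - liftZ b * liftZ a := by
  rw [kappaExt_add hψ, cocycle_bz_bx, map_smul, map_smul]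
  exact congrArg₂ _ (congrArg₂ _ (congrArg₂ _ (kappaExt_smul_basis _ _)
    (kappaExt_smul_basis _ _)) rfl) rfl

end SObj

/-! ### Phases and vectors of global elements; the equations behind the case rules. -/

namespace PHom

variable {d : ℕ} [hd : Fact (1 < d)] {V V₁ V₂ W X : SObj d}

/-- The phase of a global element. -/
def phase (f : PHom .unit V) : ZMod d := f.μ (one d)

/-- The vector of a global element. -/
def vec (f : PHom .unit V) : V := f.ψ (one d)

/-- The phase part of a morphism between symplectic objects. -/
def phaseMap (f : PHom (.pauli V) W) : V →ₗ[ZMod d] ZMod d := f.μ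

/-- The linear part of a morphism between symplectic objects. -/
def lin (f : PHom (.pauli V) W) : V →ₗ[ZMod d] W := f.ψ

theorem lin_isSymplectic (f : PHom (.pauli V) W) : SObj.IsSymplectic V W f.lin := f.isMor

theorem ext_unit {f g : PHom .unit V} (hμ : f.phase = g.phase) (hψ : f.vec = g.vec) : f = g :=
  PHom.ext (LinearMap.ext_ring hμ) (LinearMap.ext_ring hψ)

theorem comp_vec (g : PHom (.pauli V) W) (f : PHom .unit V) :
    (comp g f).vec = g.lin f.vec := rfl

theorem comp_lin (h : PHom (.pauli W) X) (g : PHom (.pauli V) W) :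
    (comp h g).lin = h.lin ∘ₗ g.lin := rfl

/-- Only basis vectors are allowed here: the phase of the composite is linear, whereas the
correction is not. -/
theorem comp_phaseMap_basis (h : PHom (.pauli W) X) (g : PHom (.pauli V) W) (j : Fin V.rank) :
    (comp h g).phaseMap (V.basis j) = g.phaseMap (V.basis j) + h.phaseMap (g.lin (V.basis j)) +
      halfPhase (SObj.kappaExt h.lin (g.lin (V.basis j))) := by
  refine (Module.Basis.constr_basis (PObj.pauli V).toCObj.basis (ZMod d) _ j).trans
    (congrArg _ ?_)
  exact (mul_one (M := ZMod d) _).trans (SObj.halfD_kappa _ _)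

/-- The unit object has the single basis vector 1, so here the prescribed value is the whole phase
and κ is evaluated at an arbitrary vector. -/
theorem comp_phase (g : PHom (.pauli V) W) (f : PHom .unit V) : (comp g f).phase =
      f.phase + g.phaseMap f.vec + halfPhase (SObj.kappaExt g.lin f.vec) := by
  have h : (CObj.unit d).basis (0 : Fin 1) = one d := Module.Basis.singleton_apply _ _ _
  have h2 : (comp g f).phase = f.μ ((CObj.unit d).basis (0 : Fin 1)) +
      g.phaseMap (f.ψ ((CObj.unit d).basis (0 : Fin 1))) +
      halfPhase (SObj.kappaExt g.lin (f.ψ ((CObj.unit d).basis (0 : Fin 1)))) := by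
    refine (congrArg (comp g f).μ h.symm).trans ?_
    refine (Module.Basis.constr_basis _ _ _ _).trans (congrArg _ ?_)
    exact (mul_one (M := ZMod d) _).trans (SObj.halfD_kappa _ _)
  rw [h2, h]
  rfl

/-- The scalar by which an endomorphism of the unit multiplies. -/
def scalar (m : (PObj.unit : PObj d).toCObj →ₗ[ZMod d] CObj.unit d) : ZMod d := m (one d)

theorem addPhase_phase (m : (PObj.unit : PObj d).toCObj →ₗ[ZMod d] CObj.unit d)
    (f : PHom .unit V) : (addPhase m f).phase = scalar m + f.phase := rfl

theorem addPhase_vec (m : (PObj.unit : PObj d).toCObj →ₗ[ZMod d] CObj.unit d)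
    (f : PHom .unit V) : (addPhase m f).vec = f.vec := rfl

theorem star_vec (f g : PHom .unit V) : (star f g).vec = f.vec + g.vec := rfl

/-- The sign of the scalar ω' of the lifts is its distance from the lift of its residue ω. Adding
the sign of the vector sum gives the cocycle minus that lift. -/
theorem star_phase (f g : PHom .unit V) : (star f g).phase = f.phase + g.phase +
    halfPhase (V.cocycle f.vec g.vec - liftZ (V.omega f.vec g.vec)) := by
  refine (one_smul (ZMod d) _).trans (congrArg _ ?_)
  refine (mul_one (M := ZMod d) _).trans ?_
  rw [halfD_add, SObj.sgnVec_eq, sgn, redZ_eq, SObj.redHom_omegaExt, SObj.redVec_lift,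
    SObj.redVec_lift, SObj.cocycle, add_sub_right_comm, halfPhase_add]
  · rfl
  · simp [SObj.redHom_omegaExt]
  · exact SObj.redHom_signExt _ _

theorem compUnit_phase (f : PHom .unit V) (r : ZMod d) :
    (compUnit f (r • LinearMap.id)).phase = r * f.phase +
      halfPhase (V.signExt (liftZ r • V.lift f.vec)) := by
  refine (one_smul (ZMod d) _).trans (congrArg₂ _ ?_ ?_)
  · exact (map_smul f.μ r (one d)).trans rfl
  · refine (mul_one (M := ZMod d) _).trans ?_
    have h : ((r • LinearMap.id : UnitEnd d) (one d) : ZMod d) = r := mul_one (M := ZMod d) r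
    rw [h, ← SObj.sgnVec_eq]
    rfl

theorem compUnit_vec (f : PHom .unit V) (r : ZMod d) :
    (compUnit f (r • LinearMap.id)).vec = r • f.vec :=
  map_smul f.ψ r (one d)

theorem id_comp (f : PHom .unit V) : comp (id V) f = f := by
  refine ext_unit ?_ rfl
  have h1 : (id V).phaseMap = 0 := rfl
  have h2 : (id V).lin = LinearMap.id := rfl
  rw [comp_phase, h1, h2, SObj.kappaExt_id]
  simp

theorem inl_comp (f : PHom .unit V) : (comp (inl V W) f).phase = f.phase ∧
    (comp (inl V W) f).vec = (f.vec, 0) := by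
  refine ⟨?_, rfl⟩
  have h1 : (inl V W).phaseMap = 0 := rfl
  have h2 : (inl V W).lin = LinearMap.inl (ZMod d) V W := rfl
  rw [comp_phase, h1, h2, SObj.kappaExt_inl]
  simp

theorem inr_comp (f : PHom .unit W) : (comp (inr V W) f).phase = f.phase ∧
    (comp (inr V W) f).vec = (0, f.vec) := by
  refine ⟨?_, rfl⟩
  have h1 : (inr V W).phaseMap = 0 := rfl
  have h2 : (inr V W).lin = LinearMap.inr (ZMod d) V W := rfl
  rw [comp_phase, h1, h2, SObj.kappaExt_inr]
  simp

theorem addPhase_comp (m : V →ₗ[ZMod d] ZMod d) (g : PHom (.pauli V) W) (f : PHom .unit V) :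
    (comp (addPhase (A := .pauli V) m g) f).phase = m f.vec + (comp g f).phase := by
  have h1 : (addPhase (A := .pauli V) m g).phaseMap = m + g.phaseMap := rfl
  have h2 : (addPhase (A := .pauli V) m g).lin = g.lin := rfl
  rw [comp_phase, comp_phase, h1, h2, LinearMap.add_apply]
  ring

/-- Both bracketings have the same vector. Their phases differ by the linear phase of h∘g minus the
sum of the phases of g and h, compared with the discrepancy of the corrections; both are additive
and agree on the basis. -/
theorem comp_assoc (h : PHom (.pauli W) X) (g : PHom (.pauli V) W) (f : PHom .unit V) :
    comp (comp h g) f = comp h (comp g f) := by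
  refine ext_unit ?_ rfl
  have hg := g.lin_isSymplectic
  have hh := h.lin_isSymplectic
  have hhg := (comp h g).lin_isSymplectic
  rw [comp_lin] at hhg
  have hred : ∀ v, redHom d (SObj.kappaExt g.lin v + SObj.kappaExt h.lin (g.lin v) -
      SObj.kappaExt (h.lin ∘ₗ g.lin) v) = 0 := fun v => by
    rw [map_sub, map_add, SObj.redHom_kappaExt hg, SObj.redHom_kappaExt hh,
      SObj.redHom_kappaExt hhg]
    simp
  -- Each correction alone fails to be additive; this combination is additive, and its multiples of
  -- `d` are halved together.
  have key := SObj.eq_zero_of_additive (V := V)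
    (f := fun v => (comp h g).phaseMap v - g.phaseMap v - h.phaseMap (g.lin v) -
      halfPhase (SObj.kappaExt g.lin v + SObj.kappaExt h.lin (g.lin v) -
        SObj.kappaExt (h.lin ∘ₗ g.lin) v))
    (fun u v => by
      rw [SObj.kappaExt_comp_add hh hg, halfPhase_add (hred u) (hred v)]
      simp only [map_add]
      ring)
    (fun j => by
      rw [SObj.kappaExt_basis, SObj.kappaExt_basis, comp_phaseMap_basis, zero_add, sub_zero]
      ring) f.vec
  have h1 : halfPhase (SObj.kappaExt g.lin f.vec) + halfPhase (SObj.kappaExt h.lin (g.lin f.vec)) =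
      halfPhase (SObj.kappaExt g.lin f.vec + SObj.kappaExt h.lin (g.lin f.vec) -
        SObj.kappaExt (h.lin ∘ₗ g.lin) f.vec) +
      halfPhase (SObj.kappaExt (h.lin ∘ₗ g.lin) f.vec) := by
    rw [← halfPhase_add (SObj.redHom_kappaExt hg _) (SObj.redHom_kappaExt hh _),
      ← halfPhase_add (hred _) (SObj.redHom_kappaExt hhg _), sub_add_cancel]
  rw [comp_phase, comp_phase, comp_phase, comp_vec, comp_lin]
  linear_combination key - h1

/-- Write the scrutinee as r_z b^z + r_x b^x, in the order of the product. The correction then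
splits into the two power phases, the phase of ⋆ and the sign of r_x r_z, since ω(z, x) = 1. -/
theorem boxUnit_comp {fx fz : PHom .unit V} {g : PHom (.pauli (SObj.qudit d)) V}
    (hg : boxUnit fx fz = some g) {f : PHom .unit (SObj.qudit d)} {rx rz : ZMod d}
    (hf : f.vec = (rx, rz)) {m : (PObj.unit : PObj d).toCObj →ₗ[ZMod d] CObj.unit d}
    (hm : scalar m = f.phase + halfD d (sgn (liftZ rx * liftZ rz))) :
    comp g f = addPhase m
      (star (compUnit fz (rz • LinearMap.id)) (compUnit fx (rx • LinearMap.id))) := by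
  unfold boxUnit at hg
  split at hg
  swap; · cases hg
  next h =>
  have hgl : ∀ a b : ZMod d, g.lin (a, b) = a • fx.vec + b • fz.vec := fun a b => by
    cases hg
    have e : ∀ (f : PHom .unit V) (a : CObj.unit d), f.ψ a = (a : ZMod d) • f.vec := fun f a =>
      (congrArg f.ψ (mul_one (M := ZMod d) a).symm).trans (map_smul f.ψ (a : ZMod d) (one d))
    rw [← e, ← e]
    rfl
  have hgp : ∀ a b : ZMod d, g.phaseMap (a, b) = a * fx.phase + b * fz.phase := fun a b => by
    cases hg
    have e : ∀ (f : PHom .unit V) (a : CObj.unit d), f.μ a = (a : ZMod d) * f.phase := fun f a =>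
      (congrArg f.μ (mul_one (M := ZMod d) a).symm).trans (map_smul f.μ (a : ZMod d) (one d))
    rw [← e, ← e]
    rfl
  have hs := g.lin_isSymplectic
  let i0 : Fin (SObj.qudit d).n := (0 : Fin 1)
  have hx : (SObj.qudit d).bx i0 = ((1 : ZMod d), (0 : ZMod d)) := by
    refine (Module.Basis.reindex_apply _ _ _).trans ?_
    simp [SObj.qudit]
  have hz : (SObj.qudit d).bz i0 = ((0 : ZMod d), (1 : ZMod d)) := by
    refine (Module.Basis.reindex_apply _ _ _).trans ?_
    simp [SObj.qudit]
  have hgx : g.lin ((SObj.qudit d).bx i0) = fx.vec := by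
    rw [hx, hgl, one_smul, zero_smul, add_zero]
  have hgz : g.lin ((SObj.qudit d).bz i0) = fz.vec := by
    rw [hz, hgl, one_smul, zero_smul, zero_add]
  have hv : f.vec = rz • (SObj.qudit d).bz i0 + rx • (SObj.qudit d).bx i0 := by
    rw [hf, hx, hz]
    refine Prod.ext ?_ ?_ <;> simp
  have hω : V.omega (rz • fz.vec) (rx • fx.vec) = rx * rz := by
    have h1 := SObj.redHom_cocycle (SObj.qudit d) (rz • (SObj.qudit d).bz i0)
      (rx • (SObj.qudit d).bx i0)
    rw [SObj.cocycle_bz_bx, map_mul, redHom_liftZ, redHom_liftZ, ← hs, map_smul, map_smul, hgx,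
      hgz] at h1
    rw [← h1, mul_comm]
  refine ext_unit ?_ ?_
  · have hr : redHom d (liftZ rx * liftZ rz - liftZ (rx * rz)) = 0 := by simp
    have hsg : halfD d (sgn (liftZ rx * liftZ rz)) =
        halfPhase (liftZ rx * liftZ rz - liftZ (rx * rz)) := by
      rw [sgn, redZ_eq, map_mul, redHom_liftZ, redHom_liftZ]; rfl
    -- Inserting and removing the lift of r_x r_z groups the exponent into four multiples of `d`,
    -- which can be halved separately.
    have hk : SObj.kappaExt g.lin f.vec = V.signExt (liftZ rz • V.lift fz.vec) +
        V.signExt (liftZ rx • V.lift fx.vec) +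
        (V.cocycle (rz • fz.vec) (rx • fx.vec) - liftZ (rx * rz)) +
        -(liftZ rx * liftZ rz - liftZ (rx * rz)) := by
      rw [hv, SObj.kappaExt_bz_bx hs, hgx, hgz]
      ring
    have hc : redHom d (V.cocycle (rz • fz.vec) (rx • fx.vec) - liftZ (rx * rz)) = 0 := by
      rw [map_sub, SObj.redHom_cocycle, hω, redHom_liftZ, sub_self]
    rw [comp_phase, addPhase_phase, star_phase, compUnit_phase, compUnit_phase, compUnit_vec,
      compUnit_vec, hω, hk, hm, hsg, hf, hgp, halfPhase_add, halfPhase_add, halfPhase_add,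
      halfPhase_neg hr]
    · ring
    all_goals simp only [map_add, map_neg, SObj.redHom_signExt, hc, hr, add_zero, neg_zero]
  · rw [comp_vec, addPhase_vec, star_vec, compUnit_vec, compUnit_vec, hv, map_add, map_smul,
      map_smul, hgx, hgz]

/-- The images of the two summands are ω-orthogonal, so the phase of ⋆ is half of the bare cocycle,
which is the extra term in the correction of a copairing. -/
theorem boxPauli_comp {g₁ : PHom (.pauli V₁) V} {g₂ : PHom (.pauli V₂) V}
    {g : PHom (.pauli (V₁.sum V₂)) V} (hg : boxPauli g₁ g₂ = some g)
    {f : PHom .unit (V₁.sum V₂)} {f₁ : PHom .unit V₁} {f₂ : PHom .unit V₂}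
    (hf : f.vec = (f₁.vec, f₂.vec)) (h₁ : f₁.phase = 0) (h₂ : f₂.phase = 0)
    {m : (PObj.unit : PObj d).toCObj →ₗ[ZMod d] CObj.unit d} (hm : scalar m = f.phase) :
    comp g f = addPhase m (star (comp g₁ f₁) (comp g₂ f₂)) := by
  unfold boxPauli at hg
  split at hg
  swap; · cases hg
  next h =>
  have hgl : g.lin = LinearMap.coprod g₁.lin g₂.lin := by cases hg; rfl
  have hgp : g.phaseMap = LinearMap.coprod g₁.phaseMap g₂.phaseMap := by cases hg; rfl
  have hs := g.lin_isSymplectic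
  rw [hgl] at hs
  have hω : V.omega (g₁.lin f₁.vec) (g₂.lin f₂.vec) = 0 := by
    have := hs (f₁.vec, 0) (0, f₂.vec)
    rw [PHom.omega_sum] at this
    simpa [SObj.omega, SObj.x, SObj.z] using this
  refine ext_unit ?_ ?_
  · rw [comp_phase, addPhase_phase, star_phase, comp_phase, comp_phase, comp_vec, comp_vec, hω,
      hm, h₁, h₂, hgp, hgl, hf]
    have hk := SObj.kappaExt_coprod hs f₁.vec f₂.vec
    refine (congrArg (fun t => _ + _ + halfPhase t) hk).trans ?_
    rw [halfPhase_add, halfPhase_add, liftZ_zero, sub_zero]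
    · rw [LinearMap.coprod_apply]; ring
    · exact SObj.redHom_kappaExt g₁.lin_isSymplectic _
    · exact SObj.redHom_kappaExt g₂.lin_isSymplectic _
    · rw [map_add, SObj.redHom_kappaExt g₁.lin_isSymplectic,
        SObj.redHom_kappaExt g₂.lin_isSymplectic, add_zero]
    · rw [SObj.redHom_cocycle, hω]
  · rw [comp_vec, addPhase_vec, star_vec, comp_vec, comp_vec, hgl, hf]
    rfl

end PHom
end
end ProjCliff

namespace ProjCliff
noncomputable section
set_option linter.unusedSectionVars false

/-! A semantics of raw expressions of the linear calculus in environments of typed elements.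
It determines the denotation of every derivation. -/

/-- An element of the module denoted by some type. -/
abbrev DVal (d : ℕ) : Type := Σ α : CTy, (α.den d : Type)

variable {d : ℕ}

/-- The scalars, pairs and linear maps as elements of typed modules. -/
abbrev DVal.scalar (r : ZMod d) : DVal d := ⟨.unit, r⟩

/-- A pair, as an element of a sum type. -/
abbrev DVal.pair {α β : CTy} (x : α.den d) (y : β.den d) : DVal d := ⟨.sum α β, (x, y)⟩

/-- A linear map, as an element of a function type. -/
abbrev DVal.fn {α β : CTy} (f : α.den d →ₗ[ZMod d] β.den d) : DVal d := ⟨.fn α β, f⟩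

/-- `a.Den ρ V`: in the environment `ρ`, the raw expression `a` denotes the element `V`. -/
def CExpr.Den : CExpr d → List (DVal d) → DVal d → Prop
  | .var i, ρ, V => ρ[i]? = some V
  | .letIn a a', ρ, V => ∃ W, a.Den ρ W ∧ a'.Den (W :: ρ) V
  | .zero α, _, V => V = ⟨α, 0⟩
  | .const r, _, V => V = DVal.scalar r
  | .smul a a', ρ, V => ∃ (s : ZMod d) (α : CTy) (x : α.den d),
      a.Den ρ (DVal.scalar s) ∧ a'.Den ρ ⟨α, x⟩ ∧ V = ⟨α, s • x⟩
  | .add a a', ρ, V => ∃ (α : CTy) (x y : α.den d),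
      a.Den ρ ⟨α, x⟩ ∧ a'.Den ρ ⟨α, y⟩ ∧ V = ⟨α, x + y⟩
  | .pair a a', ρ, V => ∃ (α β : CTy) (x : α.den d) (y : β.den d),
      a.Den ρ ⟨α, x⟩ ∧ a'.Den ρ ⟨β, y⟩ ∧ V = DVal.pair x y
  | .case a a₁ a₂, ρ, V => ∃ (α₁ α₂ β : CTy) (x₁ : α₁.den d) (x₂ : α₂.den d) (y₁ y₂ : β.den d),
      a.Den ρ (DVal.pair x₁ x₂) ∧ a₁.Den (⟨α₁, x₁⟩ :: ρ) ⟨β, y₁⟩ ∧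
      a₂.Den (⟨α₂, x₂⟩ :: ρ) ⟨β, y₂⟩ ∧ V = ⟨β, y₁ + y₂⟩
  | .lam α a, ρ, V => ∃ (β : CTy) (f : α.den d →ₗ[ZMod d] β.den d),
      (∀ x, a.Den (⟨α, x⟩ :: ρ) ⟨β, f x⟩) ∧ V = DVal.fn f
  | .app a a', ρ, V => ∃ (α β : CTy) (f : α.den d →ₗ[ZMod d] β.den d) (x : α.den d),
      a.Den ρ (DVal.fn f) ∧ a'.Den ρ ⟨α, x⟩ ∧ V = ⟨β, f x⟩

theorem DVal.pair_inj {α β α' β' : CTy} {x : α.den d} {y : β.den d} {x' : α'.den d}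
    {y' : β'.den d} (h : DVal.pair x y = DVal.pair x' y') :
    (⟨α, x⟩ : DVal d) = ⟨α', x'⟩ ∧ (⟨β, y⟩ : DVal d) = ⟨β', y'⟩ := by
  cases h; exact ⟨rfl, rfl⟩

namespace CExpr

/-- The environment determines both the type and the element, so any two derivations of one raw
expression can be compared through it. -/
theorem Den.unique {a : CExpr d} {ρ : List (DVal d)} {V V' : DVal d} (h : a.Den ρ V)
    (h' : a.Den ρ V') : V = V' := by
  induction a generalizing ρ V V' with
  | var i => exact Option.some.inj (h.symm.trans h')
  | letIn a a' ih ih' =>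
    obtain ⟨W, h1, h2⟩ := h
    obtain ⟨W', h1', h2'⟩ := h'
    cases ih h1 h1'
    exact ih' h2 h2'
  | zero α => exact h.trans h'.symm
  | const r => exact h.trans h'.symm
  | smul a a' ih ih' =>
    obtain ⟨s, α, x, h1, h2, rfl⟩ := h
    obtain ⟨s', α', x', h1', h2', rfl⟩ := h'
    cases ih h1 h1'
    cases ih' h2 h2'
    rfl
  | add a a' ih ih' =>
    obtain ⟨α, x, y, h1, h2, rfl⟩ := h
    obtain ⟨α', x', y', h1', h2', rfl⟩ := h'
    cases ih h1 h1'
    cases ih' h2 h2'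
    rfl
  | pair a a' ih ih' =>
    obtain ⟨α, β, x, y, h1, h2, rfl⟩ := h
    obtain ⟨α', β', x', y', h1', h2', rfl⟩ := h'
    cases ih h1 h1'
    cases ih' h2 h2'
    rfl
  | case a a₁ a₂ ih ih₁ ih₂ =>
    obtain ⟨α₁, α₂, β, x₁, x₂, y₁, y₂, h, h1, h2, rfl⟩ := h
    obtain ⟨α₁', α₂', β', x₁', x₂', y₁', y₂', h', h1', h2', rfl⟩ := h'
    obtain ⟨e1, e2⟩ := DVal.pair_inj (ih h h')
    cases e1
    cases e2
    cases ih₁ h1 h1'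
    cases ih₂ h2 h2'
    rfl
  | lam α a ih =>
    obtain ⟨β, f, h, rfl⟩ := h
    obtain ⟨β', f', h', rfl⟩ := h'
    -- An abstraction does not record its codomain; evaluating at the argument 0 reveals it.
    have hβ : β = β' := congrArg Sigma.fst (ih (h 0) (h' 0))
    subst hβ
    have hf : f = f' := LinearMap.ext fun x => eq_of_heq (Sigma.mk.inj (ih (h x) (h' x))).2
    rw [hf]
  | app a a' ih ih' =>
    obtain ⟨α, β, f, x, h1, h2, rfl⟩ := h
    obtain ⟨α', β', f', x', h1', h2', rfl⟩ := h'
    cases ih h1 h1'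
    cases ih' h2 h2'
    rfl

theorem Den.weaken {a : CExpr d} {ρ : List (DVal d)} {V : DVal d} (h : a.Den ρ V)
    (ρ' : List (DVal d)) : a.Den (ρ ++ ρ') V := by
  induction a generalizing ρ V with
  | var i => exact List.getElem?_append_left (List.getElem?_eq_some_iff.1 h).1 |>.trans h
  | letIn a a' ih ih' =>
    obtain ⟨W, h1, h2⟩ := h
    exact ⟨W, ih h1, ih' h2⟩
  | zero α => exact h
  | const r => exact h
  | smul a a' ih ih' =>
    obtain ⟨s, α, x, h1, h2, rfl⟩ := h
    exact ⟨s, α, x, ih h1, ih' h2, rfl⟩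
  | add a a' ih ih' =>
    obtain ⟨α, x, y, h1, h2, rfl⟩ := h
    exact ⟨α, x, y, ih h1, ih' h2, rfl⟩
  | pair a a' ih ih' =>
    obtain ⟨α, β, x, y, h1, h2, rfl⟩ := h
    exact ⟨α, β, x, y, ih h1, ih' h2, rfl⟩
  | case a a₁ a₂ ih ih₁ ih₂ =>
    obtain ⟨α₁, α₂, β, x₁, x₂, y₁, y₂, h, h1, h2, rfl⟩ := h
    exact ⟨α₁, α₂, β, x₁, x₂, y₁, y₂, ih h, ih₁ h1, ih₂ h2, rfl⟩
  | lam α a ih =>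
    obtain ⟨β, f, h, rfl⟩ := h
    exact ⟨β, f, fun x => ih (h x), rfl⟩
  | app a a' ih ih' =>
    obtain ⟨α, β, f, x, h1, h2, rfl⟩ := h
    exact ⟨α, β, f, x, ih h1, ih' h2, rfl⟩

theorem Den.of_nil {a : CExpr d} {V : DVal d} (h : a.Den [] V) (ρ : List (DVal d)) :
    a.Den ρ V := h.weaken ρ

theorem Den.shift {a : CExpr d} {ρ₁ ρ₂ : List (DVal d)} {V : DVal d} (h : a.Den (ρ₁ ++ ρ₂) V)
    (W : DVal d) : (a.shift ρ₁.length).Den (ρ₁ ++ W :: ρ₂) V := by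
  induction a generalizing ρ₁ V with
  | var i =>
    unfold CExpr.shift
    split
    · next hi =>
      have h' : (ρ₁ ++ ρ₂)[i]? = some V := h
      rw [List.getElem?_append_left hi] at h'
      exact (List.getElem?_append_left hi).trans h'
    · next hi =>
      have h' : (ρ₁ ++ ρ₂)[i]? = some V := h
      rw [List.getElem?_append_right (by omega)] at h'
      change (ρ₁ ++ W :: ρ₂)[i + 1]? = some V
      rw [List.getElem?_append_right (by omega), show i + 1 - ρ₁.length = i - ρ₁.length + 1 by omega,
        List.getElem?_cons_succ, h']
  | letIn a a' ih ih' =>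
    obtain ⟨W, h1, h2⟩ := h
    exact ⟨W, ih h1, ih' (ρ₁ := W :: ρ₁) h2⟩
  | zero α => exact h
  | const r => exact h
  | smul a a' ih ih' =>
    obtain ⟨s, α, x, h1, h2, rfl⟩ := h
    exact ⟨s, α, x, ih h1, ih' h2, rfl⟩
  | add a a' ih ih' =>
    obtain ⟨α, x, y, h1, h2, rfl⟩ := h
    exact ⟨α, x, y, ih h1, ih' h2, rfl⟩
  | pair a a' ih ih' =>
    obtain ⟨α, β, x, y, h1, h2, rfl⟩ := h
    exact ⟨α, β, x, y, ih h1, ih' h2, rfl⟩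
  | case a a₁ a₂ ih ih₁ ih₂ =>
    obtain ⟨α₁, α₂, β, x₁, x₂, y₁, y₂, h, h1, h2, rfl⟩ := h
    exact ⟨α₁, α₂, β, x₁, x₂, y₁, y₂, ih h, ih₁ (ρ₁ := _ :: ρ₁) h1, ih₂ (ρ₁ := _ :: ρ₁) h2, rfl⟩
  | lam α a ih =>
    obtain ⟨β, f, h, rfl⟩ := h
    exact ⟨β, f, fun x => ih (ρ₁ := _ :: ρ₁) (h x), rfl⟩
  | app a a' ih ih' =>
    obtain ⟨α, β, f, x, h1, h2, rfl⟩ := h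
    exact ⟨α, β, f, x, ih h1, ih' h2, rfl⟩

theorem Den.subst {v a : CExpr d} {ρ₁ ρ₂ : List (DVal d)} {V W : DVal d} (hv : v.Den [] W)
    (h : a.Den (ρ₁ ++ W :: ρ₂) V) : (CExpr.subst ρ₁.length v a).Den (ρ₁ ++ ρ₂) V := by
  induction a generalizing ρ₁ V with
  | var i =>
    have h' : (ρ₁ ++ W :: ρ₂)[i]? = some V := h
    unfold CExpr.subst
    split
    · next hi =>
      rw [List.getElem?_append_left hi] at h'
      exact (List.getElem?_append_left hi).trans h'
    · next hi =>
      rw [List.getElem?_append_right (by omega)] at h'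
      split
      · next hi' =>
        subst hi'
        rw [Nat.sub_self, List.getElem?_cons_zero] at h'
        cases h'
        exact hv.of_nil _
      · next hi' =>
        change (ρ₁ ++ ρ₂)[i - 1]? = some V
        rw [List.getElem?_append_right (by omega)]
        rw [show i - ρ₁.length = i - 1 - ρ₁.length + 1 by omega, List.getElem?_cons_succ] at h'
        exact h'
  | letIn a a' ih ih' =>
    obtain ⟨W, h1, h2⟩ := h
    exact ⟨W, ih h1, ih' (ρ₁ := W :: ρ₁) h2⟩
  | zero α => exact h
  | const r => exact h
  | smul a a' ih ih' =>
    obtain ⟨s, α, x, h1, h2, rfl⟩ := h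
    exact ⟨s, α, x, ih h1, ih' h2, rfl⟩
  | add a a' ih ih' =>
    obtain ⟨α, x, y, h1, h2, rfl⟩ := h
    exact ⟨α, x, y, ih h1, ih' h2, rfl⟩
  | pair a a' ih ih' =>
    obtain ⟨α, β, x, y, h1, h2, rfl⟩ := h
    exact ⟨α, β, x, y, ih h1, ih' h2, rfl⟩
  | case a a₁ a₂ ih ih₁ ih₂ =>
    obtain ⟨α₁, α₂, β, x₁, x₂, y₁, y₂, h, h1, h2, rfl⟩ := h
    exact ⟨α₁, α₂, β, x₁, x₂, y₁, y₂, ih h, ih₁ (ρ₁ := _ :: ρ₁) h1, ih₂ (ρ₁ := _ :: ρ₁) h2, rfl⟩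
  | lam α a ih =>
    obtain ⟨β, f, h, rfl⟩ := h
    exact ⟨β, f, fun x => ih (ρ₁ := _ :: ρ₁) (h x), rfl⟩
  | app a a' ih ih' =>
    obtain ⟨α, β, f, x, h1, h2, rfl⟩ := h
    exact ⟨α, β, f, x, ih h1, ih' h2, rfl⟩

theorem Den.subst_zero {v a : CExpr d} {ρ : List (DVal d)} {V W : DVal d} (hv : v.Den [] W)
    (h : a.Den (W :: ρ) V) : (CExpr.subst 0 v a).Den ρ V :=
  Den.subst (ρ₁ := []) hv h

/-- No typing is involved: a denotation already determines the shape that each rule needs, and the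
β-rules are substitution in the environment. -/
theorem Den.beta {a a' : CExpr d} (hs : CBeta a a') {V : DVal d} (h : a.Den [] V) :
    a'.Den [] V := by
  cases hs with
  | letIn _ =>
    obtain ⟨W, h1, h2⟩ := h
    exact h1.subst_zero h2
  | case _ _ =>
    obtain ⟨α₁, α₂, β, x₁, x₂, y₁, y₂, h, h1, h2, rfl⟩ := h
    obtain ⟨_, _, _, _, g1, g2, e⟩ := h
    obtain ⟨e1, e2⟩ := DVal.pair_inj e
    cases e1
    cases e2
    exact ⟨β, y₁, y₂, g1.subst_zero h1, g2.subst_zero h2, rfl⟩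
  | app _ =>
    obtain ⟨α, β, f, x, ⟨_, _, h1, e⟩, h2, rfl⟩ := h
    cases e
    exact h2.subst_zero (h1 x)
  | zero_unit => exact h
  | zero_sum => exact ⟨_, _, 0, 0, rfl, rfl, h⟩
  | zero_fn => exact ⟨_, 0, fun x => rfl, h⟩
  | smul_const =>
    obtain ⟨s, α, x, h1, h2, rfl⟩ := h
    cases h1
    cases h2
    rfl
  | smul_pair _ _ =>
    obtain ⟨s, α, x, h1, ⟨_, _, y, z, g1, g2, e⟩, rfl⟩ := h
    cases e
    exact ⟨_, _, s • y, s • z, ⟨_, _, _, h1, g1, rfl⟩, ⟨_, _, _, h1, g2, rfl⟩, rfl⟩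
  | smul_lam =>
    obtain ⟨s, α, x, h1, ⟨_, f, g1, e⟩, rfl⟩ := h
    cases e
    exact ⟨_, s • f, fun x => ⟨_, _, _, Den.of_nil h1 _, g1 x, rfl⟩, rfl⟩
  | add_const =>
    obtain ⟨α, x, y, h1, h2, rfl⟩ := h
    cases h1
    cases h2
    rfl
  | add_pair _ _ _ _ =>
    obtain ⟨α, x, y, ⟨_, _, y, z, g1, g2, e⟩, ⟨_, _, y', z', g1', g2', e'⟩, rfl⟩ := h
    cases e
    cases e'
    exact ⟨_, _, y + y', z + z', ⟨_, _, _, g1, g1', rfl⟩, ⟨_, _, _, g2, g2', rfl⟩, rfl⟩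
  | add_lam =>
    obtain ⟨α, x, y, ⟨_, f, g1, e⟩, ⟨_, f', g1', e'⟩, rfl⟩ := h
    cases e
    cases e'
    refine ⟨_, _, fun z => ?_, rfl⟩
    exact ⟨_, _, _, g1 z, g1' z, rfl⟩

theorem Den.step {a a' : CExpr d} (hs : CStep a a') {V : DVal d} (h : a.Den [] V) :
    a'.Den [] V := by
  induction hs generalizing V with
  | beta hs => exact h.beta hs
  | letIn _ ih =>
    obtain ⟨W, h1, h2⟩ := h
    exact ⟨W, ih h1, h2⟩
  | smul_left _ ih =>
    obtain ⟨s, α, x, h1, h2, rfl⟩ := h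
    exact ⟨s, α, x, ih h1, h2, rfl⟩
  | smul_right _ ih =>
    obtain ⟨s, α, x, h1, h2, rfl⟩ := h
    exact ⟨s, α, x, h1, ih h2, rfl⟩
  | add_left _ ih =>
    obtain ⟨α, x, y, h1, h2, rfl⟩ := h
    exact ⟨α, x, y, ih h1, h2, rfl⟩
  | add_right _ _ ih =>
    obtain ⟨α, x, y, h1, h2, rfl⟩ := h
    exact ⟨α, x, y, h1, ih h2, rfl⟩
  | pair_left _ ih =>
    obtain ⟨α, β, x, y, h1, h2, rfl⟩ := h
    exact ⟨α, β, x, y, ih h1, h2, rfl⟩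
  | pair_right _ _ ih =>
    obtain ⟨α, β, x, y, h1, h2, rfl⟩ := h
    exact ⟨α, β, x, y, h1, ih h2, rfl⟩
  | case _ ih =>
    obtain ⟨α₁, α₂, β, x₁, x₂, y₁, y₂, h, h1, h2, rfl⟩ := h
    exact ⟨α₁, α₂, β, x₁, x₂, y₁, y₂, ih h, h1, h2, rfl⟩
  | app_left _ ih =>
    obtain ⟨α, β, f, x, h1, h2, rfl⟩ := h
    exact ⟨α, β, f, x, ih h1, h2, rfl⟩
  | app_right _ _ ih =>
    obtain ⟨α, β, f, x, h1, h2, rfl⟩ := h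
    exact ⟨α, β, f, x, h1, ih h2, rfl⟩

theorem Den.steps {a a' : CExpr d} (hs : Relation.ReflTransGen CStep a a') {V : DVal d}
    (h : a.Den [] V) : a'.Den [] V := by
  induction hs with
  | refl => exact h
  | tail _ hs ih => exact ih.step hs

end CExpr

/-- `CCtx.Point Δ ρ t`: the environment `ρ` fits the context `Δ` and `t` is the pure tensor of its
elements. -/
inductive CCtx.Point : (Δ : CCtx) → List (DVal d) → Δ.den d → Prop
  | nil (ρ : List (DVal d)) : CCtx.Point [] ρ (1 : ZMod d)
  | none {Δ : CCtx} {ρ : List (DVal d)} {t : Δ.den d} (V : DVal d) :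
      CCtx.Point Δ ρ t → CCtx.Point (none :: Δ) (V :: ρ) t
  | some {Δ : CCtx} {ρ : List (DVal d)} {t : Δ.den d} {α : CTy} (x : α.den d) :
      CCtx.Point Δ ρ t → CCtx.Point (some α :: Δ) (⟨α, x⟩ :: ρ) (t ⊗ₜ[ZMod d] x)

/-- Pure tensors span the tensor product, and each of them comes from an environment. -/
theorem CCtx.ext_point {Δ : CCtx} {M : Type*} [AddCommGroup M] [Module (ZMod d) M]
    {f g : Δ.den d →ₗ[ZMod d] M}
    (h : ∀ (ρ : List (DVal d)) (t : Δ.den d), Δ.Point ρ t → f t = g t) : f = g := by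
  induction Δ with
  | nil => exact LinearMap.ext_ring (h [] _ (.nil _))
  | cons o Δ ih =>
    cases o with
    | none => exact ih fun ρ t ht => h _ t (.none (DVal.scalar 0) ht)
    | some α =>
      refine TensorProduct.ext' fun t x => ?_
      have := ih (f := f ∘ₗ (TensorProduct.mk (ZMod d) (CCtx.den d Δ) (α.den d)).flip x)
        (g := g ∘ₗ (TensorProduct.mk (ZMod d) (CCtx.den d Δ) (α.den d)).flip x)
        fun ρ t ht => h _ _ (.some x ht)
      exact LinearMap.congr_fun this t

theorem CCtx.Point.isEmpty {Δ : CCtx} {ρ : List (DVal d)} {t : Δ.den d} (ht : Δ.Point ρ t)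
    (h : Δ.IsEmpty) : h.interp d t = (1 : ZMod d) := by
  induction h generalizing ρ with
  | nil => cases ht; rfl
  | cons h ih => cases ht with | none V ht => exact ih ht

theorem CCtx.Only.interp_here {Δ : CCtx} {α : CTy} (h : Δ.IsEmpty) (t : Δ.den d) (x : α.den d) :
    (CCtx.Only.here (α := α) h).interp d (t ⊗ₜ[ZMod d] x) = (h.interp d t : ZMod d) • x := rfl

theorem CCtx.Point.only {Δ : CCtx} {ρ : List (DVal d)} {t : Δ.den d} (ht : Δ.Point ρ t)
    {i : ℕ} {α : CTy} (h : Δ.Only i α) : ρ[i]? = Option.some ⟨α, h.interp d t⟩ := by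
  induction h generalizing ρ with
  | here h =>
    cases ht with
    | some x ht =>
      rw [CCtx.Only.interp_here, ht.isEmpty h, one_smul]
      rfl
  | there h ih => cases ht with | none V ht => exact ih ht

/-- The pure tensor splits while the environment stays whole: entries of absent variables are
ignored. This is how a raw semantics without linearity follows the linear one. -/
theorem CCtx.Point.merge {Δ₁ Δ₂ Δ : CCtx} {ρ : List (DVal d)} {t : Δ.den d} (ht : Δ.Point ρ t)
    (m : CCtx.Merge Δ₁ Δ₂ Δ) : ∃ (t₁ : Δ₁.den d) (t₂ : Δ₂.den d), Δ₁.Point ρ t₁ ∧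
      Δ₂.Point ρ t₂ ∧ m.interp d t = t₁ ⊗ₜ[ZMod d] t₂ := by
  induction m generalizing ρ with
  | nil => cases ht; exact ⟨_, _, .nil _, .nil _, rfl⟩
  | skip m ih =>
    cases ht with
    | none V ht =>
      obtain ⟨t₁, t₂, h1, h2, h3⟩ := ih ht
      exact ⟨t₁, t₂, .none V h1, .none V h2, h3⟩
  | left α m ih =>
    cases ht with
    | some x ht =>
      obtain ⟨t₁, t₂, h1, h2, h3⟩ := ih ht
      refine ⟨_, t₂, .some x h1, .none _ h2, ?_⟩
      exact (congrArg (fun s => TensorProduct.rightComm (ZMod d) _ _ _ (s ⊗ₜ[ZMod d] x)) h3)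
  | right α m ih =>
    cases ht with
    | some x ht =>
      obtain ⟨t₁, t₂, h1, h2, h3⟩ := ih ht
      refine ⟨t₁, _, .none _ h1, .some x h2, ?_⟩
      exact (congrArg (fun s => TensorProduct.assoc (ZMod d) _ _ _ (s ⊗ₜ[ZMod d] x)) h3)

theorem bindMap_tmul {A B C D : CObj d} (f : A →ₗ[ZMod d] C) (g : B.tensor C →ₗ[ZMod d] D)
    (s : A) (t : B) : bindMap f g (s ⊗ₜ[ZMod d] t) = g (t ⊗ₜ[ZMod d] f s) := rfl

/-! ### Coherence of the linear calculus. -/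

namespace CTyping

/-- The denotation of a derivation is the denotation of the raw expression. -/
theorem den_interp {Δ : CCtx} {a : CExpr d} {α : CTy} (D : CTyping Δ a α) {ρ : List (DVal d)}
    {t : Δ.den d} (ht : Δ.Point ρ t) : a.Den ρ ⟨α, D.interp t⟩ := by
  induction D generalizing ρ with
  | var h => exact ht.only h
  | letIn m D D' ih ih' =>
    obtain ⟨t₁, t₂, h1, h2, h3⟩ := ht.merge m
    have e : (CTyping.letIn m D D').interp t = D'.interp (t₂ ⊗ₜ[ZMod d] D.interp t₁) :=
      (congrArg (bindMap D.interp D'.interp) h3).trans (bindMap_tmul _ _ _ _)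
    rw [e]
    exact ⟨_, ih h1, ih' (.some (D.interp t₁) h2)⟩
  | const r h =>
    have : (CTyping.const r h).interp t = (r : ZMod d) * (h.interp d t : ZMod d) := rfl
    rw [this, ht.isEmpty h, mul_one]
    rfl
  | smul m D D' ih ih' =>
    obtain ⟨t₁, t₂, h1, h2, h3⟩ := ht.merge m
    refine ⟨_, _, _, ih h1, ih' h2, ?_⟩
    exact congrArg (Sigma.mk _)
      (congrArg (fun s => TensorProduct.lid (ZMod d) _ (TensorProduct.map D.interp D'.interp s)) h3)
  | zero Δ α => rfl
  | add D D' ih ih' => exact ⟨_, _, _, ih ht, ih' ht, rfl⟩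
  | pair D D' ih ih' => exact ⟨_, _, _, _, ih ht, ih' ht, rfl⟩
  | case m D D₁ D₂ ih ih₁ ih₂ =>
    obtain ⟨t₁, t₂, h1, h2, h3⟩ := ht.merge m
    refine ⟨_, _, _, _, _, _, _, ih h1, ih₁ (.some (D.interp t₁).1 h2),
      ih₂ (.some (D.interp t₁).2 h2), ?_⟩
    exact congrArg (Sigma.mk _) (congrArg
      (bindMap (LinearMap.fst (ZMod d) _ _ ∘ₗ D.interp) D₁.interp +
        bindMap (LinearMap.snd (ZMod d) _ _ ∘ₗ D.interp) D₂.interp) h3)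
  | lam D ih => exact ⟨_, _, fun x => ih (.some x ht), rfl⟩
  | app m D D' ih ih' =>
    obtain ⟨t₁, t₂, h1, h2, h3⟩ := ht.merge m
    refine ⟨_, _, _, _, ih h1, ih' h2, ?_⟩
    exact congrArg (Sigma.mk _) (congrArg (fun s => TensorProduct.lift LinearMap.id
      (TensorProduct.map D.interp D'.interp s)) h3)

theorem interp_unique {Δ : CCtx} {a : CExpr d} {α : CTy} (D D' : CTyping Δ a α) :
    D.interp = D'.interp :=
  CCtx.ext_point fun _ _ ht =>
    eq_of_heq (Sigma.mk.inj ((D.den_interp ht).unique (D'.den_interp ht))).2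

end CTyping
end
end ProjCliff

namespace ProjCliff

variable {d : ℕ}

/-! Closed expressions and iterated substitution. -/

namespace CExpr

/-- All free variables of the expression are less than `n`. -/
def Below : ℕ → CExpr d → Prop
  | n, var i => i < n
  | n, letIn a a' => Below n a ∧ Below (n + 1) a'
  | _, zero _ => True
  | _, const _ => True
  | n, smul a a' => Below n a ∧ Below n a'
  | n, add a a' => Below n a ∧ Below n a'
  | n, pair a a' => Below n a ∧ Below n a'
  | n, case a a₁ a₂ => Below n a ∧ Below (n + 1) a₁ ∧ Below (n + 1) a₂
  | n, lam _ a => Below (n + 1) a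
  | n, app a a' => Below n a ∧ Below n a'

theorem Below.mono {a : CExpr d} {n m : ℕ} (h : Below n a) (hnm : n ≤ m) : Below m a := by
  induction a generalizing n m with
  | var i => exact lt_of_lt_of_le h hnm
  | letIn a a' ih ih' => exact ⟨ih h.1 hnm, ih' h.2 (by omega)⟩
  | zero α => trivial
  | const r => trivial
  | smul a a' ih ih' => exact ⟨ih h.1 hnm, ih' h.2 hnm⟩
  | add a a' ih ih' => exact ⟨ih h.1 hnm, ih' h.2 hnm⟩
  | pair a a' ih ih' => exact ⟨ih h.1 hnm, ih' h.2 hnm⟩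
  | case a a₁ a₂ ih ih₁ ih₂ => exact ⟨ih h.1 hnm, ih₁ h.2.1 (by omega), ih₂ h.2.2 (by omega)⟩
  | lam α a ih => exact ih h (by omega)
  | app a a' ih ih' => exact ⟨ih h.1 hnm, ih' h.2 hnm⟩

theorem Below.subst_eq {a : CExpr d} {n k : ℕ} (h : Below n a) (hnk : n ≤ k) (v : CExpr d) :
    CExpr.subst k v a = a := by
  induction a generalizing n k with
  | var i => exact if_pos (lt_of_lt_of_le h hnk)
  | letIn a a' ih ih' => exact congrArg₂ _ (ih h.1 hnk) (ih' h.2 (by omega))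
  | zero α => rfl
  | const r => rfl
  | smul a a' ih ih' => exact congrArg₂ _ (ih h.1 hnk) (ih' h.2 hnk)
  | add a a' ih ih' => exact congrArg₂ _ (ih h.1 hnk) (ih' h.2 hnk)
  | pair a a' ih ih' => exact congrArg₂ _ (ih h.1 hnk) (ih' h.2 hnk)
  | case a a₁ a₂ ih ih₁ ih₂ =>
    rw [CExpr.subst, ih h.1 hnk, ih₁ h.2.1 (by omega), ih₂ h.2.2 (by omega)]
  | lam α a ih => exact congrArg _ (ih h (by omega))
  | app a a' ih ih' => exact congrArg₂ _ (ih h.1 hnk) (ih' h.2 hnk)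

theorem Below.subst {v a : CExpr d} (hv : Below 0 v) {n k : ℕ} (h : Below (n + 1) a)
    (hk : k ≤ n) : Below n (CExpr.subst k v a) := by
  induction a generalizing n k with
  | var i =>
    have h' : i < n + 1 := h
    unfold CExpr.subst
    split_ifs
    · exact lt_of_lt_of_le (by assumption) hk
    · exact hv.mono (Nat.zero_le _)
    · change i - 1 < n
      omega
  | letIn a a' ih ih' => exact ⟨ih h.1 hk, ih' h.2 (by omega)⟩
  | zero α => trivial
  | const r => trivial
  | smul a a' ih ih' => exact ⟨ih h.1 hk, ih' h.2 hk⟩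
  | add a a' ih ih' => exact ⟨ih h.1 hk, ih' h.2 hk⟩
  | pair a a' ih ih' => exact ⟨ih h.1 hk, ih' h.2 hk⟩
  | case a a₁ a₂ ih ih₁ ih₂ => exact ⟨ih h.1 hk, ih₁ h.2.1 (by omega), ih₂ h.2.2 (by omega)⟩
  | lam α a ih => exact ih h (by omega)
  | app a a' ih ih' => exact ⟨ih h.1 hk, ih' h.2 hk⟩

theorem subst_comm {v w : CExpr d} (hv : Below 0 v) (hw : Below 0 w) (a : CExpr d) (k : ℕ) :
    CExpr.subst k w (CExpr.subst (k + 1) v a) = CExpr.subst k v (CExpr.subst k w a) := by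
  induction a generalizing k with
  | var i =>
    rcases lt_trichotomy i k with h | h | h
    · simp [CExpr.subst, h, show i < k + 1 by omega]
    · subst h
      simp [CExpr.subst, hw.subst_eq (Nat.zero_le _)]
    · rcases Nat.eq_or_lt_of_le (show k + 1 ≤ i from h) with h' | h'
      · subst h'
        simp [CExpr.subst, hv.subst_eq (Nat.zero_le _)]
      · simp [CExpr.subst, show ¬ i < k + 1 by omega, show ¬ i = k + 1 by omega,
          show ¬ i < k by omega, show ¬ i = k by omega, show ¬ i - 1 < k by omega,
          show ¬ i - 1 = k by omega]
  | letIn a a' ih ih' => simp only [CExpr.subst, ih, ih']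
  | zero α => rfl
  | const r => rfl
  | smul a a' ih ih' => simp only [CExpr.subst, ih, ih']
  | add a a' ih ih' => simp only [CExpr.subst, ih, ih']
  | pair a a' ih ih' => simp only [CExpr.subst, ih, ih']
  | case a a₁ a₂ ih ih₁ ih₂ => simp only [CExpr.subst, ih, ih₁, ih₂]
  | lam α a ih => simp only [CExpr.subst, ih]
  | app a a' ih ih' => simp only [CExpr.subst, ih, ih']

/-- Substitution of closed expressions for the variables `k, k + 1, ...`. -/
def closeAt (k : ℕ) : List (CExpr d) → CExpr d → CExpr d
  | [], a => a
  | v :: δ, a => closeAt k δ (CExpr.subst k v a)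

theorem close_eq_closeAt (δ : List (CExpr d)) (a : CExpr d) : close δ a = closeAt 0 δ a := by
  induction δ generalizing a with
  | nil => rfl
  | cons v δ ih => exact ih _

/-- After an expression has been closed under a binder, a β-step amounts to extending the list of
substituted values by the argument. -/
theorem subst_closeAt {δ : List (CExpr d)} (hδ : ∀ v ∈ δ, Below 0 v) {w : CExpr d}
    (hw : Below 0 w) (a : CExpr d) :
    CExpr.subst 0 w (closeAt 1 δ a) = closeAt 0 (w :: δ) a := by
  induction δ generalizing a with
  | nil => rfl
  | cons v δ ih =>
    simp only [List.mem_cons, forall_eq_or_imp] at hδ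
    rw [closeAt, ih hδ.2]
    simp only [closeAt]
    rw [subst_comm hδ.1 hw]

theorem closeAt_of_below {a : CExpr d} {k : ℕ} (h : Below k a) (δ : List (CExpr d)) :
    closeAt k δ a = a := by
  induction δ with
  | nil => rfl
  | cons v δ ih => rw [closeAt, h.subst_eq le_rfl, ih]

theorem closeAt_var {δ : List (CExpr d)} (hδ : ∀ v ∈ δ, Below 0 v) {i : ℕ} {v : CExpr d}
    (h : δ[i]? = some v) : closeAt 0 δ (var i) = v := by
  induction δ generalizing i with
  | nil => simp at h
  | cons w δ ih =>
    simp only [List.mem_cons, forall_eq_or_imp] at hδ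
    cases i with
    | zero =>
      cases h
      exact closeAt_of_below hδ.1 δ
    | succ i => exact ih hδ.2 h

theorem Below.closeAt {δ : List (CExpr d)} (hδ : ∀ v ∈ δ, Below 0 v) {a : CExpr d} {n : ℕ}
    (h : Below (n + δ.length) a) (k : ℕ) (hk : k ≤ n) : Below n (closeAt k δ a) := by
  induction δ generalizing a with
  | nil => exact h
  | cons v δ ih =>
    simp only [List.mem_cons, forall_eq_or_imp] at hδ
    exact ih hδ.2 (hδ.1.subst h (by omega))

section

variable (k : ℕ) (δ : List (CExpr d)) (a a' a'' : CExpr d)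

theorem closeAt_letIn :
    closeAt k δ (letIn a a') = letIn (closeAt k δ a) (closeAt (k + 1) δ a') := by
  induction δ generalizing a a' with
  | nil => rfl
  | cons v δ ih => exact ih _ _

theorem closeAt_smul : closeAt k δ (smul a a') = smul (closeAt k δ a) (closeAt k δ a') := by
  induction δ generalizing a a' with
  | nil => rfl
  | cons v δ ih => exact ih _ _

theorem closeAt_add : closeAt k δ (add a a') = add (closeAt k δ a) (closeAt k δ a') := by
  induction δ generalizing a a' with
  | nil => rfl
  | cons v δ ih => exact ih _ _

theorem closeAt_pair : closeAt k δ (pair a a') = pair (closeAt k δ a) (closeAt k δ a') := by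
  induction δ generalizing a a' with
  | nil => rfl
  | cons v δ ih => exact ih _ _

theorem closeAt_app : closeAt k δ (app a a') = app (closeAt k δ a) (closeAt k δ a') := by
  induction δ generalizing a a' with
  | nil => rfl
  | cons v δ ih => exact ih _ _

theorem closeAt_lam (α : CTy) : closeAt k δ (lam α a) = lam α (closeAt (k + 1) δ a) := by
  induction δ generalizing a with
  | nil => rfl
  | cons v δ ih => exact ih _

theorem closeAt_case : closeAt k δ (case a a' a'') =
    case (closeAt k δ a) (closeAt (k + 1) δ a') (closeAt (k + 1) δ a'') := by
  induction δ generalizing a a' a'' with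
  | nil => rfl
  | cons v δ ih => exact ih _ _ _

end

end CExpr

/-! Context bookkeeping. -/

theorem CCtx.Merge.length_eq {Δ₁ Δ₂ Δ : CCtx} (m : CCtx.Merge Δ₁ Δ₂ Δ) :
    Δ₁.length = Δ.length ∧ Δ₂.length = Δ.length := by
  induction m <;> simp_all

theorem CCtx.Merge.lookup {Δ₁ Δ₂ Δ : CCtx} (m : CCtx.Merge Δ₁ Δ₂ Δ) {k : ℕ} {β : CTy} :
    (Δ₁[k]? = some (some β) → Δ[k]? = some (some β)) ∧
      (Δ₂[k]? = some (some β) → Δ[k]? = some (some β)) := by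
  induction m generalizing k with
  | nil => simp
  | skip m ih =>
    cases k with
    | zero => simp
    | succ k => simpa using ih
  | left α m ih =>
    cases k with
    | zero => simp
    | succ k => simpa using ih
  | right α m ih =>
    cases k with
    | zero => simp
    | succ k => simpa using ih

theorem CCtx.Merge.eraseIdx {Δ₁ Δ₂ Δ : CCtx} (m : CCtx.Merge Δ₁ Δ₂ Δ) (k : ℕ) :
    Nonempty (CCtx.Merge (Δ₁.eraseIdx k) (Δ₂.eraseIdx k) (Δ.eraseIdx k)) := by
  induction m generalizing k with
  | nil => exact ⟨.nil⟩
  | skip m ih =>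
    cases k with
    | zero => exact ⟨m⟩
    | succ k => obtain ⟨m'⟩ := ih k; exact ⟨.skip m'⟩
  | left α m ih =>
    cases k with
    | zero => exact ⟨m⟩
    | succ k => obtain ⟨m'⟩ := ih k; exact ⟨.left α m'⟩
  | right α m ih =>
    cases k with
    | zero => exact ⟨m⟩
    | succ k => obtain ⟨m'⟩ := ih k; exact ⟨.right α m'⟩

theorem CCtx.IsEmpty.eraseIdx {Δ : CCtx} (h : Δ.IsEmpty) (k : ℕ) :
    Nonempty (CCtx.IsEmpty (Δ.eraseIdx k)) := by
  induction h generalizing k with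
  | nil => exact ⟨.nil⟩
  | cons h ih =>
    cases k with
    | zero => exact ⟨h⟩
    | succ k => obtain ⟨h'⟩ := ih k; exact ⟨.cons h'⟩

theorem CCtx.Only.lt_length {Δ : CCtx} {i : ℕ} {α : CTy} (h : Δ.Only i α) : i < Δ.length := by
  induction h <;> simp_all

theorem CCtx.Only.eraseIdx_lt {Δ : CCtx} {i : ℕ} {α : CTy} (h : Δ.Only i α) {k : ℕ} (hk : i < k) :
    Nonempty (CCtx.Only (Δ.eraseIdx k) i α) := by
  induction h generalizing k with
  | here h =>
    cases k with
    | zero => omega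
    | succ k => obtain ⟨h'⟩ := h.eraseIdx k; exact ⟨.here h'⟩
  | there h ih =>
    cases k with
    | zero => omega
    | succ k => obtain ⟨h'⟩ := ih (k := k) (by omega); exact ⟨.there h'⟩

theorem CCtx.Only.eraseIdx_gt {Δ : CCtx} {i : ℕ} {α : CTy} (h : Δ.Only i α) {k : ℕ} (hk : k < i) :
    Nonempty (CCtx.Only (Δ.eraseIdx k) (i - 1) α) := by
  induction h generalizing k with
  | here h => omega
  | @there Δ i α h ih =>
    cases k with
    | zero => exact ⟨h⟩
    | succ k =>
      obtain ⟨h'⟩ := ih (k := k) (by omega)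
      obtain ⟨j, rfl⟩ : ∃ j, i = j + 1 := ⟨i - 1, by omega⟩
      exact ⟨.there h'⟩

theorem CCtx.Only.eraseIdx_eq {Δ : CCtx} {i : ℕ} {α : CTy} (h : Δ.Only i α) :
    Nonempty (CCtx.IsEmpty (Δ.eraseIdx i)) ∧ Δ[i]? = some (some α) := by
  induction h with
  | here h => exact ⟨⟨h⟩, rfl⟩
  | there h ih =>
    obtain ⟨⟨h'⟩, e⟩ := ih
    exact ⟨⟨.cons h'⟩, e⟩

theorem CCtx.IsEmpty.append {Δ E : CCtx} (h : Δ.IsEmpty) (hE : E.IsEmpty) :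
    Nonempty (CCtx.IsEmpty (Δ ++ E)) := by
  induction h with
  | nil => exact ⟨hE⟩
  | cons h ih => obtain ⟨h'⟩ := ih; exact ⟨.cons h'⟩

theorem CCtx.Only.append {Δ E : CCtx} {i : ℕ} {α : CTy} (h : Δ.Only i α) (hE : E.IsEmpty) :
    Nonempty (CCtx.Only (Δ ++ E) i α) := by
  induction h with
  | here h => obtain ⟨h'⟩ := h.append hE; exact ⟨.here h'⟩
  | there h ih => obtain ⟨h'⟩ := ih; exact ⟨.there h'⟩

theorem CCtx.IsEmpty.merge {E : CCtx} (hE : E.IsEmpty) : Nonempty (CCtx.Merge E E E) := by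
  induction hE with
  | nil => exact ⟨.nil⟩
  | cons h ih => obtain ⟨m⟩ := ih; exact ⟨.skip m⟩

theorem CCtx.Merge.append {Δ₁ Δ₂ Δ E : CCtx} (m : CCtx.Merge Δ₁ Δ₂ Δ) (hE : E.IsEmpty) :
    Nonempty (CCtx.Merge (Δ₁ ++ E) (Δ₂ ++ E) (Δ ++ E)) := by
  induction m with
  | nil => exact hE.merge
  | skip m ih => obtain ⟨m'⟩ := ih; exact ⟨.skip m'⟩
  | left α m ih => obtain ⟨m'⟩ := ih; exact ⟨.left α m'⟩
  | right α m ih => obtain ⟨m'⟩ := ih; exact ⟨.right α m'⟩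

/-! Subject reduction for the linear calculus. -/

namespace CTyping

theorem below_length {Δ : CCtx} {a : CExpr d} {α : CTy} (D : CTyping Δ a α) : a.Below Δ.length := by
  induction D with
  | var h => exact h.lt_length
  | letIn m D D' ih ih' =>
    have := m.length_eq
    exact ⟨this.1 ▸ ih, by simpa [this.2] using ih'⟩
  | const r h => trivial
  | smul m D D' ih ih' => have := m.length_eq; exact ⟨this.1 ▸ ih, this.2 ▸ ih'⟩
  | zero Δ α => trivial
  | add D D' ih ih' => exact ⟨ih, ih'⟩
  | pair D D' ih ih' => exact ⟨ih, ih'⟩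
  | case m D D₁ D₂ ih ih₁ ih₂ =>
    have := m.length_eq
    exact ⟨this.1 ▸ ih, by simpa [this.2] using ih₁, by simpa [this.2] using ih₂⟩
  | lam D ih => exact ih
  | app m D D' ih ih' => have := m.length_eq; exact ⟨this.1 ▸ ih, this.2 ▸ ih'⟩

theorem append {Δ : CCtx} {a : CExpr d} {α : CTy} (D : CTyping Δ a α) {E : CCtx}
    (hE : E.IsEmpty) : Nonempty (CTyping (Δ ++ E) a α) := by
  induction D with
  | var h => obtain ⟨h'⟩ := h.append hE; exact ⟨.var h'⟩
  | letIn m D D' ih ih' =>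
    obtain ⟨m'⟩ := m.append hE; obtain ⟨D1⟩ := ih; obtain ⟨D2⟩ := ih'; exact ⟨.letIn m' D1 D2⟩
  | const r h => obtain ⟨h'⟩ := h.append hE; exact ⟨.const r h'⟩
  | smul m D D' ih ih' =>
    obtain ⟨m'⟩ := m.append hE; obtain ⟨D1⟩ := ih; obtain ⟨D2⟩ := ih'; exact ⟨.smul m' D1 D2⟩
  | zero Δ α => exact ⟨.zero _ _⟩
  | add D D' ih ih' => obtain ⟨D1⟩ := ih; obtain ⟨D2⟩ := ih'; exact ⟨.add D1 D2⟩
  | pair D D' ih ih' => obtain ⟨D1⟩ := ih; obtain ⟨D2⟩ := ih'; exact ⟨.pair D1 D2⟩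
  | case m D D₁ D₂ ih ih₁ ih₂ =>
    obtain ⟨m'⟩ := m.append hE
    obtain ⟨D1⟩ := ih; obtain ⟨D2⟩ := ih₁; obtain ⟨D3⟩ := ih₂; exact ⟨.case m' D1 D2 D3⟩
  | lam D ih => obtain ⟨D1⟩ := ih; exact ⟨.lam D1⟩
  | app m D D' ih ih' =>
    obtain ⟨m'⟩ := m.append hE; obtain ⟨D1⟩ := ih; obtain ⟨D2⟩ := ih'; exact ⟨.app m' D1 D2⟩

/-- The condition on `v` is conditional because a split context leaves the slot `k` empty in at
least one part. There the variable does not occur and nothing is required of `v`. -/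
theorem subst {Δ : CCtx} {a v : CExpr d} {α : CTy} (D : CTyping Δ a α) {k : ℕ}
    (hk : k < Δ.length) (hv : ∀ β, Δ[k]? = some (some β) → Nonempty (CTyping [] v β)) :
    Nonempty (CTyping (Δ.eraseIdx k) (CExpr.subst k v a) α) := by
  induction D generalizing k with
  | @var Δ i α h =>
    rcases lt_trichotomy i k with hik | hik | hik
    · obtain ⟨h'⟩ := h.eraseIdx_lt hik
      rw [CExpr.subst, if_pos hik]
      exact ⟨.var h'⟩
    · subst hik
      obtain ⟨⟨h'⟩, e⟩ := h.eraseIdx_eq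
      obtain ⟨D⟩ := hv _ e
      rw [CExpr.subst, if_neg (lt_irrefl _), if_pos rfl]
      exact D.append h'
    · obtain ⟨h'⟩ := h.eraseIdx_gt hik
      rw [CExpr.subst, if_neg (by omega), if_neg (by omega)]
      exact ⟨.var h'⟩
  | letIn m D D' ih ih' =>
    have hl := m.length_eq
    obtain ⟨m'⟩ := m.eraseIdx k
    obtain ⟨D1⟩ := ih (by omega) fun β h => hv β (m.lookup.1 h)
    obtain ⟨D2⟩ := ih' (k := k + 1) (by simp only [List.length_cons]; omega)
      fun β h => hv β (m.lookup.2 h)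
    exact ⟨.letIn m' D1 D2⟩
  | const r h => obtain ⟨h'⟩ := h.eraseIdx k; exact ⟨.const r h'⟩
  | smul m D D' ih ih' =>
    have hl := m.length_eq
    obtain ⟨m'⟩ := m.eraseIdx k
    obtain ⟨D1⟩ := ih (by omega) fun β h => hv β (m.lookup.1 h)
    obtain ⟨D2⟩ := ih' (by omega) fun β h => hv β (m.lookup.2 h)
    exact ⟨.smul m' D1 D2⟩
  | zero Δ α => exact ⟨.zero _ _⟩
  | add D D' ih ih' =>
    obtain ⟨D1⟩ := ih hk hv; obtain ⟨D2⟩ := ih' hk hv; exact ⟨.add D1 D2⟩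
  | pair D D' ih ih' =>
    obtain ⟨D1⟩ := ih hk hv; obtain ⟨D2⟩ := ih' hk hv; exact ⟨.pair D1 D2⟩
  | case m D D₁ D₂ ih ih₁ ih₂ =>
    have hl := m.length_eq
    obtain ⟨m'⟩ := m.eraseIdx k
    obtain ⟨D1⟩ := ih (by omega) fun β h => hv β (m.lookup.1 h)
    obtain ⟨D2⟩ := ih₁ (k := k + 1) (by simp only [List.length_cons]; omega)
      fun β h => hv β (m.lookup.2 h)
    obtain ⟨D3⟩ := ih₂ (k := k + 1) (by simp only [List.length_cons]; omega)
      fun β h => hv β (m.lookup.2 h)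
    exact ⟨.case m' D1 D2 D3⟩
  | lam D ih =>
    obtain ⟨D1⟩ := ih (k := k + 1) (by simp only [List.length_cons]; omega) fun β h => hv β h
    exact ⟨.lam D1⟩
  | app m D D' ih ih' =>
    have hl := m.length_eq
    obtain ⟨m'⟩ := m.eraseIdx k
    obtain ⟨D1⟩ := ih (by omega) fun β h => hv β (m.lookup.1 h)
    obtain ⟨D2⟩ := ih' (by omega) fun β h => hv β (m.lookup.2 h)
    exact ⟨.app m' D1 D2⟩

theorem subst_zero {a v : CExpr d} {α β : CTy} (D : CTyping [some β] a α) (Dv : CTyping [] v β) :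
    Nonempty (CTyping [] (CExpr.subst 0 v a) α) :=
  D.subst (k := 0) (by simp) fun γ h => by
    cases h
    exact ⟨Dv⟩

theorem beta {a a' : CExpr d} {α : CTy} (hs : CBeta a a') (D : CTyping [] a α) :
    Nonempty (CTyping [] a' α) := by
  cases hs with
  | letIn _ => cases D with | letIn m D D' => cases m; exact D'.subst_zero D
  | case _ _ =>
    cases D with
    | case m D D₁ D₂ =>
      cases m
      cases D with
      | pair D D' =>
        obtain ⟨E1⟩ := D₁.subst_zero D
        obtain ⟨E2⟩ := D₂.subst_zero D'
        exact ⟨.add E1 E2⟩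
  | app _ =>
    cases D with
    | app m D D' =>
      cases m
      cases D with
      | lam D => exact D.subst_zero D'
  | zero_unit => cases D; exact ⟨.const _ .nil⟩
  | zero_sum => cases D; exact ⟨.pair (.zero _ _) (.zero _ _)⟩
  | zero_fn => cases D; exact ⟨.lam (.zero _ _)⟩
  | smul_const => cases D with | smul m D D' => cases D'; exact ⟨.const _ .nil⟩
  | smul_pair _ _ =>
    cases D with
    | smul m D D' =>
      cases m
      cases D' with
      | pair E E' => exact ⟨.pair (.smul .nil D E) (.smul .nil D E')⟩
  | smul_lam =>
    cases D with
    | smul m D D' =>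
      cases m
      cases D' with
      | lam E => exact ⟨.lam (.smul (.right _ .nil) (.const _ (.cons .nil)) E)⟩
  | add_const => cases D with | add D D' => cases D'; exact ⟨.const _ .nil⟩
  | add_pair _ _ _ _ =>
    cases D with
    | add D D' =>
      cases D with
      | pair E1 E2 => cases D' with | pair E1' E2' => exact ⟨.pair (.add E1 E1') (.add E2 E2')⟩
  | add_lam =>
    cases D with
    | add D D' =>
      cases D with
      | lam E => cases D' with | lam E' => exact ⟨.lam (.add E E')⟩

theorem step {a a' : CExpr d} {α : CTy} (hs : CStep a a') (D : CTyping [] a α) :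
    Nonempty (CTyping [] a' α) := by
  induction hs generalizing α with
  | beta hs => exact D.beta hs
  | letIn _ ih =>
    cases D with | letIn m D D' => cases m; obtain ⟨E⟩ := ih D; exact ⟨.letIn .nil E D'⟩
  | smul_left _ ih =>
    cases D with | smul m D D' => cases m; obtain ⟨E⟩ := ih D; exact ⟨.smul .nil E D'⟩
  | smul_right _ ih =>
    cases D with | smul m D D' => cases m; obtain ⟨E⟩ := ih D'; exact ⟨.smul .nil D E⟩
  | add_left _ ih => cases D with | add D D' => obtain ⟨E⟩ := ih D; exact ⟨.add E D'⟩
  | add_right _ _ ih => cases D with | add D D' => obtain ⟨E⟩ := ih D'; exact ⟨.add D E⟩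
  | pair_left _ ih => cases D with | pair D D' => obtain ⟨E⟩ := ih D; exact ⟨.pair E D'⟩
  | pair_right _ _ ih => cases D with | pair D D' => obtain ⟨E⟩ := ih D'; exact ⟨.pair D E⟩
  | case _ ih =>
    cases D with | case m D D₁ D₂ => cases m; obtain ⟨E⟩ := ih D; exact ⟨.case .nil E D₁ D₂⟩
  | app_left _ ih =>
    cases D with | app m D D' => cases m; obtain ⟨E⟩ := ih D; exact ⟨.app .nil E D'⟩
  | app_right _ _ ih =>
    cases D with | app m D D' => cases m; obtain ⟨E⟩ := ih D'; exact ⟨.app .nil D E⟩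

end CTyping

/-! Normalization for the linear calculus. -/

open Relation (ReflTransGen)

/-- The closed values that are reducible at a type. -/
def RedVal : CTy → CExpr d → Prop
  | .unit, v => ∃ r : ZMod d, v = .const r
  | .sum α₁ α₂, v => ∃ v₁ v₂ : CExpr d, v = .pair v₁ v₂ ∧ RedVal α₁ v₁ ∧ RedVal α₂ v₂
  | .fn α β, v => ∃ a : CExpr d, v = .lam α a ∧ v.Below 0 ∧ ∀ w, RedVal α w →
      ∃ u, ReflTransGen CStep (CExpr.subst 0 w a) u ∧ RedVal β u

/-- The expressions that reduce to a reducible value. -/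
def RedExp (α : CTy) (a : CExpr d) : Prop := ∃ u, ReflTransGen CStep a u ∧ RedVal α u

theorem RedVal.below {α : CTy} {v : CExpr d} (h : RedVal α v) : v.Below 0 := by
  induction α generalizing v with
  | unit => obtain ⟨r, rfl⟩ := h; trivial
  | sum α₁ α₂ ih₁ ih₂ => obtain ⟨v₁, v₂, rfl, h1, h2⟩ := h; exact ⟨ih₁ h1, ih₂ h2⟩
  | fn α β _ _ => obtain ⟨a, rfl, h1, _⟩ := h; exact h1

theorem RedVal.isVal {α : CTy} {v : CExpr d} (h : RedVal α v) : v.IsVal := by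
  induction α generalizing v with
  | unit => obtain ⟨r, rfl⟩ := h; exact .const r
  | sum α₁ α₂ ih₁ ih₂ => obtain ⟨v₁, v₂, rfl, h1, h2⟩ := h; exact .pair (ih₁ h1) (ih₂ h2)
  | fn α β _ _ => obtain ⟨a, rfl, h1, _⟩ := h; exact .lam α a

theorem RedVal.redExp {α : CTy} {v : CExpr d} (h : RedVal α v) : RedExp α v := ⟨v, .refl, h⟩

theorem RedExp.of_steps {α : CTy} {a a' : CExpr d} (hs : ReflTransGen CStep a a')
    (h : RedExp α a') : RedExp α a := by
  obtain ⟨u, h1, h2⟩ := h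
  exact ⟨u, hs.trans h1, h2⟩

theorem RedExp.of_beta {α : CTy} {a a' : CExpr d} (hs : CBeta a a') (h : RedExp α a') :
    RedExp α a := h.of_steps (.single (.beta hs))

theorem RedExp.pair {α β : CTy} {a b : CExpr d} (ha : RedExp α a) (hb : RedExp β b) :
    RedExp (.sum α β) (.pair a b) := by
  obtain ⟨u, h1, h2⟩ := ha
  obtain ⟨w, h3, h4⟩ := hb
  exact ⟨.pair u w, (h1.lift (fun a => CExpr.pair a b) fun _ _ => .pair_left).trans
    (h3.lift (fun b => CExpr.pair u b) fun _ _ => .pair_right h2.isVal), u, w, rfl, h2, h4⟩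

theorem RedVal.smul {α : CTy} {v : CExpr d} (r : ZMod d) (h : RedVal α v) :
    RedExp α (.smul (.const r) v) := by
  induction α generalizing v with
  | unit =>
    obtain ⟨s, rfl⟩ := h
    exact ⟨_, .single (.beta .smul_const), _, rfl⟩
  | sum α₁ α₂ ih₁ ih₂ =>
    obtain ⟨v₁, v₂, rfl, h1, h2⟩ := h
    exact .of_beta (.smul_pair h1.isVal h2.isVal) ((ih₁ h1).pair (ih₂ h2))
  | fn α β _ ih =>
    obtain ⟨a, rfl, h1, h2⟩ := h
    refine ⟨_, .single (.beta .smul_lam), _, rfl, ⟨trivial, h1⟩, fun w hw => ?_⟩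
    obtain ⟨u, h3, h4⟩ := h2 w hw
    exact (ih h4).of_steps (h3.lift (fun a => CExpr.smul (.const r) a) fun _ _ => .smul_right)

theorem RedVal.add {α : CTy} {v v' : CExpr d} (h : RedVal α v) (h' : RedVal α v') :
    RedExp α (.add v v') := by
  induction α generalizing v v' with
  | unit =>
    obtain ⟨s, rfl⟩ := h
    obtain ⟨s', rfl⟩ := h'
    exact ⟨_, .single (.beta .add_const), _, rfl⟩
  | sum α₁ α₂ ih₁ ih₂ =>
    obtain ⟨v₁, v₂, rfl, h1, h2⟩ := h
    obtain ⟨v₁', v₂', rfl, h1', h2'⟩ := h'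
    exact .of_beta (.add_pair h1.isVal h2.isVal h1'.isVal h2'.isVal)
      ((ih₁ h1 h1').pair (ih₂ h2 h2'))
  | fn α β _ ih =>
    obtain ⟨a, rfl, h1, h2⟩ := h
    obtain ⟨a', rfl, h1', h2'⟩ := h'
    refine ⟨_, .single (.beta .add_lam), _, rfl, ⟨h1, h1'⟩, fun w hw => ?_⟩
    obtain ⟨u, h3, h4⟩ := h2 w hw
    obtain ⟨u', h3', h4'⟩ := h2' w hw
    exact (ih h4 h4').of_steps
      ((h3.lift (fun b => CExpr.add b (CExpr.subst 0 w a')) fun _ _ => .add_left).trans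
        (h3'.lift (fun b => CExpr.add u b) fun _ _ => .add_right h4.isVal))

theorem RedExp.add {α : CTy} {a b : CExpr d} (ha : RedExp α a) (hb : RedExp α b) :
    RedExp α (.add a b) := by
  obtain ⟨u, h1, h2⟩ := ha
  obtain ⟨w, h3, h4⟩ := hb
  exact (h2.add h4).of_steps ((h1.lift (fun a => CExpr.add a b) fun _ _ => .add_left).trans
    (h3.lift (fun b => CExpr.add u b) fun _ _ => .add_right h2.isVal))

theorem RedExp.zero (α : CTy) : RedExp α (.zero α : CExpr d) := by
  induction α with
  | unit => exact ⟨_, .single (.beta .zero_unit), _, rfl⟩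
  | sum α₁ α₂ ih₁ ih₂ => exact .of_beta .zero_sum (ih₁.pair ih₂)
  | fn α β _ ih => exact ⟨_, .single (.beta .zero_fn), _, rfl, trivial, fun w _ => ih⟩

/-- Closed instances of typed expressions by reducible values are reducible. -/
theorem CTyping.redExp {Δ : CCtx} {a : CExpr d} {α : CTy} (D : CTyping Δ a α)
    {δ : List (CExpr d)} (hl : δ.length = Δ.length) (hc : ∀ v ∈ δ, v.Below 0)
    (hδ : ∀ (i : ℕ) (v : CExpr d) (β : CTy), Δ[i]? = some (some β) → δ[i]? = some v →
      RedVal β v) : RedExp α (CExpr.closeAt 0 δ a) := by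
  have hcons : ∀ {Δ : CCtx} {δ : List (CExpr d)} {β : CTy} {w : CExpr d}, RedVal β w →
      (∀ (i : ℕ) (v : CExpr d) (β : CTy), Δ[i]? = some (some β) → δ[i]? = some v →
        RedVal β v) →
      ∀ (i : ℕ) (v : CExpr d) (γ : CTy), (some β :: Δ)[i]? = some (some γ) →
        (w :: δ)[i]? = some v → RedVal γ v := by
    intro Δ δ β w hw hδ i v γ h1 h2
    cases i with
    | zero => cases h1; cases h2; exact hw
    | succ i => exact hδ i v γ h1 h2
  have hclosed : ∀ {δ : List (CExpr d)} {w : CExpr d}, w.Below 0 → (∀ v ∈ δ, v.Below 0) →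
      ∀ v ∈ w :: δ, v.Below 0 := by
    intro δ w hw hδ
    simpa using ⟨hw, hδ⟩
  induction D generalizing δ with
  | @var Δ i α h =>
    have hi : i < δ.length := hl ▸ h.lt_length
    have e := List.getElem?_eq_getElem hi
    rw [CExpr.closeAt_var hc e]
    exact (hδ i _ α h.eraseIdx_eq.2 e).redExp
  | letIn m D D' ih ih' =>
    have hl' := m.length_eq
    obtain ⟨u, h1, h2⟩ := ih (hl.trans hl'.1.symm) hc
      fun i v β h => hδ i v β (m.lookup.1 h)
    rw [CExpr.closeAt_letIn]
    refine .of_steps (h1.lift (fun a => CExpr.letIn a _) fun _ _ => .letIn) ?_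
    refine .of_beta (.letIn h2.isVal) ?_
    rw [CExpr.subst_closeAt hc h2.below]
    exact ih' (by simp [hl, hl'.2]) (hclosed h2.below hc)
      (hcons h2 fun i v β h => hδ i v β (m.lookup.2 h))
  | const r h =>
    rw [CExpr.closeAt_of_below (a := .const r) trivial]
    exact ⟨_, .refl, r, rfl⟩
  | smul m D D' ih ih' =>
    have hl' := m.length_eq
    obtain ⟨u, h1, r, rfl⟩ := ih (hl.trans hl'.1.symm) hc
      fun i v β h => hδ i v β (m.lookup.1 h)
    obtain ⟨w, h3, h4⟩ := ih' (hl.trans hl'.2.symm) hc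
      fun i v β h => hδ i v β (m.lookup.2 h)
    rw [CExpr.closeAt_smul]
    exact (h4.smul r).of_steps
      ((h1.lift (fun a => CExpr.smul a _) fun _ _ => .smul_left).trans
      (h3.lift (fun b => CExpr.smul (.const r) b) fun _ _ => .smul_right))
  | zero Δ α =>
    rw [CExpr.closeAt_of_below (a := .zero α) trivial]
    exact .zero α
  | add D D' ih ih' =>
    rw [CExpr.closeAt_add]
    exact (ih hl hc hδ).add (ih' hl hc hδ)
  | pair D D' ih ih' =>
    rw [CExpr.closeAt_pair]
    exact (ih hl hc hδ).pair (ih' hl hc hδ)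
  | case m D D₁ D₂ ih ih₁ ih₂ =>
    have hl' := m.length_eq
    obtain ⟨u, h1, v₁, v₂, rfl, h2, h3⟩ := ih (hl.trans hl'.1.symm) hc
      fun i v β h => hδ i v β (m.lookup.1 h)
    rw [CExpr.closeAt_case]
    refine .of_steps (h1.lift (fun a => CExpr.case a _ _) fun _ _ => .case) ?_
    refine .of_beta (.case h2.isVal h3.isVal) ?_
    rw [CExpr.subst_closeAt hc h2.below, CExpr.subst_closeAt hc h3.below]
    exact (ih₁ (by simp [hl, hl'.2]) (hclosed h2.below hc)
      (hcons h2 fun i v β h => hδ i v β (m.lookup.2 h))).add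
      (ih₂ (by simp [hl, hl'.2]) (hclosed h3.below hc)
      (hcons h3 fun i v β h => hδ i v β (m.lookup.2 h)))
  | @lam Δ a α α' D ih =>
    -- Reducibility at function types includes closedness, which lets the value be substituted under
    -- other binders later.
    have hb : (CExpr.closeAt 0 δ (CExpr.lam α a)).Below 0 :=
      CExpr.Below.closeAt hc (by simpa [hl] using (CTyping.lam D).below_length) 0 le_rfl
    rw [CExpr.closeAt_lam] at hb ⊢
    refine RedVal.redExp ⟨_, rfl, hb, fun w hw => ?_⟩
    rw [CExpr.subst_closeAt hc hw.below]
    exact ih (by simp [hl]) (hclosed hw.below hc) (hcons hw hδ)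
  | app m D D' ih ih' =>
    have hl' := m.length_eq
    obtain ⟨u, h1, a, rfl, hb, h2⟩ := ih (hl.trans hl'.1.symm) hc
      fun i v β h => hδ i v β (m.lookup.1 h)
    obtain ⟨w, h3, h4⟩ := ih' (hl.trans hl'.2.symm) hc
      fun i v β h => hδ i v β (m.lookup.2 h)
    rw [CExpr.closeAt_app]
    refine .of_steps ((h1.lift (fun a => CExpr.app a _) fun _ _ => .app_left).trans
      (h3.lift (fun b => CExpr.app (.lam _ a) b) fun _ _ => .app_right (.lam _ _))) ?_
    exact .of_beta (.app h4.isVal) (h2 w h4)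

end ProjCliff

namespace ProjCliff
noncomputable section
set_option linter.unusedSectionVars false

variable {d : ℕ}

/-! The symplectic form as a term and as a bilinear map. -/

namespace SObj

variable (V W : SObj d)

theorem omega_add_left (a b c : V) : V.omega (a + b) c = V.omega a c + V.omega b c := by
  simp only [omega, x, z, map_add, Finsupp.add_apply, ← Finset.sum_add_distrib]
  exact Finset.sum_congr rfl fun i _ => by ring

theorem omega_smul_left (r : ZMod d) (a c : V) : V.omega (r • a) c = r * V.omega a c := by
  simp only [omega, x, z, map_smul, Finsupp.smul_apply, Finset.mul_sum, smul_eq_mul]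
  exact Finset.sum_congr rfl fun i _ => by ring

theorem omega_antisymm (a b : V) : V.omega a b = - V.omega b a := by
  simp only [omega, ← Finset.sum_neg_distrib]
  exact Finset.sum_congr rfl fun i _ => by ring

theorem omega_add_right (a b c : V) : V.omega a (b + c) = V.omega a b + V.omega a c := by
  rw [omega_antisymm, omega_add_left, neg_add, ← omega_antisymm, ← omega_antisymm]

theorem omega_smul_right (r : ZMod d) (a c : V) : V.omega a (r • c) = r * V.omega a c := by
  rw [omega_antisymm, omega_smul_left, V.omega_antisymm a c, mul_neg]

/-- The symplectic form as a bilinear map. -/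
def omegaLin : V →ₗ[ZMod d] V →ₗ[ZMod d] ZMod d :=
  LinearMap.mk₂ _ V.omega V.omega_add_left V.omega_smul_left V.omega_add_right V.omega_smul_right

theorem omega_qudit (p q : ZMod d × ZMod d) :
    (SObj.qudit d).omega p q = p.2 * q.1 - q.2 * p.1 := by
  have hx : ∀ p : ZMod d × ZMod d, (SObj.qudit d).basis.repr p (finSumFinEquiv (Sum.inl 0)) = p.1 :=
    fun p => by simp
  have hz : ∀ p : ZMod d × ZMod d, (SObj.qudit d).basis.repr p (finSumFinEquiv (Sum.inr 0)) = p.2 :=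
    fun p => by simp
  refine (Fin.sum_univ_one _).trans ?_
  exact congrArg₂ _ (congrArg₂ _ (hz p) (hx q)) (congrArg₂ _ (hz q) (hx p))

end SObj

namespace PTy

/-- The nested cases of the term add up four branches. On a pair of components only the mixed ones
survive for a qudit, and only the diagonal ones for a product. -/
theorem omega_den (Q : PTy) (ρ : List (DVal d)) : (Q.omega d).Den ρ
    (DVal.fn (α := Q.toC) (β := .fn Q.toC .unit) (Q.den d).omegaLin) := by
  induction Q generalizing ρ with
  | pauli =>
    have e : ∀ px pz qx qz : ZMod d, (SObj.qudit d).omegaLin (px, pz) (qx, qz) =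
        ((0 : ZMod d) + (-1) * (px * qz)) + (pz * qx + (0 : ZMod d)) := fun px pz qx qz =>
      (SObj.omega_qudit _ _).trans (by ring)
    refine ⟨.fn (.sum .unit .unit) .unit, (PTy.den d .pauli).omegaLin,
      fun p => ⟨.unit, (PTy.den d .pauli).omegaLin p, fun q => ?_, rfl⟩, rfl⟩
    obtain ⟨px, pz⟩ := p
    obtain ⟨qx, qz⟩ := q
    refine ⟨.unit, .unit, .unit, px, pz, _, _, rfl, ⟨.unit, .unit, .unit, qx, qz, _, _, rfl,
      rfl, ⟨_, _, _, rfl, ⟨_, _, _, rfl, rfl, rfl⟩, rfl⟩, rfl⟩, ⟨.unit, .unit, .unit, qx, qz, _, _,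
      rfl, ⟨_, _, _, rfl, rfl, rfl⟩, rfl, rfl⟩, congrArg (Sigma.mk _) (e px pz qx qz)⟩
  | tensor Q₁ Q₂ ih₁ ih₂ =>
    refine ⟨.fn (.sum Q₁.toC Q₂.toC) .unit, (PTy.den d (.tensor Q₁ Q₂)).omegaLin,
      fun p => ⟨.unit, (PTy.den d (.tensor Q₁ Q₂)).omegaLin p, fun q => ?_, rfl⟩, rfl⟩
    obtain ⟨p₁, p₂⟩ := p
    obtain ⟨q₁, q₂⟩ := q
    have e : ((Q₁.den d).sum (Q₂.den d)).omegaLin (p₁, p₂) (q₁, q₂) =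
        ((Q₁.den d).omegaLin p₁ q₁ + (0 : ZMod d)) + ((0 : ZMod d) + (Q₂.den d).omegaLin p₂ q₂) := by
      refine (PHom.omega_sum _ _ _ _).trans ?_
      rw [add_zero, zero_add]
      rfl
    refine ⟨Q₁.toC, Q₂.toC, .unit, p₁, p₂, _, _, rfl, ⟨Q₁.toC, Q₂.toC, .unit, q₁, q₂, _, _, rfl,
      ⟨_, _, _, _, ⟨_, _, _, _, ih₁ _, rfl, rfl⟩, rfl, rfl⟩, rfl, rfl⟩,
      ⟨Q₁.toC, Q₂.toC, .unit, q₁, q₂, _, _,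
      rfl, rfl, ⟨_, _, _, _, ⟨_, _, _, _, ih₂ _, rfl, rfl⟩, rfl, rfl⟩, rfl⟩,
      congrArg (Sigma.mk _) e⟩

theorem sympForm_den (Q : PTy) {a₁ a₂ : CExpr d} {ρ : List (DVal d)} {y₁ y₂ : Q.toC.den d}
    (h₁ : a₁.Den ρ ⟨Q.toC, y₁⟩) (h₂ : a₂.Den ρ ⟨Q.toC, y₂⟩) :
    (sympForm Q a₁ a₂).Den ρ (DVal.scalar ((Q.den d).omega y₁ y₂)) :=
  ⟨_, _, _, _, ⟨_, _, _, _, Q.omega_den ρ, h₁, rfl⟩, h₂, rfl⟩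

/-- Every element of a symplectic type is denoted by a closed value. -/
theorem exists_val (Q : PTy) (y : Q.toC.den d) :
    ∃ v : CExpr d, RedVal Q.toC v ∧ ValRel Q.toC v v ∧ v.Den [] ⟨Q.toC, y⟩ := by
  induction Q with
  | pauli =>
    obtain ⟨x, z⟩ := y
    exact ⟨.pair (.const x) (.const z), ⟨_, _, rfl, ⟨_, rfl⟩, ⟨_, rfl⟩⟩,
      ⟨_, _, _, _, rfl, rfl, ⟨_, rfl, rfl⟩, ⟨_, rfl, rfl⟩⟩, ⟨_, _, _, _, rfl, rfl, rfl⟩⟩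
  | tensor Q₁ Q₂ ih₁ ih₂ =>
    obtain ⟨y₁, y₂⟩ := y
    obtain ⟨v₁, h1, h2, h3⟩ := ih₁ y₁
    obtain ⟨v₂, h1', h2', h3'⟩ := ih₂ y₂
    exact ⟨.pair v₁ v₂, ⟨_, _, rfl, h1, h1'⟩, ⟨_, _, _, _, rfl, rfl, h2, h2'⟩,
      ⟨_, _, _, _, h3, h3', rfl⟩⟩

theorem toC_ne_unit (Q : PTy) : Q.toC ≠ .unit := by cases Q <;> simp [toC]

/-- `CExpr.Den` sees only underlying types. Nothing is lost: the components of a product are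
symplectic types, never the scalars that make up a qudit. -/
theorem toC_injective : Function.Injective toC := by
  intro Q
  induction Q with
  | pauli =>
    intro Q' h
    cases Q' with
    | pauli => rfl
    | tensor Q₁ Q₂ => exact absurd (CTy.sum.inj h).1.symm Q₁.toC_ne_unit
  | tensor Q₁ Q₂ ih₁ ih₂ =>
    intro Q' h
    cases Q' with
    | pauli => exact absurd (CTy.sum.inj h).1 Q₁.toC_ne_unit
    | tensor Q₁' Q₂' => rw [ih₁ (CTy.sum.inj h).1, ih₂ (CTy.sum.inj h).2]

end PTy

/-- Equivalent expressions of scalar type denote the same scalar in every reducible instance. -/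
theorem CEquiv.scalar_eq {Δ : CCtx} {a b : CExpr d} (h : CEquiv Δ a b .unit)
    {δ : List (CExpr d)} (hl : δ.length = Δ.length) (hc : ∀ v ∈ δ, v.Below 0)
    (hδ : ∀ (i : ℕ) (v : CExpr d) (β : CTy), Δ[i]? = some (some β) → δ[i]? = some v →
      RedVal β v) (hrel : CtxRel Δ δ δ) {r s : ZMod d}
    (ha : (CExpr.closeAt 0 δ a).Den [] (DVal.scalar r))
    (hb : (CExpr.closeAt 0 δ b).Den [] (DVal.scalar s)) : r = s := by
  obtain ⟨⟨Da⟩, ⟨Db⟩, h⟩ := h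
  obtain ⟨u, h1, r', rfl⟩ := Da.redExp hl hc hδ
  obtain ⟨w, h2, s', rfl⟩ := Db.redExp hl hc hδ
  have hr : r = r' := by
    have := ha.steps h1
    cases this
    rfl
  have hs : s = s' := by
    have := hb.steps h2
    cases this
    rfl
  rw [← CExpr.close_eq_closeAt] at h1 h2
  obtain ⟨t, e1, e2⟩ := (h δ δ hrel).2.2 _ _ ⟨⟨h1, .const _⟩, ⟨h2, .const _⟩⟩
  cases e1
  cases e2
  rw [hr, hs]

theorem CEquiv.scalar_eq_of_closed {a b : CExpr d} (h : CEquiv [] a b .unit) {r s : ZMod d}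
    (ha : a.Den [] (DVal.scalar r)) (hb : b.Den [] (DVal.scalar s)) : r = s :=
  h.scalar_eq (δ := []) rfl (by simp) (by simp) trivial ha hb

/-! Well-definedness of interpretations. -/

namespace PHom

variable [hd : Fact (1 < d)] {V V₁ V₂ W X : SObj d}

/-- Expanding bilinearly, the form on the images is determined by this one value; `f` plays the part
of X and `g` that of Z. -/
theorem exists_boxUnit (f g : PHom .unit V) (h : V.omega g.vec f.vec = 1) :
    ∃ k, boxUnit f g = some k ∧ ∀ a b : ZMod d, k.lin (a, b) = a • f.vec + b • g.vec := by
  have e : ∀ a b : ZMod d, LinearMap.coprod f.ψ g.ψ (a, b) = a • f.vec + b • g.vec := fun a b => by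
    have e : ∀ (f : PHom .unit V) (a : CObj.unit d), f.ψ a = (a : ZMod d) • f.vec := fun f a =>
      (congrArg f.ψ (mul_one (M := ZMod d) a).symm).trans (map_smul f.ψ (a : ZMod d) (one d))
    rw [← e, ← e]
    rfl
  have hs : SObj.IsSymplectic (SObj.qudit d) V (LinearMap.coprod f.ψ g.ψ) := by
    rintro ⟨a, b⟩ ⟨a', b'⟩
    refine (congrArg₂ V.omega (e a b) (e a' b')).trans (Eq.trans ?_ (SObj.omega_qudit _ _).symm)
    simp only [SObj.omega_add_left, SObj.omega_add_right, SObj.omega_smul_left,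
      SObj.omega_smul_right, SObj.omega_self, V.omega_antisymm f.vec g.vec, h]
    ring
  refine ⟨_, dif_pos hs, fun a b => e a b⟩

/-- Orthogonality removes the cross terms, and what remains is the form of the direct sum. -/
theorem exists_boxPauli (f : PHom (.pauli V₁) V) (g : PHom (.pauli V₂) V)
    (h : ∀ y₁ y₂, V.omega (f.lin y₁) (g.lin y₂) = 0) :
    ∃ k, boxPauli f g = some k ∧ k.lin = LinearMap.coprod f.lin g.lin := by
  have hs : SObj.IsSymplectic (V₁.sum V₂) V (LinearMap.coprod f.lin g.lin) := by
    rintro ⟨a, b⟩ ⟨a', b'⟩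
    refine Eq.trans ?_ (PHom.omega_sum _ _ _ _).symm
    have e : ∀ a b, LinearMap.coprod f.lin g.lin (a, b) = f.lin a + g.lin b := fun a b => rfl
    rw [e, e, ← f.lin_isSymplectic, ← g.lin_isSymplectic]
    simp only [SObj.omega_add_left, SObj.omega_add_right, h,
      V.omega_antisymm (g.lin b) (f.lin a')]
    simp
  exact ⟨_, dif_pos hs, rfl⟩

end PHom

/-- An environment for a context, with the corresponding element of the module of the context. -/
inductive PCtx.Point : (Θ : PCtx) → List (DVal d) → (Θ.den d).toCObj → Prop
  | none : PCtx.Point none [] (PHom.one d)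
  | some {Q : PTy} (x : Q.toC.den d) : PCtx.Point (some Q) [⟨Q.toC, x⟩] x

theorem PCtx.exists_point (Θ : PCtx) : ∃ (ρ : List (DVal d)) (t : (Θ.den d).toCObj),
    Θ.Point ρ t := by
  cases Θ with
  | none => exact ⟨_, _, .none⟩
  | some Q => exact ⟨_, _, .some 0⟩

/-! ### Definedness and coherence of the interpretation for projective Cliffords. -/

namespace PTyping

variable [hd : Fact (1 < d)]

/-- The interpretation of a derivation is defined, and its linear part is denoted by the
underlying expression of the linear calculus. -/
theorem exists_interp {Θ : PCtx} {e : PExpr d} {Q : PTy} (D : PTyping Θ e Q) :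
    ∃ f, D.interp = some f ∧ ∀ (ρ : List (DVal d)) (t : (Θ.den d).toCObj), Θ.Point ρ t →
      e.psi.Den ρ ⟨Q.toC, f.ψ t⟩ := by
  induction D with
  | var Q =>
    refine ⟨_, rfl, fun ρ t ht => ?_⟩
    cases ht
    rfl
  | letIn D D' ih ih' =>
    obtain ⟨f, hf, hf'⟩ := ih
    obtain ⟨g, hg, hg'⟩ := ih'
    refine ⟨PHom.comp g f, by simp [interp, hf, hg], fun ρ t ht => ?_⟩
    exact ⟨_, hf' ρ t ht, (hg' _ _ (.some (f.ψ t))).weaken ρ⟩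
  | ofC D =>
    refine ⟨_, rfl, fun ρ t ht => ?_⟩
    cases ht
    exact D.den_interp (.nil [])
  | phase D D' ih =>
    obtain ⟨f, hf, hf'⟩ := ih
    exact ⟨PHom.addPhase _ f, by simp only [interp, hf]; rfl, hf'⟩
  | star D D' ih ih' =>
    obtain ⟨f, hf, hf'⟩ := ih
    obtain ⟨g, hg, hg'⟩ := ih'
    exact ⟨PHom.star f g, by simp only [interp, hf, hg]; rfl, fun ρ t ht =>
      ⟨_, _, _, hf' ρ t ht, hg' ρ t ht, rfl⟩⟩
  | pow r D ih =>
    obtain ⟨f, hf, hf'⟩ := ih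
    refine ⟨_, by simp only [interp, hf]; rfl, fun ρ t ht => ?_⟩
    exact ⟨r, _, _, rfl, hf' ρ t ht, congrArg (Sigma.mk _) (map_smul f.ψ r t)⟩
  | caseXZ D Dx Dz h ih ihx ihz =>
    obtain ⟨f, hf, hf'⟩ := ih
    obtain ⟨gx, hgx, hgx'⟩ := ihx
    obtain ⟨gz, hgz, hgz'⟩ := ihz
    obtain ⟨g, hg, hg'⟩ := PHom.exists_boxUnit gx gz
      (h.scalar_eq_of_closed (PTy.sympForm_den _ (hgz' _ _ .none) (hgx' _ _ .none)) rfl)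
    refine ⟨PHom.comp g f, by simp [interp, hf, hgx, hgz, hg], fun ρ t ht => ?_⟩
    refine ⟨.unit, .unit, _, (f.ψ t).1, (f.ψ t).2, _, _, hf' ρ t ht, ⟨_, _, _, rfl,
      ((hgx' _ _ .none).of_nil ρ).shift (ρ₁ := []) _, rfl⟩, ⟨_, _, _, rfl,
      ((hgz' _ _ .none).of_nil ρ).shift (ρ₁ := []) _, rfl⟩,
      congrArg (Sigma.mk _) (hg' (f.ψ t).1 (f.ψ t).2)⟩
  | inl Q₂ D ih =>
    obtain ⟨f, hf, hf'⟩ := ih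
    exact ⟨_, by simp only [interp, hf]; rfl, fun ρ t ht => ⟨_, _, _, _, hf' ρ t ht, rfl, rfl⟩⟩
  | inr Q₁ D ih =>
    obtain ⟨f, hf, hf'⟩ := ih
    exact ⟨_, by simp only [interp, hf]; rfl, fun ρ t ht => ⟨_, _, _, _, rfl, hf' ρ t ht, rfl⟩⟩
  | @caseIn Θ e e₁ e₂ Q₁ Q₂ Q' D D₁ D₂ h ih ih₁ ih₂ =>
    obtain ⟨f, hf, hf'⟩ := ih
    obtain ⟨g₁, hg₁, hg₁'⟩ := ih₁
    obtain ⟨g₂, hg₂, hg₂'⟩ := ih₂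
    -- The side condition concerns closed values, so arbitrary vectors are first realized by such
    -- values, which are reducible and related to themselves.
    have hω : ∀ y₁ y₂, (Q'.den d).omega (g₁.lin y₁) (g₂.lin y₂) = 0 := by
      intro y₁ y₂
      obtain ⟨v₁, a1, a2, a3⟩ := Q₁.exists_val y₁
      obtain ⟨v₂, b1, b2, b3⟩ := Q₂.exists_val y₂
      have hden := PTy.sympForm_den Q' ((hg₁' _ _ (.some y₁)).weaken [⟨Q₂.toC, y₂⟩])
        ((hg₂' _ _ (.some y₂)).shift (ρ₁ := []) ⟨Q₁.toC, y₁⟩)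
      refine h.scalar_eq (δ := [v₁, v₂]) rfl (by simp [a1.below, b1.below]) ?_
        ⟨a2, b2, trivial⟩ (b3.subst_zero (a3.subst_zero hden)) rfl
      intro i v β h1 h2
      match i with
      | 0 => cases h1; cases h2; exact a1
      | 1 => cases h1; cases h2; exact b1
      | i + 2 => simp at h1
    obtain ⟨g, hg, hg'⟩ := PHom.exists_boxPauli g₁ g₂ hω
    refine ⟨PHom.comp (W := Q'.den d) g f, ?_, fun ρ t ht => ?_⟩
    · simp only [interp, hf, hg₁, hg₂]
      exact congrArg (fun o => Option.bind o fun g => some (PHom.comp g f)) hg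
    have e : g.lin (f.ψ t) = g₁.lin (f.ψ t).1 + g₂.lin (f.ψ t).2 :=
      LinearMap.congr_fun hg' (f.ψ t)
    exact ⟨Q₁.toC, Q₂.toC, _, (f.ψ t).1, (f.ψ t).2, _, _, hf' ρ t ht,
      (hg₁' _ _ (.some (f.ψ t).1)).weaken ρ, (hg₂' _ _ (.some (f.ψ t).2)).weaken ρ,
      congrArg (Sigma.mk _) e⟩

/-- The underlying expression has at most one denotation in a given environment, and the denotation
carries its type. This settles the intermediate types of `letIn` and `caseIn`, which the syntax
leaves open. -/
theorem type_unique {Θ : PCtx} {e : PExpr d} {Q Q' : PTy} (D : PTyping Θ e Q)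
    (D' : PTyping Θ e Q') : Q = Q' := by
  obtain ⟨ρ, t, ht⟩ := PCtx.exists_point (d := d) Θ
  obtain ⟨f, _, hf⟩ := D.exists_interp
  obtain ⟨g, _, hg⟩ := D'.exists_interp
  exact PTy.toC_injective (congrArg Sigma.fst ((hf ρ t ht).unique (hg ρ t ht)))

theorem interp_unique {Θ : PCtx} {e : PExpr d} {Q : PTy} (D D' : PTyping Θ e Q) :
    D.interp = D'.interp := by
  induction D with
  | var Q => cases D'; rfl
  | letIn D₁ D₂ ih₁ ih₂ =>
    cases D' with
    | letIn E₁ E₂ =>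
      cases D₁.type_unique E₁
      simp only [interp, ih₁ E₁, ih₂ E₂]
  | ofC D => cases D' with | ofC E => simp only [interp, D.interp_unique E]
  | phase D₁ D₂ ih =>
    cases D' with | phase E₁ E₂ => simp only [interp, D₁.interp_unique E₁, ih E₂]
  | star D₁ D₂ ih₁ ih₂ => cases D' with | star E₁ E₂ => rw [interp, ih₁ E₁, ih₂ E₂]; rfl
  | pow r D ih => cases D' with | pow _ E => rw [interp, ih E]; rfl
  | caseXZ D Dx Dz h ih ihx ihz =>
    cases D' with | caseXZ E Ex Ez _ => simp only [interp, ih E, ihx Ex, ihz Ez]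
  | inl Q₂ D ih => cases D' with | inl _ E => simp only [interp, ih E]
  | inr Q₁ D ih => cases D' with | inr _ E => simp only [interp, ih E]
  | caseIn D D₁ D₂ h ih ih₁ ih₂ =>
    cases D' with
    | caseIn E E₁ E₂ _ =>
      cases D.type_unique E
      simp only [interp, ih E, ih₁ E₁, ih₂ E₂]

end PTyping
end
end ProjCliff

namespace ProjCliff
noncomputable section
set_option linter.unusedSectionVars false

variable {d : ℕ}

/-! Substitution of values in expressions with one variable. -/

/-- A context holds at most one variable, so the body of a binder sees only the variable bound
there. An outer substitution never reaches it. -/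
theorem PTyping.subst_eq {Θ : PCtx} {e : PExpr d} {Q : PTy} (D : PTyping Θ e Q) {k : ℕ}
    (hk : Θ.toC.length ≤ k) (v : CExpr d) : PExpr.subst k v e = e := by
  induction D generalizing k with
  | var Q => exact if_pos hk
  | letIn D D' ih ih' => rw [PExpr.subst, ih hk, ih' (Nat.succ_le_succ (Nat.zero_le k))]
  | ofC D => rw [PExpr.subst, D.below_length.subst_eq hk]
  | phase D D' ih => rw [PExpr.subst, D.below_length.subst_eq hk, ih hk]
  | star D D' ih ih' => rw [PExpr.subst, ih hk, ih' hk]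
  | pow r D ih => rw [PExpr.subst, ih hk]
  | caseXZ D Dx Dz h ih ihx ihz =>
    rw [PExpr.subst, ih hk, ihx (Nat.zero_le k), ihz (Nat.zero_le k)]
  | inl Q₂ D ih => rw [PExpr.subst, ih hk]
  | inr Q₁ D ih => rw [PExpr.subst, ih hk]
  | caseIn D D₁ D₂ h ih ih₁ ih₂ =>
    rw [PExpr.subst, ih hk, ih₁ (Nat.succ_le_succ (Nat.zero_le k)),
      ih₂ (Nat.succ_le_succ (Nat.zero_le k))]

/-- The global element denoted by a closed expression of the linear calculus. -/
def CTyping.global {a : CExpr d} {Q : PTy} (D : CTyping [] a Q.toC) : PHom .unit (Q.den d) :=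
  ⟨0, D.interp, trivial⟩

theorem PTyping.interp_ofC {a : CExpr d} {Q : PTy} (D : CTyping [] a Q.toC) :
    (PTyping.ofC D).interp = some D.global := rfl

variable [hd : Fact (1 < d)]

theorem CTyping.global_phase {a : CExpr d} {Q : PTy} (D : CTyping [] a Q.toC) :
    D.global.phase = 0 := rfl

theorem CTyping.den_global {a : CExpr d} {Q : PTy} (D : CTyping [] a Q.toC) :
    a.Den [] ⟨Q.toC, D.global.vec⟩ := D.den_interp (.nil [])

theorem CTyping.den_scalar {a : CExpr d} (D : CTyping [] a .unit) :
    a.Den [] (DVal.scalar (PHom.scalar (D.interp ∘ₗ PCtx.toTensor d none))) :=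
  D.den_interp (.nil [])

/-- Substitution is composition with the global element of `v`. The variable lies in the principal
subexpression, so each binding or case construct reduces to associativity; constructs that require a
closed context do not occur. -/
theorem PTyping.exists_subst {Q₀ : PTy} {v : CExpr d} (Dv : CTyping [] v Q₀.toC) :
    ∀ {e : PExpr d} {Q : PTy} (D : PTyping (some Q₀) e Q),
      ∃ D' : PTyping none (PExpr.subst 0 v e) Q,
        ∀ g, D.interp = some g → D'.interp = some (PHom.comp g Dv.global)
  | _, _, .var _ => ⟨.ofC Dv, fun g hg => by
      cases hg
      exact congrArg some (PHom.id_comp Dv.global).symm⟩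
  | .letIn e e', _, .letIn D E => by
      obtain ⟨D', hD'⟩ := exists_subst Dv D
      have he : PExpr.subst 1 v e' = e' := E.subst_eq le_rfl v
      rw [PExpr.subst, he]
      refine ⟨.letIn D' E, fun k hk => ?_⟩
      obtain ⟨f, hf, _⟩ := D.exists_interp
      obtain ⟨g, hg, _⟩ := E.exists_interp
      simp only [interp, hf, hg] at hk
      cases hk
      simp only [interp, hD' f hf, hg]
      exact congrArg some (PHom.comp_assoc g f Dv.global).symm
  | .phase a e, Q, .phase Da D => by
      obtain ⟨D', hD'⟩ := exists_subst Dv D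
      obtain ⟨Da'⟩ := Da.subst_zero Dv
      refine ⟨.phase Da' D', fun k hk => ?_⟩
      obtain ⟨f, hf, _⟩ := D.exists_interp
      simp only [interp, hf] at hk
      cases hk
      simp only [interp, hD' f hf]
      refine congrArg some (PHom.ext_unit ?_ rfl)
      refine Eq.trans ?_ (PHom.addPhase_comp (W := Q.den d)
        (Da.interp ∘ₗ PCtx.toTensor d (some Q₀)) f Dv.global).symm
      refine congrArg (· + (PHom.comp f Dv.global).phase) ?_
      -- The phase after substitution and the phase map evaluated at the vector of `v` are
      -- denotations of the same raw expression.
      have h1 := Da'.den_scalar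
      have h2 := Dv.den_global.subst_zero (Da.den_interp (.some Dv.global.vec (.nil [])))
      exact eq_of_heq (Sigma.mk.inj (h1.unique h2)).2
  | .caseXZ e ex ez, Q, .caseXZ D Dx Dz h => by
      obtain ⟨D', hD'⟩ := exists_subst Dv D
      have hx : PExpr.subst 0 v ex = ex := Dx.subst_eq le_rfl v
      have hz : PExpr.subst 0 v ez = ez := Dz.subst_eq le_rfl v
      rw [PExpr.subst, hx, hz]
      refine ⟨.caseXZ D' Dx Dz h, fun k hk => ?_⟩
      obtain ⟨f, hf, _⟩ := D.exists_interp
      obtain ⟨gx, hgx, _⟩ := Dx.exists_interp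
      obtain ⟨gz, hgz, _⟩ := Dz.exists_interp
      obtain ⟨k', hk', _⟩ := (PTyping.caseXZ D Dx Dz h).exists_interp
      simp only [interp, hf, hgx, hgz] at hk
      simp only [interp, hD' f hf, hgx, hgz]
      change (PHom.boxUnit gx gz).bind (fun g => some (PHom.comp g f)) = some k at hk
      change (PHom.boxUnit gx gz).bind (fun g => some (PHom.comp g (PHom.comp f Dv.global))) = _
      obtain ⟨g, hg, hk⟩ := Option.bind_eq_some_iff.1 hk
      cases hk
      rw [hg]
      exact congrArg some (PHom.comp_assoc g f Dv.global).symm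
  | .inl Q₂ e, .tensor Q₁ _, .inl _ D => by
      obtain ⟨D', hD'⟩ := exists_subst Dv D
      refine ⟨.inl Q₂ D', fun k hk => ?_⟩
      obtain ⟨f, hf, _⟩ := D.exists_interp
      simp only [interp, hf] at hk
      cases hk
      simp only [interp, hD' f hf]
      exact congrArg some (PHom.comp_assoc (PHom.inl (Q₁.den d) (Q₂.den d)) f Dv.global).symm
  | .inr Q₁ e, .tensor _ Q₂, .inr _ D => by
      obtain ⟨D', hD'⟩ := exists_subst Dv D
      refine ⟨.inr Q₁ D', fun k hk => ?_⟩
      obtain ⟨f, hf, _⟩ := D.exists_interp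
      simp only [interp, hf] at hk
      cases hk
      simp only [interp, hD' f hf]
      exact congrArg some (PHom.comp_assoc (PHom.inr (Q₁.den d) (Q₂.den d)) f Dv.global).symm
  | .caseIn e e₁ e₂, Q, .caseIn D D₁ D₂ h => by
      obtain ⟨D', hD'⟩ := exists_subst Dv D
      have h1 : PExpr.subst 1 v e₁ = e₁ := D₁.subst_eq le_rfl v
      have h2 : PExpr.subst 1 v e₂ = e₂ := D₂.subst_eq le_rfl v
      rw [PExpr.subst, h1, h2]
      refine ⟨.caseIn D' D₁ D₂ h, fun k hk => ?_⟩
      obtain ⟨f, hf, _⟩ := D.exists_interp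
      obtain ⟨g₁, hg₁, _⟩ := D₁.exists_interp
      obtain ⟨g₂, hg₂, _⟩ := D₂.exists_interp
      simp only [interp, hf, hg₁, hg₂] at hk
      simp only [interp, hD' f hf, hg₁, hg₂]
      change (PHom.boxPauli g₁ g₂).bind (fun g => some (PHom.comp g f)) = some k at hk
      change (PHom.boxPauli g₁ g₂).bind
        (fun g => some (PHom.comp g (PHom.comp f Dv.global))) = _
      obtain ⟨g, hg, hk⟩ := Option.bind_eq_some_iff.1 hk
      cases hk
      rw [hg]
      exact congrArg some (PHom.comp_assoc g f Dv.global).symm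

/-! Coordinates of values. -/

/-- The list `x_1, z_1, x_2, z_2, ...` of the entries of a coordinate vector. -/
def PTy.extList {R : Type} : (Q : PTy) → (Fin (Q.den d).rank → R) → List R
  | .pauli, a => [a (finSumFinEquiv (m := 1) (n := 1) (Sum.inl 0)),
      a (finSumFinEquiv (m := 1) (n := 1) (Sum.inr 0))]
  | .tensor Q₁ Q₂, a =>
      Q₁.extList (fun j => a (finSumFinEquiv (m := (Q₁.den d).rank) (Sum.inl j))) ++
        Q₂.extList (fun j => a (finSumFinEquiv (n := (Q₂.den d).rank) (Sum.inr j)))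

theorem PTy.map_extList {R S : Type} (f : R → S) (Q : PTy) (a : Fin (Q.den d).rank → R) :
    (Q.extList a).map f = Q.extList (fun j => f (a j)) := by
  induction Q with
  | pauli => rfl
  | tensor Q₁ Q₂ ih₁ ih₂ => simp only [extList, List.map_append, ih₁, ih₂]

theorem PTy.length_extList {R : Type} (Q : PTy) (a : Fin (Q.den d).rank → R) :
    (Q.extList a).length = 2 * Q.qudits := by
  induction Q with
  | pauli => rfl
  | tensor Q₁ Q₂ ih₁ ih₂ =>
    simp only [extList, List.length_append, ih₁, ih₂, qudits]
    ring

theorem PTy.zipWith_extList {R S T : Type} (f : R → S → T) (Q : PTy) (a : Fin (Q.den d).rank → R)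
    (b : Fin (Q.den d).rank → S) :
    List.zipWith f (Q.extList a) (Q.extList b) = Q.extList (fun j => f (a j) (b j)) := by
  induction Q with
  | pauli => rfl
  | tensor Q₁ Q₂ ih₁ ih₂ =>
    rw [extList, extList, List.zipWith_append (by rw [length_extList, length_extList]), ih₁, ih₂]
    rfl

/-- Both first parts have the same even length, so no conjugate pair straddles the boundary. -/
theorem listOmegaExt_append {n : ℕ} {u₁ u₂ v₁ v₂ : List (ZMod (dExt d))}
    (hu : u₁.length = 2 * n) (hv : v₁.length = 2 * n) :
    listOmegaExt (u₁ ++ u₂) (v₁ ++ v₂) = listOmegaExt u₁ v₁ + listOmegaExt u₂ v₂ := by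
  induction n generalizing u₁ v₁ with
  | zero =>
    rw [List.length_eq_zero_iff.1 hu, List.length_eq_zero_iff.1 hv]
    simp [listOmegaExt]
  | succ n ih =>
    match u₁, v₁, hu, hv with
    | x :: z :: u, x' :: z' :: v, hu, hv =>
      simp only [List.length_cons] at hu hv
      simp only [List.cons_append, listOmegaExt]
      rw [ih (by omega) (by omega), add_assoc]

theorem PTy.listOmegaExt_extList (Q : PTy) (a b : (Q.den d).ExtVec) :
    listOmegaExt (Q.extList a) (Q.extList b) = (Q.den d).omegaExt a b := by
  induction Q with
  | pauli =>
    refine Eq.trans ?_ (Fin.sum_univ_one _).symm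
    exact add_zero _
  | tensor Q₁ Q₂ ih₁ ih₂ =>
    rw [extList, extList, listOmegaExt_append (length_extList _ _) (length_extList _ _), ih₁, ih₂]
    exact (SObj.omegaExt_sum (V := Q₁.den d) (W := Q₂.den d) a b).symm

/-- This identifies the phases of the reduction rules, computed from syntax, with those of the
category, computed from coordinates in the chosen basis. -/
theorem CExpr.flatten_eq {Q : PTy} {v : CExpr d} (hv : v.IsVal) {y : Q.den d}
    (h : v.Den [] ⟨Q.toC, y⟩) :
    v.flatten = Q.extList (fun j => (Q.den d).basis.repr y j) := by
  induction Q generalizing v with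
  | pauli =>
    cases hv with
    | const r => cases h
    | lam α a => obtain ⟨_, _, _, e⟩ := h; cases e
    | pair h1 h2 =>
      obtain ⟨α, β, x, z, d1, d2, e⟩ := h
      cases e
      have hx : ∀ r s : ZMod d,
          (SObj.qudit d).basis.repr (r, s) (finSumFinEquiv (Sum.inl 0)) = r := fun r s => by simp
      have hz : ∀ r s : ZMod d,
          (SObj.qudit d).basis.repr (r, s) (finSumFinEquiv (Sum.inr 0)) = s := fun r s => by simp
      cases h1 with
      | pair _ _ => obtain ⟨_, _, _, _, _, _, e⟩ := d1; cases e
      | lam α a => obtain ⟨_, _, _, e⟩ := d1; cases e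
      | const r =>
        cases d1
        cases h2 with
        | pair _ _ => obtain ⟨_, _, _, _, _, _, e⟩ := d2; cases e
        | lam α a => obtain ⟨_, _, _, e⟩ := d2; cases e
        | const s =>
          cases d2
          exact (congrArg₂ (fun a b => [a, b]) (hx _ _) (hz _ _)).symm
  | tensor Q₁ Q₂ ih₁ ih₂ =>
    cases hv with
    | const r => cases h
    | lam α a => obtain ⟨_, _, _, e⟩ := h; cases e
    | pair h1 h2 =>
      obtain ⟨α, β, y₁, y₂, d1, d2, e⟩ := h
      cases e
      have e1 : ∀ j, ((Q₁.den d).sum (Q₂.den d)).basis.repr (y₁, y₂)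
          (finSumFinEquiv (Sum.inl j)) = (Q₁.den d).basis.repr y₁ j := fun j => by simp
      have e2 : ∀ j, ((Q₁.den d).sum (Q₂.den d)).basis.repr (y₁, y₂)
          (finSumFinEquiv (Sum.inr j)) = (Q₂.den d).basis.repr y₂ j := fun j => by simp
      rw [flatten, ih₁ h1 d1, ih₂ h2 d2]
      exact congrArg₂ _ (congrArg _ (funext fun j => (e1 j).symm))
        (congrArg _ (funext fun j => (e2 j).symm))

theorem CExpr.map_liftZ_flatten {Q : PTy} {v : CExpr d} (hv : v.IsVal) {y : Q.den d}
    (h : v.Den [] ⟨Q.toC, y⟩) : v.flatten.map liftZ = Q.extList ((Q.den d).lift y) := by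
  rw [CExpr.flatten_eq hv h, PTy.map_extList]
  rfl

theorem PTy.listSgn_extList (Q : PTy) (a : (Q.den d).ExtVec) :
    listSgn (Q.extList a) = (Q.den d).sgnVec a := by
  rw [listSgn, map_extList, listOmegaExt_extList]
  rfl

theorem starPhase_eq {Q : PTy} {v₁ v₂ : CExpr d} (hv₁ : v₁.IsVal) (hv₂ : v₂.IsVal)
    {y₁ y₂ : Q.den d} (h₁ : v₁.Den [] ⟨Q.toC, y₁⟩) (h₂ : v₂.Den [] ⟨Q.toC, y₂⟩) :
    starPhase v₁ v₂ = halfD d (sgn ((Q.den d).omegaExt ((Q.den d).lift y₁) ((Q.den d).lift y₂))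
      + (Q.den d).sgnVec ((Q.den d).lift y₁ + (Q.den d).lift y₂)) := by
  rw [starPhase, CExpr.map_liftZ_flatten hv₁ h₁, CExpr.map_liftZ_flatten hv₂ h₂,
    PTy.zipWith_extList, PTy.listSgn_extList, PTy.listOmegaExt_extList]
  rfl

theorem powPhase_eq {Q : PTy} {v : CExpr d} (hv : v.IsVal) {y : Q.den d} (r : ZMod d)
    (h : v.Den [] ⟨Q.toC, y⟩) :
    powPhase r v = halfD d ((Q.den d).sgnVec (liftZ r • (Q.den d).lift y)) := by
  have e : v.flatten.map (fun c => liftZ r * liftZ c) =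
      (v.flatten.map liftZ).map (fun c => liftZ r * c) := by
    rw [List.map_map]; rfl
  rw [powPhase, e, CExpr.map_liftZ_flatten hv h, PTy.map_extList, PTy.listSgn_extList]
  rfl

end
end ProjCliff

namespace ProjCliff
noncomputable section
set_option linter.unusedSectionVars false

variable {d : ℕ} [hd : Fact (1 < d)]

/-! Soundness of reduction. -/

theorem CTyping.scalar_const {r : ZMod d} (D : CTyping [] (.const r) .unit) :
    PHom.scalar (D.interp ∘ₗ PCtx.toTensor d none) = r :=
  eq_of_heq (Sigma.mk.inj D.den_scalar).2

theorem CTyping.interp_step {a a' : CExpr d} {α : CTy} (hs : CStep a a') (D : CTyping [] a α)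
    (D' : CTyping [] a' α) : D'.interp = D.interp :=
  LinearMap.ext_ring (eq_of_heq (Sigma.mk.inj
    ((D'.den_interp (.nil [])).unique ((D.den_interp (.nil [])).step hs))).2)

namespace PTyping

/-- The derivation of a normal form. -/
def nf {v : CExpr d} {Q : PTy} (r : ZMod d) (D : CTyping [] v Q.toC) : PTyping none (.nf r v) Q :=
  .phase (Θ := none) (.const r CCtx.IsEmpty.nil) (.ofC D)

theorem exists_interp_nf {v : CExpr d} {Q : PTy} {r : ZMod d} (D : PTyping none (.nf r v) Q) :
    ∃ (Dv : CTyping [] v Q.toC) (f : PHom .unit (Q.den d)), D.interp = some f ∧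
      f.phase = r ∧ f.vec = Dv.global.vec := by
  cases D with
  | phase Dr D =>
    cases D with
    | ofC Dv =>
      refine ⟨Dv, PHom.addPhase (A := .unit) (Dr.interp ∘ₗ PCtx.toTensor d none) Dv.global, rfl,
        ?_, rfl⟩
      exact (add_zero _).trans (CTyping.scalar_const Dr)

theorem interp_phase_const {e : PExpr d} {Q : PTy} (r : ZMod d) {D : PTyping none e Q}
    {f : PHom .unit (Q.den d)} (h : D.interp = some f) :
    ∃ m, PHom.scalar m = r ∧
      (PTyping.phase (Θ := none) (CTyping.const r CCtx.IsEmpty.nil) D).interp = some (PHom.addPhase (A := .unit) m f) := by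
  refine ⟨_, CTyping.scalar_const (.const r .nil), ?_⟩
  simp only [interp, h]
  rfl

theorem interp_nf {v : CExpr d} {Q : PTy} {r : ZMod d} (D : CTyping [] v Q.toC)
    {f : PHom .unit (Q.den d)} (hr : f.phase = r) (hv : v.Den [] ⟨Q.toC, f.vec⟩) :
    (nf r D).interp = some f := by
  obtain ⟨m, hm, h⟩ := interp_phase_const r (interp_ofC D)
  refine h.trans (congrArg some (PHom.ext_unit ?_ ?_))
  · exact (congrArg₂ _ hm D.global_phase).trans ((add_zero r).trans hr.symm)
  · exact eq_of_heq (Sigma.mk.inj (D.den_global.unique hv)).2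

/-- A normal form is a global element with prescribed phase and vector, so each rule becomes an
equation of phases and vectors. Substitution rules use `exists_subst`, the case rules also the
copairing equations. -/
theorem exists_beta {e e' : PExpr d} {Q : PTy} (hb : PBeta e e') (D : PTyping none e Q) :
    ∃ D' : PTyping none e' Q, D'.interp = D.interp := by
  cases hb with
  | letIn hv =>
    rename_i r v e'
    cases D with
    | letIn D E =>
      obtain ⟨Dv, f, hf, hfp, hfv⟩ := D.exists_interp_nf
      obtain ⟨g, hg, _⟩ := E.exists_interp
      obtain ⟨E', hE'⟩ := exists_subst Dv E
      obtain ⟨m, hm, h⟩ := interp_phase_const r (hE' g hg)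
      refine ⟨_, h.trans ?_⟩
      simp only [interp, hf, hg]
      refine congrArg some (PHom.ext_unit ?_ ?_)
      · refine (congrArg₂ _ hm (PHom.comp_phase g Dv.global)).trans
          (Eq.trans ?_ (PHom.comp_phase g f).symm)
        rw [hfp, hfv, CTyping.global_phase, zero_add]
        exact (add_assoc _ _ _).symm
      · exact congrArg g.lin hfv.symm
  | phase hv =>
    rename_i r' r v
    cases D with
    | phase Dr D =>
      obtain ⟨Dv, f, hf, hfp, hfv⟩ := D.exists_interp_nf
      refine ⟨nf (r' + r) Dv, ?_⟩
      simp only [interp, hf]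
      refine interp_nf Dv (congrArg₂ _ (CTyping.scalar_const Dr) hfp) ?_
      exact hfv ▸ Dv.den_global
  | star hv₁ hv₂ =>
    rename_i r₁ r₂ v₁ v₂
    cases D with
    | star D₁ D₂ =>
      obtain ⟨Dv₁, f₁, hf₁, hp₁, h₁⟩ := D₁.exists_interp_nf
      obtain ⟨Dv₂, f₂, hf₂, hp₂, h₂⟩ := D₂.exists_interp_nf
      refine ⟨nf _ (.add Dv₁ Dv₂), ?_⟩
      simp only [interp, hf₁, hf₂]
      have d₁ := h₁ ▸ Dv₁.den_global
      have d₂ := h₂ ▸ Dv₂.den_global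
      refine interp_nf _ ?_ ⟨Q.toC, f₁.vec, f₂.vec, d₁, d₂, rfl⟩
      rw [starPhase_eq hv₁ hv₂ d₁ d₂, ← hp₁, ← hp₂]
      exact (one_smul (ZMod d) _).trans (congrArg _ (mul_one (M := ZMod d) _))
  | pow hv =>
    rename_i r r' v
    cases D with
    | pow _ D =>
      obtain ⟨Dv, f, hf, hp, h⟩ := D.exists_interp_nf
      refine ⟨nf _ (.smul .nil (.const r' .nil) Dv), ?_⟩
      simp only [interp, hf]
      have d₁ := h ▸ Dv.den_global
      refine interp_nf _ ?_ ⟨r', Q.toC, f.vec, rfl, d₁, congrArg _ (PHom.compUnit_vec f r')⟩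
      rw [powPhase_eq hv r' d₁, ← hp]
      refine (PHom.compUnit_phase f r').trans ?_
      rw [← SObj.sgnVec_eq]
  | caseXZ =>
    rename_i r rx rz ex ez
    cases D with
    | caseXZ D Dx Dz h =>
      obtain ⟨k, hk, _⟩ := (PTyping.caseXZ D Dx Dz h).exists_interp
      obtain ⟨Dv, f, hf, hfp, hfv⟩ := D.exists_interp_nf
      obtain ⟨gx, hgx, _⟩ := Dx.exists_interp
      obtain ⟨gz, hgz, _⟩ := Dz.exists_interp
      have hs : (PTyping.star (.pow rz Dz) (.pow rx Dx)).interp = some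
          (PHom.star (PHom.compUnit gz (rz • LinearMap.id))
            (PHom.compUnit gx (rx • LinearMap.id))) := by
        simp only [interp, hgx, hgz]
        rfl
      obtain ⟨m, hm, h'⟩ :=
        interp_phase_const (r + halfD d (sgn (liftZ rx * liftZ rz))) hs
      refine ⟨_, h'.trans ?_⟩
      rw [hk]
      simp only [interp, hf, hgx, hgz] at hk
      change (PHom.boxUnit gx gz).bind (fun g => some (PHom.comp g f)) = some k at hk
      obtain ⟨g, hg, hk⟩ := Option.bind_eq_some_iff.1 hk
      refine Eq.trans (congrArg some ?_) hk
      refine (PHom.boxUnit_comp hg ?_ (hm.trans (congrArg (· + _) hfp.symm))).symm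
      -- The vector of the scrutinee is read off from the shape of the value, because denotations
      -- are unique.
      have h0 : (CExpr.pair (.const rx) (.const rz)).Den []
          ⟨PTy.pauli.toC, ((rx, rz) : ZMod d × ZMod d)⟩ := ⟨.unit, .unit, rx, rz, rfl, rfl, rfl⟩
      exact hfv.trans (eq_of_heq (Sigma.mk.inj (Dv.den_global.unique h0)).2)
  | inl hv =>
    rename_i Q₂ r v
    cases D with
    | inl _ D =>
      obtain ⟨Dv, f, hf, hp, h⟩ := D.exists_interp_nf
      refine ⟨nf r (.pair Dv (.zero [] Q₂.toC)), ?_⟩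
      simp only [interp, hf]
      refine interp_nf (Q := .tensor _ Q₂) _ ((PHom.inl_comp f).1.trans hp) ?_
      have d₁ := h ▸ Dv.den_global
      exact ⟨_, _, _, _, d₁, rfl, rfl⟩
  | inr hv =>
    rename_i Q₁ r v
    cases D with
    | inr _ D =>
      obtain ⟨Dv, f, hf, hp, h⟩ := D.exists_interp_nf
      refine ⟨nf r (.pair (.zero [] Q₁.toC) Dv), ?_⟩
      simp only [interp, hf]
      refine interp_nf (Q := .tensor Q₁ _) _ ((PHom.inr_comp f).1.trans hp) ?_
      have d₁ := h ▸ Dv.den_global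
      exact ⟨_, _, _, _, rfl, d₁, rfl⟩
  | caseIn hv₁ hv₂ =>
    rename_i r v₁ v₂ e₁ e₂
    cases D with
    | caseIn D D₁ D₂ h =>
      rename_i Q₁ Q₂
      obtain ⟨k, hk, _⟩ := (PTyping.caseIn D D₁ D₂ h).exists_interp
      obtain ⟨Dv, f, hf, hfp, hfv⟩ := D.exists_interp_nf
      obtain ⟨g₁, hg₁, _⟩ := D₁.exists_interp
      obtain ⟨g₂, hg₂, _⟩ := D₂.exists_interp
      obtain ⟨⟨Dv₁⟩, ⟨Dv₂⟩⟩ : Nonempty (CTyping [] v₁ Q₁.toC) ∧ Nonempty (CTyping [] v₂ Q₂.toC) := by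
        have Dv' : CTyping [] (.pair v₁ v₂) (.sum Q₁.toC Q₂.toC) := Dv
        cases Dv' with
        | pair Dv₁ Dv₂ => exact ⟨⟨Dv₁⟩, ⟨Dv₂⟩⟩
      obtain ⟨E₁, hE₁⟩ := exists_subst Dv₁ D₁
      obtain ⟨E₂, hE₂⟩ := exists_subst Dv₂ D₂
      have hs : (PTyping.star E₁ E₂).interp = some
          (PHom.star (PHom.comp g₁ Dv₁.global) (PHom.comp g₂ Dv₂.global)) := by
        simp only [interp, hE₁ g₁ hg₁, hE₂ g₂ hg₂]
        rfl
      obtain ⟨m, hm, h'⟩ := interp_phase_const r hs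
      refine ⟨_, h'.trans ?_⟩
      rw [hk]
      simp only [interp, hf, hg₁, hg₂] at hk
      change (PHom.boxPauli g₁ g₂).bind (fun g => some (PHom.comp g f)) = some k at hk
      obtain ⟨g, hg, hk⟩ := Option.bind_eq_some_iff.1 hk
      refine Eq.trans (congrArg some ?_) hk
      -- Values carry no phase of their own; the phase of the scrutinee is entirely in the outer
      -- factor.
      refine (PHom.boxPauli_comp hg ?_ Dv₁.global_phase Dv₂.global_phase
        (hm.trans hfp.symm)).symm
      have h0 : (CExpr.pair v₁ v₂).Den []
          ⟨(PTy.tensor Q₁ Q₂).toC, ((Dv₁.global.vec, Dv₂.global.vec) : Q₁.den d × Q₂.den d)⟩ :=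
        ⟨_, _, _, _, Dv₁.den_global, Dv₂.den_global, rfl⟩
      exact hfv.trans (eq_of_heq (Sigma.mk.inj (Dv.den_global.unique h0)).2)
  | eta hv =>
    cases D with
    | ofC Dv =>
      refine ⟨nf 0 Dv, ?_⟩
      rw [interp_ofC]
      exact interp_nf Dv Dv.global_phase Dv.den_global

/-- The interpretation is compositional, and the side conditions of the case rules do not mention
the scrutinee, so they survive its reduction unchanged. -/
theorem exists_step {e e' : PExpr d} {Q : PTy} (D : PTyping none e Q) (hs : PStep e e') :
    ∃ D' : PTyping none e' Q, D'.interp = D.interp := by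
  induction hs generalizing Q with
  | beta hb => exact exists_beta hb D
  | letIn _ ih =>
    cases D with
    | letIn D E =>
      obtain ⟨D', h⟩ := ih D
      exact ⟨.letIn D' E, by simp only [interp, h]⟩
  | ofC hs =>
    cases D with
    | ofC D =>
      obtain ⟨D'⟩ := D.step hs
      exact ⟨.ofC D', by simp only [interp, CTyping.interp_step hs D D']⟩
  | phase_left hs =>
    cases D with
    | phase Da D =>
      obtain ⟨Da'⟩ := CTyping.step hs Da
      exact ⟨.phase Da' D, by
        simp only [interp]
        exact congrArg (fun m => D.interp.bind fun f => some
          (PHom.addPhase (A := .unit) (m ∘ₗ PCtx.toTensor d none) f))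
          (CTyping.interp_step hs Da Da')⟩
  | phase_right _ ih =>
    cases D with
    | phase Da D =>
      obtain ⟨D', h⟩ := ih D
      exact ⟨.phase Da D', by simp only [interp, h]⟩
  | star_left _ ih =>
    cases D with
    | star D E =>
      obtain ⟨D', h⟩ := ih D
      exact ⟨.star D' E, by rw [interp, h]; rfl⟩
  | star_right _ _ ih =>
    cases D with
    | star D E =>
      obtain ⟨E', h⟩ := ih E
      exact ⟨.star D E', by rw [interp, h]; rfl⟩
  | pow _ ih =>
    cases D with
    | pow _ D =>
      obtain ⟨D', h⟩ := ih D
      exact ⟨.pow _ D', by rw [interp, h]; rfl⟩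
  | caseXZ _ ih =>
    cases D with
    | caseXZ D Dx Dz hω =>
      obtain ⟨D', h⟩ := ih D
      exact ⟨.caseXZ D' Dx Dz hω, by simp only [interp, h]⟩
  | inl _ ih =>
    cases D with
    | inl _ D =>
      obtain ⟨D', h⟩ := ih D
      exact ⟨.inl _ D', by simp only [interp, h]⟩
  | inr _ ih =>
    cases D with
    | inr _ D =>
      obtain ⟨D', h⟩ := ih D
      exact ⟨.inr _ D', by simp only [interp, h]⟩
  | caseIn _ ih =>
    cases D with
    | caseIn D D₁ D₂ hω =>
      obtain ⟨D', h⟩ := ih D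
      exact ⟨.caseIn D' D₁ D₂ hω, by simp only [interp, h]⟩

end PTyping

end
end ProjCliff

theorem mainTheorem1 (d : ℕ) (hd : 2 ≤ d) (Q : ProjCliff.PTy) (e e' : ProjCliff.PExpr d)
    (D : ProjCliff.PTyping none e Q) (hstep : ProjCliff.PStep e e') :
    ∃ γ : ProjCliff.PHom (ProjCliff.PObj.unit : ProjCliff.PObj d) (Q.den d),
      D.interp = some γ ∧
      Nonempty (ProjCliff.PTyping none e' Q) ∧
      ∀ D' : ProjCliff.PTyping none e' Q, D'.interp = some γ := by
  have : Fact (1 < d) := ⟨hd⟩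
  obtain ⟨γ, hγ, _⟩ := D.exists_interp
  obtain ⟨E, hE⟩ := D.exists_step hstep
  -- Subject reduction produces one derivation with the right interpretation; coherence extends this
  -- to all derivations.
  exact ⟨γ, hγ, ⟨E⟩, fun D' => (D'.interp_unique E).trans (hE.trans hγ)⟩
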